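/- Let $n\ge 1$, $R,h>0$, and let $\Omega=C_{R,h}=\{x=(x',x_n)\in\mathbb{R}^{n-1}\times\mathbb{R}: |x'|<R,\ |x_n|<h\}$. Let $V,W\in L^2(\Omega)$ be real-valued functions such that the set $$S(\Omega)=\{v\in H^1(\Omega): V\le v\le W \text{ a.e. in } \Omega\}$$ is non-empty (as is the case, for instance, when $V\in H^1(\Omega)$ and $V\le W$ a.e.). For $v\in H^1(\Omega)$ put $$I(v,\Omega)=\int_\Omega \left(|\nabla v|^2+\chi_{\{|v|<1\}}\right)dx .$$ Then there exists $u\in S(\Omega)$ such that $$I(u,\Omega)=\inf_{v\in S(\Omega)} I(v,\Omega).$$ Moreover, if $V$ and $W$ are monotonically increasing (i.e. non-decreasing) in the $x_n$-variable on $\Omega$, then such a minimizer $u\in S(\Omega)$ can be chosen to be (that is, to have a representative that is) monotonically increasing in the $x_n$-variable on $\Omega$. -/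

import Mathlib

open MeasureTheory
open scoped ENNReal ContDiff

/-- The right cylinder `C_{R,h} = {x = (x', xₙ) : |x'| < R, |xₙ| < h}` in `ℝⁿ`, `n = d + 1`, where
`x'` collects the first `d` coordinates and `xₙ` is the last one. -/
def rightCylinder (d : ℕ) (R h : ℝ) : Set (EuclideanSpace ℝ (Fin (d + 1))) :=
  {x | ‖WithLp.toLp 2 (fun i : Fin d => x i.castSucc)‖ < R ∧ |x (Fin.last d)| < h}

/-- `g` is a weak (distributional) gradient of `v` on the open set `Ω`. -/
structure IsWeakGradient {n : ℕ} (Ω : Set (EuclideanSpace ℝ (Fin n)))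
    (v : EuclideanSpace ℝ (Fin n) → ℝ)
    (g : EuclideanSpace ℝ (Fin n) → EuclideanSpace ℝ (Fin n)) : Prop where
  locallyIntegrableOn : LocallyIntegrableOn v Ω volume
  locallyIntegrableOn_grad : LocallyIntegrableOn g Ω volume
  integral_eq : ∀ φ : EuclideanSpace ℝ (Fin n) → ℝ, ContDiff ℝ ∞ φ → HasCompactSupport φ →
    tsupport φ ⊆ Ω → ∀ i : Fin n,
      ∫ x in Ω, v x * fderiv ℝ φ x (EuclideanSpace.single i 1) = -∫ x in Ω, g x i * φ x

/-- `v ∈ H¹(Ω)`: both `v` and a weak gradient of `v` are square integrable on `Ω`. -/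
def MemH1 {n : ℕ} (Ω : Set (EuclideanSpace ℝ (Fin n)))
    (v : EuclideanSpace ℝ (Fin n) → ℝ) : Prop :=
  MemLp v 2 (volume.restrict Ω) ∧ ∃ g, IsWeakGradient Ω v g ∧ MemLp g 2 (volume.restrict Ω)

open Classical in
/-- The weak gradient of `v` on `Ω` (any representative; it is unique almost everywhere on an open
set `Ω`), and `0` if there is none. -/
noncomputable def weakGradient {n : ℕ} (Ω : Set (EuclideanSpace ℝ (Fin n)))
    (v : EuclideanSpace ℝ (Fin n) → ℝ) : EuclideanSpace ℝ (Fin n) → EuclideanSpace ℝ (Fin n) :=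
  if hv : ∃ g, IsWeakGradient Ω v g then hv.choose else 0

/-- Weak gradients are unique almost everywhere, so that `weakGradient` is well defined. -/
theorem IsWeakGradient.ae_eq_weakGradient {n : ℕ} {Ω : Set (EuclideanSpace ℝ (Fin n))}
    (hΩ : IsOpen Ω) {v : EuclideanSpace ℝ (Fin n) → ℝ}
    {g : EuclideanSpace ℝ (Fin n) → EuclideanSpace ℝ (Fin n)} (hg : IsWeakGradient Ω v g) :
    weakGradient Ω v =ᵐ[volume.restrict Ω] g := by
  have hex : ∃ g, IsWeakGradient Ω v g := ⟨g, hg⟩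
  have hw : IsWeakGradient Ω v (weakGradient Ω v) := by
    rw [weakGradient, dif_pos hex]
    exact hex.choose_spec
  set w := weakGradient Ω v
  have hcomp : ∀ {f : EuclideanSpace ℝ (Fin n) → EuclideanSpace ℝ (Fin n)} (i : Fin n),
      LocallyIntegrableOn f Ω volume → LocallyIntegrableOn (fun x => f x i) Ω volume := by
    intro f i hf x hx
    obtain ⟨U, hU, hfU⟩ := hf x hx
    exact ⟨U, hU, (EuclideanSpace.proj (𝕜 := ℝ) i).integrable_comp hfU⟩
  have key : ∀ i : Fin n, ∀ᵐ x ∂volume, x ∈ Ω → w x i - g x i = 0 := by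
    intro i
    have hwi := hcomp i hw.locallyIntegrableOn_grad
    have hgi := hcomp i hg.locallyIntegrableOn_grad
    refine hΩ.ae_eq_zero_of_integral_contDiff_smul_eq_zero (hwi.sub hgi) ?_
    intro φ hφ hc hs
    have hint : ∀ {f : EuclideanSpace ℝ (Fin n) → ℝ}, LocallyIntegrableOn f Ω volume →
        Integrable (fun x => φ x • f x) := by
      intro f hf
      have hK := (hf.integrableOn_compact_subset hs hc).continuousOn_smul
        hφ.continuous.continuousOn hc
      refine (integrableOn_iff_integrable_of_support_subset fun x hx => ?_).1 hK
      refine subset_tsupport φ fun h0 => hx ?_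
      simp only [h0, zero_smul]
    have hset : ∀ f : EuclideanSpace ℝ (Fin n) → ℝ,
        ∫ x in Ω, f x * φ x = ∫ x, φ x • f x := by
      intro f
      simp_rw [mul_comm, smul_eq_mul]
      refine setIntegral_eq_integral_of_forall_compl_eq_zero fun x hx => ?_
      rw [image_eq_zero_of_notMem_tsupport fun h => hx (hs h), zero_mul]
    have h1 := hw.integral_eq φ hφ hc hs i
    have h2 := hg.integral_eq φ hφ hc hs i
    rw [hset] at h1 h2
    simp only [smul_sub]
    rw [integral_sub (hint hwi) (hint hgi)]
    linarith
  rw [Filter.EventuallyEq, ae_restrict_iff' hΩ.measurableSet]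
  filter_upwards [ae_all_iff.2 key] with x hx hxΩ
  ext i
  exact sub_eq_zero.1 (hx i hxΩ)

/-- The functional `I(v, Ω) = ∫_Ω |∇v|² + χ_{|v| < 1}`. -/
noncomputable def energy {n : ℕ} (Ω : Set (EuclideanSpace ℝ (Fin n)))
    (v : EuclideanSpace ℝ (Fin n) → ℝ) : ℝ≥0∞ :=
  ∫⁻ x in Ω, (‖weakGradient Ω v x‖ₑ ^ 2 + Set.indicator {y | |v y| < 1} 1 x)

/-- The constraint set `S(Ω) = {v ∈ H¹(Ω) : V ≤ v ≤ W a.e. in Ω}`. -/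
def constraintSet {n : ℕ} (Ω : Set (EuclideanSpace ℝ (Fin n)))
    (V W : EuclideanSpace ℝ (Fin n) → ℝ) : Set (EuclideanSpace ℝ (Fin n) → ℝ) :=
  {v | MemH1 Ω v ∧ ∀ᵐ x ∂volume.restrict Ω, V x ≤ v x ∧ v x ≤ W x}

/-- `v` is monotonically increasing in the last variable `xₙ` on `Ω`. -/
def IsMonotoneLast {d : ℕ} (Ω : Set (EuclideanSpace ℝ (Fin (d + 1))))
    (v : EuclideanSpace ℝ (Fin (d + 1)) → ℝ) : Prop :=
  ∀ x ∈ Ω, ∀ y ∈ Ω, (∀ i : Fin d, x i.castSucc = y i.castSucc) →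
    x (Fin.last d) ≤ y (Fin.last d) → v x ≤ v y

/-! Existence is the direct method, carried out with translations. Every member of the constraint
set is dominated a.e. by the fixed `L²` function `|V| + |W|`. A square integrable weak derivative
makes translation Lipschitz in `L²` (`eLpNorm_shift_sub_le`, where convexity of the cylinder
enters). Domination plus equicontinuity under translations give an a.e. convergent subsequence by a
Kolmogorov–Riesz argument (`exists_subseq_ae_tendsto`): translation is compared only where both
points lie in `Ω`, and the remaining boundary layer costs little mass of the dominating function.
The gradient of the limit is a weak limit of difference quotients, so its norm is lower
semicontinuous (`exists_isWeakDerivAlong_of_tendsto`). The volume of `{|v| < 1}` is lower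
semicontinuous by Fatou, because `{|t| < 1}` is open.

For monotonicity, a minimizer is rearranged increasingly on vertical lines, in discrete form. The
cylinder is cut into `m + 1` slices, and above each point of the lowest slice the `m + 1` values one
mesh size apart are sorted. Three facts about sorting finite tuples carry the argument. It keeps the
multiset of values, hence the phase volume. It is an `ℓ²` contraction (`sum_sq_sub_sortedTuple_le`),
hence does not increase horizontal differences. It does not increase the sum of squared consecutive
differences (`sum_sq_sortedTuple_succ_sub_le`), hence does not increase vertical differences at
exactly one mesh size. It also respects monotone bounds, so the constraint survives.

The sorted functions may jump between slices and so need not be in `H¹`. Only finite differences of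
them are ever estimated, and weak differentiability reappears in the limit `m → ∞`. For this reason
the compactness principle `exists_subseq_tendsto_memH1_energy_le` is phrased through difference
quotients along a sequence of steps; it serves both halves of the theorem.

The sorted functions increase along multiples of the mesh size. In the limit the averages over balls
increase under every upward shift, and Lebesgue differentiation turns this into a representative
that is monotone at every point (`exists_ae_eq_isMonotoneLast`). -/

open Filter Topology

/-! ### Sorting finite tuples of real numbers -/

/-- The non-decreasing rearrangement of a finite tuple. -/
noncomputable def sortedTuple {N : ℕ} (x : Fin N → ℝ) : Fin N → ℝ := x ∘ Tuple.sort x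

theorem monotone_sortedTuple {N : ℕ} (x : Fin N → ℝ) : Monotone (sortedTuple x) :=
  Tuple.monotone_sort x

theorem sum_sortedTuple {N : ℕ} {M : Type*} [AddCommMonoid M] (x : Fin N → ℝ) (f : ℝ → M) :
    ∑ j, f (sortedTuple x j) = ∑ j, f (x j) :=
  Equiv.sum_comp (Tuple.sort x) fun j => f (x j)

/-- This is the rearrangement inequality: two increasing tuples are similarly ordered, and
reindexing by the sorting permutation of `y` shows the left side as a permuted pairing of them. -/
theorem sum_mul_le_sum_sortedTuple_mul {N : ℕ} (x y : Fin N → ℝ) :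
    ∑ j, x j * y j ≤ ∑ j, sortedTuple x j * sortedTuple y j := by
  have hmono : Monovary (sortedTuple x) (sortedTuple y) :=
    (monotone_sortedTuple x).monovary (monotone_sortedTuple y)
  have := hmono.sum_comp_perm_mul_le_sum_mul (σ := (Tuple.sort y).trans (Tuple.sort x).symm)
  refine le_trans (le_of_eq ?_) this
  rw [← Equiv.sum_comp (Tuple.sort y)]
  simp [sortedTuple]

/-- Sorting is a contraction for the Euclidean norm. -/
theorem sum_sq_sub_sortedTuple_le {N : ℕ} (x y : Fin N → ℝ) :
    ∑ j, (sortedTuple x j - sortedTuple y j) ^ 2 ≤ ∑ j, (x j - y j) ^ 2 := by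
  simp only [sub_sq, Finset.sum_add_distrib, Finset.sum_sub_distrib, mul_assoc, ← Finset.mul_sum]
  rw [sum_sortedTuple x (· ^ 2), sum_sortedTuple y (· ^ 2)]
  linarith [sum_mul_le_sum_sortedTuple_mul x y]

/-- A consequence of the contraction property; it is what makes the sorted functions measurable
later. -/
theorem continuous_sortedTuple {N : ℕ} : Continuous (sortedTuple (N := N)) := by
  rw [continuous_pi_iff]
  intro j
  rw [continuous_iff_continuousAt]
  intro x
  have hlim : Filter.Tendsto (fun y : Fin N → ℝ => √(∑ i, (y i - x i) ^ 2)) (nhds x) (nhds 0) := by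
    have : Continuous fun y : Fin N → ℝ => √(∑ i, (y i - x i) ^ 2) := by fun_prop
    simpa using this.tendsto x
  rw [ContinuousAt, tendsto_iff_dist_tendsto_zero]
  refine squeeze_zero (fun _ => dist_nonneg) (fun y => ?_) hlim
  rw [Real.dist_eq]
  refine Real.abs_le_sqrt (le_trans ?_ (sum_sq_sub_sortedTuple_le y x))
  exact Finset.single_le_sum (f := fun i => (sortedTuple y i - sortedTuple x i) ^ 2)
    (fun i _ => sq_nonneg _) (Finset.mem_univ j)

/-- Pigeonhole: the positions in `x` of its `j + 1` smallest entries cannot all be below `j`. One of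
them is a position at or above `j`, where `x` is already at least `y j`. -/
theorem le_sortedTuple {N : ℕ} {x y : Fin N → ℝ} (hy : Monotone y) (h : ∀ j, y j ≤ x j)
    (j : Fin N) : y j ≤ sortedTuple x j := by
  obtain ⟨k, hk, hjk⟩ : ∃ k ≤ j, j ≤ Tuple.sort x k := by
    by_contra! hcon
    have hsub : (Finset.Iic j).image (Tuple.sort x) ⊆ Finset.Iio j := by
      intro i hi
      obtain ⟨k, hk, rfl⟩ := Finset.mem_image.1 hi
      exact Finset.mem_Iio.2 (hcon k (Finset.mem_Iic.1 hk))
    have := Finset.card_le_card hsub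
    rw [Finset.card_image_of_injective _ (Tuple.sort x).injective] at this
    simp at this
  exact (hy hjk).trans ((h _).trans (monotone_sortedTuple x hk))

theorem sortedTuple_le {N : ℕ} {x y : Fin N → ℝ} (hy : Monotone y) (h : ∀ j, x j ≤ y j)
    (j : Fin N) : sortedTuple x j ≤ y j := by
  obtain ⟨k, hk, hjk⟩ : ∃ k ≥ j, Tuple.sort x k ≤ j := by
    by_contra! hcon
    have hsub : (Finset.Ici j).image (Tuple.sort x) ⊆ Finset.Ioi j := by
      intro i hi
      obtain ⟨k, hk, rfl⟩ := Finset.mem_image.1 hi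
      exact Finset.mem_Ioi.2 (hcon k (Finset.mem_Ici.1 hk))
    have := Finset.card_le_card hsub
    rw [Finset.card_image_of_injective _ (Tuple.sort x).injective] at this
    simp at this
    omega
  exact (monotone_sortedTuple x hk).trans ((h _).trans (hy hjk))

/-- The gaps are nonnegative, so the sum of their squares is at most the square of their sum, which
telescopes. -/
theorem sum_sq_gaps_le {Y : ℕ → ℝ} (hY : Monotone Y) {a b : ℕ} (hab : a ≤ b) :
    ∑ i ∈ Finset.Ico a b, (Y (i + 1) - Y i) ^ 2 ≤ (Y b - Y a) ^ 2 := by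
  induction b, hab using Nat.le_induction with
  | base => simp
  | succ b hab ih =>
    rw [Finset.sum_Ico_succ_top hab]
    nlinarith [hY hab, hY (Nat.le_succ b), mul_nonneg (sub_nonneg.2 (hY hab))
      (sub_nonneg.2 (hY (Nat.le_succ b)))]

/-- A discrete intermediate value theorem: a path that is at or below `i` at one time and above `i`
at another must cross the edge from `i` to `i + 1`. The two times may come in either order. -/
theorem exists_crossing {p : ℕ → ℕ} {a b i : ℕ} (ha : p a ≤ i) (hb : i < p b) (m : ℕ)
    (ham : a ≤ m) (hbm : b ≤ m) :
    ∃ j < m, i ∈ Finset.Ico (min (p j) (p (j + 1))) (max (p j) (p (j + 1))) := by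
  by_contra! hcon
  have hiff : ∀ j ≤ m, (p j ≤ i ↔ p 0 ≤ i) := by
    intro j
    induction j with
    | zero => simp
    | succ j ih =>
      intro hj
      have h1 := hcon j (by omega)
      have h2 := ih (by omega)
      rw [Finset.mem_Ico] at h1
      rw [← h2]
      omega
  have h1 := (hiff a ham).1 ha
  have h2 := (hiff b hbm).2 h1
  omega

theorem sum_biUnion_le_sum_of_nonneg (s : Finset ℕ) (C : ℕ → Finset ℕ) {f : ℕ → ℝ}
    (hf : ∀ i, 0 ≤ f i) : ∑ i ∈ s.biUnion C, f i ≤ ∑ j ∈ s, ∑ i ∈ C j, f i := by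
  classical
  induction s using Finset.induction_on with
  | empty => simp
  | insert a s ha ih =>
    rw [Finset.biUnion_insert, Finset.sum_insert ha]
    have := Finset.sum_union_inter (s₁ := C a) (s₂ := s.biUnion C) (f := f)
    have h0 : 0 ≤ ∑ i ∈ C a ∩ s.biUnion C, f i := Finset.sum_nonneg fun i _ => hf i
    linarith

/-- Each step of the path pays for all the gaps it jumps over, and by hypothesis every gap is jumped
over at least once. -/
theorem sum_sq_gaps_le_sum_sq_steps {Y : ℕ → ℝ} (hY : Monotone Y) {p : ℕ → ℕ} {m : ℕ}
    (hp : ∀ i < m, ∃ j < m, i ∈ Finset.Ico (min (p j) (p (j + 1))) (max (p j) (p (j + 1)))) :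
    ∑ i ∈ Finset.range m, (Y (i + 1) - Y i) ^ 2
      ≤ ∑ j ∈ Finset.range m, (Y (p (j + 1)) - Y (p j)) ^ 2 := by
  let C : ℕ → Finset ℕ := fun j => Finset.Ico (min (p j) (p (j + 1))) (max (p j) (p (j + 1)))
  calc ∑ i ∈ Finset.range m, (Y (i + 1) - Y i) ^ 2
      ≤ ∑ i ∈ (Finset.range m).biUnion C, (Y (i + 1) - Y i) ^ 2 := by
        refine Finset.sum_le_sum_of_subset_of_nonneg ?_ fun _ _ _ => sq_nonneg _
        intro i hi
        obtain ⟨j, hj, hij⟩ := hp i (Finset.mem_range.1 hi)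
        exact Finset.mem_biUnion.2 ⟨j, Finset.mem_range.2 hj, hij⟩
    _ ≤ ∑ j ∈ Finset.range m, ∑ i ∈ C j, (Y (i + 1) - Y i) ^ 2 :=
        sum_biUnion_le_sum_of_nonneg _ _ fun _ => sq_nonneg _
    _ ≤ _ := by
        refine Finset.sum_le_sum fun j _ => (sum_sq_gaps_le hY min_le_max).trans (le_of_eq ?_)
        rcases le_total (p j) (p (j + 1)) with h | h
        · rw [min_eq_left h, max_eq_right h]
        · rw [min_eq_right h, max_eq_left h]; ring

/-- Sorting does not increase the sum of the squares of the consecutive differences. -/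
theorem sum_sq_sortedTuple_succ_sub_le {m : ℕ} (x : Fin (m + 1) → ℝ) :
    ∑ j : Fin m, (sortedTuple x j.succ - sortedTuple x j.castSucc) ^ 2
      ≤ ∑ j : Fin m, (x j.succ - x j.castSucc) ^ 2 := by
  set σ := Tuple.sort x
  -- Clamping to `Fin (m + 1)` allows natural number indices. `Y` lists the sorted values and `p k`
  -- is the rank of the `k`-th entry, so the original tuple is a path through the sorted values.
  let c : ℕ → Fin (m + 1) := fun k => ⟨min k m, by omega⟩
  let Y : ℕ → ℝ := fun k => sortedTuple x (c k)
  let p : ℕ → ℕ := fun k => (σ.symm (c k) : ℕ)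
  have hY : Monotone Y := fun a b hab => monotone_sortedTuple x
    (Fin.mk_le_mk.2 (min_le_min_right m hab))
  have hc : ∀ k : Fin (m + 1), c k = k := fun k => Fin.ext (by simp [c]; omega)
  have hYp : ∀ k, Y (p k) = x (c k) := fun k => by
    simp only [Y, p, hc]
    simp [sortedTuple, σ]
  have hpσ : ∀ k : Fin (m + 1), p (σ k) = k := fun k => by simp [p, hc]
  have := sum_sq_gaps_le_sum_sq_steps hY (p := p) (m := m) fun i hi => by
    -- The path of ranks visits rank `0` at position `σ 0` and rank `m` at position `σ (Fin.last
    -- m)`, so it crosses every gap.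
    refine exists_crossing (a := σ 0) (b := σ (Fin.last m)) ?_ ?_ m (by omega) (by omega)
    · rw [hpσ]; simp
    · rw [hpσ]; simpa using hi
  rw [← Fin.sum_univ_eq_sum_range (fun i => (Y (i + 1) - Y i) ^ 2),
    ← Fin.sum_univ_eq_sum_range (fun j => (Y (p (j + 1)) - Y (p j)) ^ 2)] at this
  refine le_trans (le_of_eq ?_) (this.trans (le_of_eq ?_))
  · refine Finset.sum_congr rfl fun j _ => ?_
    rw [← hc j.succ, ← hc j.castSucc]; rfl
  · refine Finset.sum_congr rfl fun j _ => ?_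
    rw [hYp, hYp, ← hc j.succ, ← hc j.castSucc]; rfl

/-! ### Weak compactness and duality in `L²` -/

/-- Sequential Banach–Alaoglu in the dual, carried back to `H` by the Riesz isometry. -/
theorem exists_subseq_weakly_tendsto {H : Type*} [NormedAddCommGroup H] [InnerProductSpace ℝ H]
    [CompleteSpace H] [TopologicalSpace.SeparableSpace H] (F : ℕ → H) {C : ℝ}
    (hF : ∀ k, ‖F k‖ ≤ C) :
    ∃ φ : ℕ → ℕ, StrictMono φ ∧ ∃ g : H,
      ∀ ψ : H, Tendsto (fun k => inner ℝ (F (φ k)) ψ) atTop (𝓝 (inner ℝ g ψ)) := by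
  have hsc := WeakDual.isSeqCompact_closedBall ℝ H 0 C
  let L : ℕ → WeakDual ℝ H := fun k =>
    StrongDual.toWeakDual (𝕜 := ℝ) (E := H) (InnerProductSpace.toDual ℝ H (F k))
  have hL : ∀ k, L k ∈ WeakDual.toStrongDual (𝕜 := ℝ) (E := H) ⁻¹' Metric.closedBall 0 C := by
    intro k
    simp only [Set.mem_preimage, Metric.mem_closedBall, dist_zero_right]
    exact ((InnerProductSpace.toDual ℝ H).norm_map (F k)).le.trans (hF k)
  obtain ⟨ℓ, -, φ, hφ, hlim⟩ := hsc hL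
  refine ⟨φ, hφ, (InnerProductSpace.toDual ℝ H).symm (WeakDual.toStrongDual (𝕜 := ℝ) (E := H) ℓ),
    fun ψ => ?_⟩
  have := ((WeakDual.eval_continuous (𝕜 := ℝ) ψ).tendsto ℓ).comp hlim
  rw [InnerProductSpace.toDual_symm_apply]
  exact this

theorem enorm_le_of_toReal_le {α : Type*} [MeasurableSpace α] {μ : Measure α} {f : α → ℝ}
    (hf : MemLp f 2 μ) {A : ℝ} (h : (eLpNorm f 2 μ).toReal ≤ A) :
    eLpNorm f 2 μ ≤ ENNReal.ofReal A := by
  rw [← ENNReal.ofReal_toReal hf.eLpNorm_ne_top]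
  exact ENNReal.ofReal_le_ofReal h

theorem inner_toLp {α : Type*} [MeasurableSpace α] {μ : Measure α} {f g : α → ℝ}
    (hf : MemLp f 2 μ) (hg : MemLp g 2 μ) :
    inner ℝ (hf.toLp f) (hg.toLp g) = ∫ x, f x * g x ∂μ := by
  rw [L2.inner_def]
  refine integral_congr_ae ?_
  filter_upwards [hf.coeFn_toLp, hg.coeFn_toLp] with x h1 h2
  rw [h1, h2]
  simp [mul_comm]

theorem abs_integral_mul_le {α : Type*} [MeasurableSpace α] {μ : Measure α} {f g : α → ℝ}
    (hf : MemLp f 2 μ) (hg : MemLp g 2 μ) :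
    |∫ x, f x * g x ∂μ| ≤ (eLpNorm f 2 μ).toReal * (eLpNorm g 2 μ).toReal := by
  rw [← inner_toLp hf hg, ← Lp.norm_toLp f hf, ← Lp.norm_toLp g hg]
  exact abs_real_inner_le_norm _ _

/-- Sequential weak compactness of bounded sequences in `L²`. -/
theorem exists_subseq_integral_mul_tendsto {α : Type*} [MeasurableSpace α] {μ : Measure α}
    [IsSeparable μ] {f : ℕ → α → ℝ} (hf : ∀ k, MemLp (f k) 2 μ) {a : ℕ → ℝ} {A : ℝ}
    (hfa : ∀ k, (eLpNorm (f k) 2 μ).toReal ≤ a k) (ha : Tendsto a atTop (𝓝 A)) :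
    ∃ φ : ℕ → ℕ, StrictMono φ ∧ ∃ g : α → ℝ, MemLp g 2 μ ∧ (eLpNorm g 2 μ).toReal ≤ A ∧
      ∀ ψ, MemLp ψ 2 μ →
        Tendsto (fun k => ∫ x, f (φ k) x * ψ x ∂μ) atTop (𝓝 (∫ x, g x * ψ x ∂μ)) := by
  have : Fact ((2 : ℝ≥0∞) ≠ ⊤) := ⟨by simp⟩
  obtain ⟨C, hC⟩ := ha.bddAbove_range
  obtain ⟨φ, hφ, g, hg⟩ := exists_subseq_weakly_tendsto (fun k => (hf k).toLp (f k)) (C := C)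
    fun k => by
      rw [Lp.norm_toLp]
      exact (hfa k).trans (hC ⟨k, rfl⟩)
  have key : ∀ ψ, MemLp ψ 2 μ →
      Tendsto (fun k => ∫ x, f (φ k) x * ψ x ∂μ) atTop (𝓝 (∫ x, g x * ψ x ∂μ)) := by
    intro ψ hψ
    have := hg (hψ.toLp ψ)
    simp only [inner_toLp] at this
    rw [← Lp.toLp_coeFn g (Lp.memLp g), inner_toLp] at this
    exact this
  refine ⟨φ, hφ, g, Lp.memLp g, ?_, key⟩
  have hg2 := Lp.memLp g
  -- Weak lower semicontinuity of the norm: the weak convergence is tested against `g` itself.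
  have h1 : ‖g‖ * ‖g‖ ≤ A * ‖g‖ := by
    refine le_of_tendsto_of_tendsto (hg g)
      ((ha.comp hφ.tendsto_atTop).mul_const ‖g‖) (Eventually.of_forall fun k => ?_) |>.trans'
        (le_of_eq (real_inner_self_eq_norm_mul_norm g).symm)
    refine (real_inner_le_norm _ _).trans ?_
    refine mul_le_mul_of_nonneg_right ?_ (norm_nonneg _)
    rw [Lp.norm_toLp]
    exact hfa _
  have hA : 0 ≤ A := ge_of_tendsto' ha fun k => ENNReal.toReal_nonneg.trans (hfa k)
  rw [← Lp.norm_def]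
  rcases eq_or_lt_of_le (norm_nonneg g) with h0 | h0
  · rw [← h0]; exact hA
  · exact le_of_mul_le_mul_right h1 h0

/-! ### Density of test functions and duality on open sets -/

section Density

theorem exists_contDiff_eq_one_of_isCompact {E : Type*} [NormedAddCommGroup E]
    [InnerProductSpace ℝ E] [FiniteDimensional ℝ E] {K U : Set E} (hK : IsCompact K) (hU : IsOpen U)
    (hKU : K ⊆ U) : ∃ χ : E → ℝ, ContDiff ℝ ∞ χ ∧ HasCompactSupport χ ∧ tsupport χ ⊆ U ∧
      (∀ x, |χ x| ≤ 1) ∧ ∀ x ∈ K, χ x = 1 := by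
  obtain ⟨V, hV, hKV, hVU, hVc⟩ := exists_open_between_and_isCompact_closure hK hU hKU
  obtain ⟨χ, hχ, hr, hs, h1⟩ := exists_contMDiff_support_eq_eq_one_iff (n := (⊤ : ℕ∞))
    (modelWithCornersSelf ℝ E) hV hK.isClosed hKV
  refine ⟨χ, hχ.contDiff, ?_, ?_, fun x => ?_, fun x hx => (h1 x).1 hx⟩
  · rw [HasCompactSupport, tsupport, hs]; exact hVc
  · rw [tsupport, hs]; exact hVU
  · have := hr ⟨x, rfl⟩
    rw [abs_of_nonneg this.1]; exact this.2

variable {E : Type*} [NormedAddCommGroup E] [InnerProductSpace ℝ E] [FiniteDimensional ℝ E]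
  [MeasurableSpace E] [BorelSpace E]

theorem exists_isCompact_eLpNorm_indicator_compl_le {U : Set E} (hU : IsOpen U) {f : E → ℝ}
    (hf : MemLp f 2 (volume.restrict U)) {ε : ℝ} (hε : 0 < ε) :
    ∃ K ⊆ U, IsCompact K ∧
      eLpNorm (f - K.indicator f) 2 (volume.restrict U) ≤ ENNReal.ofReal ε := by
  -- The measure `|f|² dx` on `U` is finite, so inner regularity exhausts `U` by a compact set up to
  -- mass `ε²`.
  let ν := (volume.restrict U).withDensity fun x => ‖f x‖ₑ ^ (2 : ℝ)
  have hνfin : ∫⁻ x in U, ‖f x‖ₑ ^ (2 : ℝ) ≠ ⊤ := by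
    have := lintegral_rpow_enorm_lt_top_of_eLpNorm_lt_top (by simp) (by simp) hf.2
    simpa using this.ne
  have : IsFiniteMeasure ν := isFiniteMeasure_withDensity hνfin
  obtain ⟨K, hKU, hK, hlt⟩ := hU.measurableSet.exists_isCompact_sdiff_lt (μ := ν)
    (measure_ne_top ν U) (ε := ENNReal.ofReal ε ^ (2 : ℝ)) (by simp [hε])
  refine ⟨K, hKU, hK, ?_⟩
  rw [eLpNorm_eq_lintegral_rpow_enorm_toReal (by simp) (by simp)]
  have h2 : ((2 : ℝ≥0∞).toReal) = 2 := by simp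
  rw [h2]
  have : ∫⁻ x in U, ‖(f - K.indicator f) x‖ₑ ^ (2 : ℝ) = ν (U \ K) := by
    rw [withDensity_apply _ (hU.measurableSet.diff hK.measurableSet),
      ← lintegral_indicator (hU.measurableSet.diff hK.measurableSet)]
    refine setLIntegral_congr_fun hU.measurableSet fun x hx => ?_
    by_cases hxK : x ∈ K
    · simp [hxK]
    · simp [hxK, hx]
  rw [this]
  calc (ν (U \ K)) ^ (1 / (2 : ℝ)) ≤ (ENNReal.ofReal ε ^ (2 : ℝ)) ^ (1 / (2 : ℝ)) := by gcongr
    _ = ENNReal.ofReal ε := by rw [← ENNReal.rpow_mul]; norm_num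

/-- Test functions are dense in `L²(U)`. -/
theorem exists_contDiff_tsupport_subset_eLpNorm_sub_le {U : Set E} (hU : IsOpen U) {f : E → ℝ}
    (hf : MemLp f 2 (volume.restrict U)) {ε : ℝ} (hε : 0 < ε) :
    ∃ ψ : E → ℝ, ContDiff ℝ ∞ ψ ∧ HasCompactSupport ψ ∧ tsupport ψ ⊆ U ∧
      eLpNorm (f - ψ) 2 (volume.restrict U) ≤ ENNReal.ofReal ε := by
  obtain ⟨K, hKU, hK, hfK⟩ := exists_isCompact_eLpNorm_indicator_compl_le hU hf (half_pos hε)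
  have hfK2 : MemLp (K.indicator f) 2 (volume.restrict U) := hf.indicator hK.measurableSet
  obtain ⟨g, hgc, hg, hgε⟩ := hfK2.exist_eLpNorm_sub_le (by simp) (by norm_num) (half_pos hε)
  obtain ⟨χ, hχ, hχc, hχU, hχ1, hχK⟩ := exists_contDiff_eq_one_of_isCompact hK hU hKU
  refine ⟨fun x => χ x * g x, hχ.mul hg, hχc.mul_right, (tsupport_mul_subset_left).trans hχU, ?_⟩
  have hgm : AEStronglyMeasurable g (volume.restrict U) := hg.continuous.aestronglyMeasurable
  have hχg : AEStronglyMeasurable (fun x => χ x * g x) (volume.restrict U) :=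
    (hχ.continuous.mul hg.continuous).aestronglyMeasurable
  have hle : eLpNorm (K.indicator f - fun x => χ x * g x) 2 (volume.restrict U)
      ≤ eLpNorm (K.indicator f - g) 2 (volume.restrict U) := by
    refine eLpNorm_mono fun x => ?_
    -- As `χ = 1` on `K` and the truncated function vanishes off `K`, cutting off `g` multiplies the
    -- whole error by `χ`, and `|χ| ≤ 1`.
    have : (K.indicator f - fun x => χ x * g x) x = χ x * (K.indicator f - g) x := by
      by_cases hx : x ∈ K
      · simp [hx, hχK x hx]
      · simp [hx]
    rw [this, norm_mul]
    exact mul_le_of_le_one_left (norm_nonneg _) (hχ1 x)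
  calc eLpNorm (f - fun x => χ x * g x) 2 (volume.restrict U)
      = eLpNorm ((f - K.indicator f) + (K.indicator f - fun x => χ x * g x)) 2
          (volume.restrict U) := by congr 1; abel
    _ ≤ _ := eLpNorm_add_le (hf.aestronglyMeasurable.sub hfK2.aestronglyMeasurable)
          (hfK2.aestronglyMeasurable.sub hχg) (by norm_num)
    _ ≤ ENNReal.ofReal (ε / 2) + ENNReal.ofReal (ε / 2) := add_le_add hfK (hle.trans hgε)
    _ = ENNReal.ofReal ε := by
        rw [← ENNReal.ofReal_add (half_pos hε).le (half_pos hε).le, add_halves]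

/-- The `L²(U)`-norm is determined by testing against test functions. -/
theorem eLpNorm_toReal_le_of_forall_test {U : Set E} (hU : IsOpen U) {f : E → ℝ}
    (hf : MemLp f 2 (volume.restrict U)) {M : ℝ} (hM : 0 ≤ M)
    (h : ∀ ψ : E → ℝ, ContDiff ℝ ∞ ψ → HasCompactSupport ψ → tsupport ψ ⊆ U →
      |∫ x in U, f x * ψ x| ≤ M * (eLpNorm ψ 2 (volume.restrict U)).toReal) :
    (eLpNorm f 2 (volume.restrict U)).toReal ≤ M := by
  set F := hf.toLp f
  -- The best test direction is `f` itself; a test function `ε`-close to it is used instead, and `ε`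
  -- tends to `0`.
  have hclose : ∀ ε > 0, ‖F‖ * ‖F‖ ≤ M * ‖F‖ + (M + ‖F‖) * ε := by
    intro ε hε
    obtain ⟨ψ, hψ, hψc, hψU, hψε⟩ := exists_contDiff_tsupport_subset_eLpNorm_sub_le hU hf hε
    have hψ2 : MemLp ψ 2 (volume.restrict U) := hψ.continuous.memLp_of_hasCompactSupport hψc
    have h1 := h ψ hψ hψc hψU
    rw [← inner_toLp hf hψ2, ← Lp.norm_toLp ψ hψ2] at h1
    set Ψ := hψ2.toLp ψ
    have h2 : ‖F - Ψ‖ ≤ ε := by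
      rw [← MemLp.toLp_sub, Lp.norm_toLp]
      exact ENNReal.toReal_le_of_le_ofReal hε.le hψε
    have h3 : ‖Ψ‖ ≤ ‖F‖ + ε := by
      have := norm_sub_norm_le Ψ F
      rw [norm_sub_rev] at this
      linarith
    have h4 : inner ℝ F F = inner ℝ F Ψ + inner ℝ F (F - Ψ) := by rw [inner_sub_right]; ring
    have h5 := real_inner_le_norm F (F - Ψ)
    rw [← real_inner_self_eq_norm_mul_norm, h4]
    have h6 : ‖F‖ * ‖F - Ψ‖ ≤ ‖F‖ * ε := by gcongr
    have h7 : M * ‖Ψ‖ ≤ M * (‖F‖ + ε) := by gcongr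
    linarith [le_abs_self (inner ℝ F Ψ : ℝ)]
  have hlim : ‖F‖ * ‖F‖ ≤ M * ‖F‖ := by
    have hc : Tendsto (fun ε : ℝ => M * ‖F‖ + (M + ‖F‖) * ε) (𝓝[>] 0) (𝓝 (M * ‖F‖)) := by
      have : Continuous fun ε : ℝ => M * ‖F‖ + (M + ‖F‖) * ε := by fun_prop
      simpa using (this.tendsto 0).mono_left nhdsWithin_le_nhds
    exact ge_of_tendsto hc (eventually_mem_nhdsWithin.mono fun ε hε => hclose ε hε)
  rw [← Lp.norm_toLp f hf]
  rcases eq_or_lt_of_le (norm_nonneg F) with h0 | h0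
  · rw [← h0]; exact hM
  · exact le_of_mul_le_mul_right hlim h0

end Density

/-! ### Translation estimates for functions with a weak derivative -/

section Translation

variable {E : Type*} [NormedAddCommGroup E]

/-- The points `x ∈ Ω` such that `x + y ∈ Ω`. -/
def shiftDomain (Ω : Set E) (y : E) : Set E := Ω ∩ {x | x + y ∈ Ω}

theorem IsOpen.shiftDomain {Ω : Set E} (hΩ : IsOpen Ω) (y : E) : IsOpen (shiftDomain Ω y) :=
  hΩ.inter (hΩ.preimage (continuous_add_const y))

theorem tsupport_comp_sub_right {ψ : E → ℝ} (a : E) {x : E}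
    (hx : x ∈ tsupport fun z => ψ (z - a)) : x - a ∈ tsupport ψ := by
  have := tsupport_comp_eq_preimage ψ (Homeomorph.subRight a)
  change x ∈ tsupport (ψ ∘ Homeomorph.subRight a) at hx
  rw [this] at hx
  exact hx

theorem hasCompactSupport_comp_sub_right {ψ : E → ℝ} (hψ : HasCompactSupport ψ) (a : E) :
    HasCompactSupport fun z => ψ (z - a) :=
  hψ.comp_homeomorph (Homeomorph.subRight a)

variable [InnerProductSpace ℝ E]

theorem Convex.add_smul_mem_of_mem_shiftDomain {Ω : Set E} (hc : Convex ℝ Ω) {e x : E} {s τ : ℝ}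
    (hx : x ∈ shiftDomain Ω (τ • e)) (hs : s ∈ Set.uIcc 0 τ) : x + s • e ∈ Ω := by
  rw [← segment_eq_uIcc] at hs
  obtain ⟨a, b, ha, hb, hab, rfl⟩ := hs
  have := hc hx.1 hx.2 ha hb hab
  convert this using 1
  rw [smul_add, ← add_assoc, ← add_smul, hab, one_smul, smul_zero, zero_add, smul_eq_mul, mul_smul]

variable [MeasurableSpace E] [BorelSpace E] [FiniteDimensional ℝ E]

/-- `g` is a weak derivative of `v` on `Ω` in the direction `e`. -/
def IsWeakDerivAlong (Ω : Set E) (v : E → ℝ) (e : E) (g : E → ℝ) : Prop :=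
  ∀ φ : E → ℝ, ContDiff ℝ ∞ φ → HasCompactSupport φ → tsupport φ ⊆ Ω →
    ∫ x in Ω, v x * fderiv ℝ φ x e = -∫ x in Ω, g x * φ x

/-- The translation is put on the smooth factor, so the pairing is differentiable even though `v` is
only integrable. The derivative is in the form to which a weak derivative of `v` applies. -/
theorem hasDerivAt_integral_mul_comp_sub {Ω : Set E} {v : E → ℝ}
    (hv : IntegrableOn v Ω) {ψ : E → ℝ} (hψ : ContDiff ℝ ∞ ψ) (hψc : HasCompactSupport ψ) (e : E)
    (s : ℝ) :
    HasDerivAt (fun s : ℝ => ∫ x in Ω, v x * ψ (x - s • e))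
      (∫ x in Ω, v x * -(fderiv ℝ ψ (x - s • e) e)) s := by
  have hdc : Continuous (fderiv ℝ ψ) := hψ.continuous_fderiv (by simp)
  obtain ⟨C, hC⟩ := (hψc.fderiv ℝ).exists_bound_of_continuous hdc
  obtain ⟨C', hC'⟩ := hψc.exists_bound_of_continuous hψ.continuous
  have hm : ∀ s : ℝ, AEStronglyMeasurable (fun x => ψ (x - s • e)) (volume.restrict Ω) := fun s =>
    (hψ.continuous.comp (continuous_sub_right _)).aestronglyMeasurable
  refine (hasDerivAt_integral_of_dominated_loc_of_deriv_le (s := Set.univ)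
    (bound := fun x => ‖v x‖ * (C * ‖e‖)) (F' := fun s x => v x * -(fderiv ℝ ψ (x - s • e) e))
    univ_mem ?_ ?_ ?_ ?_ ?_ ?_).2
  · exact Eventually.of_forall fun s => hv.aestronglyMeasurable.mul (hm s)
  · exact Integrable.mul_bdd (c := C') hv (hm s) (Eventually.of_forall fun x => hC' _)
  · refine hv.aestronglyMeasurable.mul (Continuous.aestronglyMeasurable ?_)
    exact ((hdc.comp (continuous_sub_right _)).clm_apply continuous_const).neg
  · refine Eventually.of_forall fun x t _ => ?_
    rw [norm_mul, norm_neg]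
    gcongr
    exact (ContinuousLinearMap.le_opNorm _ _).trans (by gcongr; exact hC _)
  · exact hv.norm.mul_const _
  · refine Eventually.of_forall fun x t _ => ?_
    have h1 : HasDerivAt (fun t : ℝ => x - t • e) (-e) t := by
      simpa using ((hasDerivAt_id t).smul_const e).const_sub x
    have h2 : HasFDerivAt ψ (fderiv ℝ ψ (x - t • e)) (x - t • e) :=
      (hψ.differentiable (by simp) _).hasFDerivAt
    have := (h2.comp_hasDerivAt t h1).const_mul (v x)
    simpa using this

/-- Discrete integration by parts: the difference moves from `v` to the test function by translation
invariance. There is no boundary term because `ψ` lives where both `x` and `x + y` are in `Ω`. -/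
theorem integral_shiftDomain_sub_mul {Ω : Set E} (hΩ : IsOpen Ω) {v : E → ℝ}
    (hv : IntegrableOn v Ω) {ψ : E → ℝ} (hψ : Continuous ψ) (hψc : HasCompactSupport ψ) (y : E)
    (hψU : tsupport ψ ⊆ shiftDomain Ω y) :
    ∫ x in shiftDomain Ω y, (v (x + y) - v x) * ψ x
      = (∫ x in Ω, v x * ψ (x - y)) - ∫ x in Ω, v x * ψ x := by
  have hzero : ∀ x, x ∉ shiftDomain Ω y → ψ x = 0 := fun x hx =>
    image_eq_zero_of_notMem_tsupport fun h => hx (hψU h)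
  obtain ⟨C, hC⟩ := hψc.exists_bound_of_continuous hψ
  have hvE : Integrable (Ω.indicator v) := (integrable_indicator_iff hΩ.measurableSet).2 hv
  have hi1 : Integrable fun x => Ω.indicator v x * ψ x :=
    Integrable.mul_bdd (c := C) hvE hψ.aestronglyMeasurable (Eventually.of_forall hC)
  have hi2 : Integrable fun x => Ω.indicator v (x + y) * ψ x :=
    Integrable.mul_bdd (c := C) (hvE.comp_add_right y) hψ.aestronglyMeasurable
      (Eventually.of_forall hC)
  have e1 : ∀ χ : E → ℝ, ∫ x in Ω, v x * χ x = ∫ x, Ω.indicator v x * χ x := by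
    intro χ
    rw [← integral_indicator hΩ.measurableSet]
    congr 1 with x
    by_cases hx : x ∈ Ω <;> simp [hx]
  have e2 : ∫ x, Ω.indicator v x * ψ (x - y) = ∫ x, Ω.indicator v (x + y) * ψ x := by
    rw [← integral_add_right_eq_self _ y]
    simp
  rw [e1, e1, e2, ← integral_sub hi2 hi1,
    setIntegral_eq_integral_of_forall_compl_eq_zero fun x hx => by rw [hzero x hx, mul_zero]]
  congr 1 with x
  by_cases hx : x ∈ shiftDomain Ω y
  · have h1 : x ∈ Ω := hx.1
    have h2 : x + y ∈ Ω := hx.2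
    simp [h1, h2, sub_mul]
  · simp [hzero x hx]

theorem MeasureTheory.MemLp.comp_add_right_shiftDomain {Ω : Set E} (hΩ : IsOpen Ω) {v : E → ℝ}
    (hv : MemLp v 2 (volume.restrict Ω)) (y : E) :
    MemLp (fun x => v (x + y)) 2 (volume.restrict (shiftDomain Ω y)) := by
  have h1 : MemLp (Ω.indicator v) 2 volume := (memLp_indicator_iff_restrict hΩ.measurableSet).2 hv
  have h2 := (h1.comp_measurePreserving (measurePreserving_add_right volume y)).restrict
    (shiftDomain Ω y)
  refine h2.ae_eq ?_
  filter_upwards [ae_restrict_mem (hΩ.shiftDomain y).measurableSet] with x hx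
  have : x + y ∈ Ω := hx.2
  simp [this]

theorem MeasureTheory.MemLp.shiftDomain_sub {Ω : Set E} (hΩ : IsOpen Ω) {v : E → ℝ}
    (hv : MemLp v 2 (volume.restrict Ω)) (y : E) :
    MemLp (fun x => v (x + y) - v x) 2 (volume.restrict (shiftDomain Ω y)) :=
  (hv.comp_add_right_shiftDomain hΩ y).sub (hv.mono_measure
    (Measure.restrict_mono Set.inter_subset_left le_rfl))

/-- A function with a square integrable weak derivative is Lipschitz continuous in `L²` with
respect to translations. -/
theorem eLpNorm_shift_sub_le {Ω : Set E} (hΩ : IsOpen Ω) (hc : Convex ℝ Ω)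
    (hfin : volume Ω ≠ ⊤) {v g : E → ℝ} {e : E} (hv : MemLp v 2 (volume.restrict Ω))
    (hg : MemLp g 2 (volume.restrict Ω)) (hvg : IsWeakDerivAlong Ω v e g) (τ : ℝ) :
    eLpNorm (fun x => v (x + τ • e) - v x) 2 (volume.restrict (shiftDomain Ω (τ • e)))
      ≤ ENNReal.ofReal (|τ| * (eLpNorm g 2 (volume.restrict Ω)).toReal) := by
  have : IsFiniteMeasure (volume.restrict Ω) := ⟨by simpa using hfin.lt_top⟩
  have hvi : IntegrableOn v Ω := hv.integrable (by norm_num)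
  refine enorm_le_of_toReal_le (hv.shiftDomain_sub hΩ _) ?_
  refine eLpNorm_toReal_le_of_forall_test (hΩ.shiftDomain _) (hv.shiftDomain_sub hΩ _)
    (by positivity) fun ψ hψ hψc hψU => ?_
  rw [integral_shiftDomain_sub_mul hΩ hvi hψ.continuous hψc _ hψU]
  have hψ2 : MemLp ψ 2 volume := hψ.continuous.memLp_of_hasCompactSupport hψc
  -- Mean value inequality for the pairing of `v` with `ψ` translated by `s • e`. Convexity keeps
  -- the translated support in `Ω` for every `s` between `0` and `τ`, so the derivative is a pairing
  -- with `g`, bounded by Cauchy–Schwarz.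
  have key := Convex.norm_image_sub_le_of_norm_hasDerivWithin_le
    (f := fun s : ℝ => ∫ x in Ω, v x * ψ (x - s • e)) (x := 0) (y := τ) (s := Set.uIcc 0 τ)
    (C := (eLpNorm g 2 (volume.restrict Ω)).toReal
      * (eLpNorm ψ 2 (volume.restrict (shiftDomain Ω (τ • e)))).toReal)
    (fun s _ => (hasDerivAt_integral_mul_comp_sub hvi hψ hψc e s).hasDerivWithinAt)
    (fun s hs => ?_) (convex_uIcc 0 τ) Set.left_mem_uIcc Set.right_mem_uIcc
  · simp only [zero_smul, sub_zero, Real.norm_eq_abs] at key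
    linarith
  · have hφ : ContDiff ℝ ∞ fun x => ψ (x - s • e) := hψ.comp (contDiff_id.sub contDiff_const)
    have hw := hvg _ hφ (hasCompactSupport_comp_sub_right hψc _) fun x hx => by
      have h1 := hc.add_smul_mem_of_mem_shiftDomain (hψU (tsupport_comp_sub_right _ hx)) hs
      simpa using h1
    simp only [fderiv_comp_sub] at hw
    simp only [mul_neg, integral_neg, hw, neg_neg, Real.norm_eq_abs]
    have hmp : MeasurePreserving (fun x : E => x - s • e) volume volume :=
      measurePreserving_sub_right volume _
    have hφ2 : MemLp (fun x => ψ (x - s • e)) 2 volume := hψ2.comp_measurePreserving hmp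
    refine (abs_integral_mul_le hg (hφ2.restrict Ω)).trans ?_
    gcongr
    · exact (hψ2.restrict _).eLpNorm_ne_top
    · rw [eLpNorm_restrict_eq_of_support_subset (s := shiftDomain Ω (τ • e))
        ((subset_tsupport ψ).trans hψU),
        ← eLpNorm_comp_measurePreserving hψ2.aestronglyMeasurable hmp]
      exact eLpNorm_restrict_le _ _ _ _

end Translation

/-! ### Compactness in `L²` -/

/-- Dominated convergence in `L²`. -/
theorem tendsto_eLpNorm_two_zero_of_dominated {α ι : Type*} [MeasurableSpace α] {μ : Measure α}
    {l : Filter ι} [l.IsCountablyGenerated] {F : ι → α → ℝ} {G : α → ℝ}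
    (hF : ∀ i, AEStronglyMeasurable (F i) μ) (hG : MemLp G 2 μ)
    (hFG : ∀ i, ∀ᵐ x ∂μ, |F i x| ≤ |G x|) (hlim : ∀ᵐ x ∂μ, Tendsto (fun i => F i x) l (𝓝 0)) :
    Tendsto (fun i => eLpNorm (F i) 2 μ) l (𝓝 0) := by
  have h2 : ((2 : ℝ≥0∞).toReal) = 2 := by simp
  have hle : ∀ i, ∀ᵐ x ∂μ, ‖F i x‖ₑ ^ (2 : ℝ) ≤ ‖G x‖ₑ ^ (2 : ℝ) := fun i => by
    filter_upwards [hFG i] with x hx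
    gcongr
    rw [Real.enorm_eq_ofReal_abs, Real.enorm_eq_ofReal_abs]
    exact ENNReal.ofReal_le_ofReal hx
  have hfin : ∫⁻ x, ‖G x‖ₑ ^ (2 : ℝ) ∂μ ≠ ⊤ := by
    have := lintegral_rpow_enorm_lt_top_of_eLpNorm_lt_top (by simp) (by simp) hG.2
    simpa using this.ne
  have key := tendsto_lintegral_filter_of_dominated_convergence' (μ := μ) (l := l)
    (F := fun i x => ‖F i x‖ₑ ^ (2 : ℝ)) (f := fun _ => 0) (fun x => ‖G x‖ₑ ^ (2 : ℝ))
    (Eventually.of_forall fun i => (hF i).enorm.pow_const _) (Eventually.of_forall hle) hfin (by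
      filter_upwards [hlim] with x hx
      have h1 : Tendsto (fun i => ‖F i x‖ₑ) l (𝓝 ‖(0 : ℝ)‖ₑ) := hx.enorm
      have h3 := (ENNReal.continuous_rpow_const (y := 2)).tendsto ‖(0 : ℝ)‖ₑ |>.comp h1
      simpa [Function.comp_def] using h3)
  simp only [eLpNorm_eq_lintegral_rpow_enorm_toReal (p := 2) (by simp) (by simp), h2]
  have h4 := (ENNReal.continuous_rpow_const (y := 1 / 2)).tendsto _ |>.comp key
  simpa [Function.comp_def] using h4

/-! ### Averages over translates -/

section Average

variable {E : Type*} [NormedAddCommGroup E] [InnerProductSpace ℝ E] [FiniteDimensional ℝ E]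
  [MeasurableSpace E] [BorelSpace E]

theorem eLpNorm_comp_add_right {w : E → ℝ} (hw : AEStronglyMeasurable w volume) (a : E) :
    eLpNorm (fun x => w (x + a)) 2 volume = eLpNorm w 2 volume :=
  eLpNorm_comp_measurePreserving hw (measurePreserving_add_right volume a)

theorem eLpNorm_translate_add_le {w : E → ℝ} (hw : Measurable w) (a b : E) :
    eLpNorm (fun x => w (x + (a + b)) - w x) 2 volume
      ≤ eLpNorm (fun x => w (x + a) - w x) 2 volume
        + eLpNorm (fun x => w (x + b) - w x) 2 volume := by
  have hm : ∀ a : E, Measurable fun x => w (x + a) - w x := fun a =>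
    (hw.comp (measurable_add_const a)).sub hw
  have h1 : (fun x => w (x + (a + b)) - w x)
      = (fun x => w (x + b + a) - w (x + b)) + fun x => w (x + b) - w x := by
    ext x
    simp only [Pi.add_apply]
    rw [add_comm a b, ← add_assoc]
    ring
  rw [h1, ← eLpNorm_comp_add_right (hm a).aestronglyMeasurable b]
  exact eLpNorm_add_le ((hm a).comp (measurable_add_const b)).aestronglyMeasurable
    (hm b).aestronglyMeasurable (by norm_num)

/-- Reduces an arbitrary translation to translations along the coordinate axes, the only ones
estimated later. -/
theorem eLpNorm_translate_sum_le {ι : Type*} {w : E → ℝ} (hw : Measurable w) (s : Finset ι)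
    (a : ι → E) :
    eLpNorm (fun x => w (x + ∑ i ∈ s, a i) - w x) 2 volume
      ≤ ∑ i ∈ s, eLpNorm (fun x => w (x + a i) - w x) 2 volume := by
  classical
  induction s using Finset.induction_on with
  | empty => simp
  | insert i s hi ih =>
    rw [Finset.sum_insert hi, Finset.sum_insert hi]
    exact (eLpNorm_translate_add_le hw _ _).trans (by gcongr)

theorem sq_lintegral_le_lintegral_sq {α : Type*} [MeasurableSpace α] {ν : Measure α}
    [IsProbabilityMeasure ν] {f : α → ℝ} (hf : Measurable f) :
    (∫⁻ y, ‖f y‖ₑ ∂ν) ^ (2 : ℝ) ≤ ∫⁻ y, ‖f y‖ₑ ^ (2 : ℝ) ∂ν := by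
  have h := eLpNorm_le_eLpNorm_of_exponent_le (p := 1) (q := 2) (μ := ν) (by norm_num)
    hf.aestronglyMeasurable
  rw [eLpNorm_one_eq_lintegral_enorm,
    eLpNorm_eq_lintegral_rpow_enorm_toReal (p := 2) (by simp) (by simp)] at h
  have h2 : ((2 : ℝ≥0∞).toReal) = 2 := by simp
  rw [h2] at h
  calc (∫⁻ y, ‖f y‖ₑ ∂ν) ^ (2 : ℝ)
      ≤ ((∫⁻ y, ‖f y‖ₑ ^ (2 : ℝ) ∂ν) ^ (1 / (2 : ℝ))) ^ (2 : ℝ) := by gcongr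
    _ = _ := by rw [← ENNReal.rpow_mul]; norm_num

/-- An average of translates of `w` is close to `w` in `L²` if all these translates are. -/
theorem eLpNorm_average_sub_le {ν : Measure E} [IsProbabilityMeasure ν] {w : E → ℝ}
    (hw : Measurable w) (hint : ∀ x, Integrable (fun y => w (x + y)) ν) {η : ℝ≥0∞}
    (hη : ∀ᵐ y ∂ν, eLpNorm (fun x => w (x + y) - w x) 2 volume ≤ η) :
    eLpNorm (fun x => (∫ y, w (x + y) ∂ν) - w x) 2 volume ≤ η := by
  have h2 : ((2 : ℝ≥0∞).toReal) = 2 := by simp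
  have hm2 : Measurable fun p : E × E => w (p.1 + p.2) - w p.1 :=
    (hw.comp (measurable_fst.add measurable_snd)).sub (hw.comp measurable_fst)
  -- Jensen's inequality at each point; Tonelli then exchanges the average with the `L²` norm.
  have hpt : ∀ x, ‖(∫ y, w (x + y) ∂ν) - w x‖ₑ ^ (2 : ℝ)
      ≤ ∫⁻ y, ‖w (x + y) - w x‖ₑ ^ (2 : ℝ) ∂ν := by
    intro x
    have h1 : (∫ y, w (x + y) ∂ν) - w x = ∫ y, (w (x + y) - w x) ∂ν := by
      rw [integral_sub (hint x) (integrable_const _)]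
      simp
    rw [h1]
    refine le_trans ?_ (sq_lintegral_le_lintegral_sq
      (hm2.comp (measurable_prodMk_left (x := x))))
    gcongr
    exact enorm_integral_le_lintegral_enorm _
  rw [eLpNorm_eq_lintegral_rpow_enorm_toReal (by simp) (by simp), h2]
  have hsq : ∫⁻ x, ‖(∫ y, w (x + y) ∂ν) - w x‖ₑ ^ (2 : ℝ) ≤ η ^ (2 : ℝ) :=
    calc ∫⁻ x, ‖(∫ y, w (x + y) ∂ν) - w x‖ₑ ^ (2 : ℝ)
        ≤ ∫⁻ x, ∫⁻ y, ‖w (x + y) - w x‖ₑ ^ (2 : ℝ) ∂ν := lintegral_mono hpt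
      _ = ∫⁻ y, (∫⁻ x, ‖w (x + y) - w x‖ₑ ^ (2 : ℝ)) ∂ν :=
          lintegral_lintegral_swap (hm2.enorm.pow_const _).aemeasurable
      _ ≤ ∫⁻ _, η ^ (2 : ℝ) ∂ν := by
          refine lintegral_mono_ae ?_
          filter_upwards [hη] with y hy
          rw [eLpNorm_eq_lintegral_rpow_enorm_toReal (by simp) (by simp), h2] at hy
          calc ∫⁻ x, ‖w (x + y) - w x‖ₑ ^ (2 : ℝ)
              = ((∫⁻ x, ‖w (x + y) - w x‖ₑ ^ (2 : ℝ)) ^ (1 / (2 : ℝ))) ^ (2 : ℝ) := by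
                rw [← ENNReal.rpow_mul]; norm_num
            _ ≤ η ^ (2 : ℝ) := by gcongr
      _ = η ^ (2 : ℝ) := by simp
  calc (∫⁻ x, ‖(∫ y, w (x + y) ∂ν) - w x‖ₑ ^ (2 : ℝ)) ^ (1 / (2 : ℝ))
      ≤ (η ^ (2 : ℝ)) ^ (1 / (2 : ℝ)) := by gcongr
    _ = η := by rw [← ENNReal.rpow_mul]; norm_num

/-- The uniform probability measure on a set `Q`. -/
noncomputable def uniformMeasure (Q : Set E) : Measure E := (volume Q)⁻¹ • volume.restrict Q

theorem isProbabilityMeasure_uniformMeasure {Q : Set E} (h0 : volume Q ≠ 0) (h1 : volume Q ≠ ⊤) :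
    IsProbabilityMeasure (uniformMeasure Q) :=
  ⟨by simp [uniformMeasure, ENNReal.inv_mul_cancel h0 h1]⟩

/-- An average of `w` is a pairing with a translated indicator, so weak convergence of functions
yields pointwise convergence of their averages. -/
theorem integral_uniformMeasure_eq {Q : Set E} (hQ : MeasurableSet Q) (w : E → ℝ) (x : E) :
    ∫ y, w (x + y) ∂(uniformMeasure Q)
      = ∫ z, w z * Q.indicator (fun _ => (volume Q)⁻¹.toReal) (z - x) := by
  rw [uniformMeasure, integral_smul_measure, ← integral_indicator hQ, smul_eq_mul,
    ← integral_const_mul,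
    ← integral_add_right_eq_self (fun z => w z * Q.indicator (fun _ => (volume Q)⁻¹.toReal) (z - x))
      x]
  congr 1 with y
  by_cases hy : y ∈ Q
  · simp [hy, add_comm, mul_comm]
  · simp [hy]

theorem eLpNorm_comp_sub_right {w : E → ℝ} (hw : AEStronglyMeasurable w volume) (a : E) :
    eLpNorm (fun x => w (x - a)) 2 volume = eLpNorm w 2 volume :=
  eLpNorm_comp_measurePreserving hw (measurePreserving_sub_right volume a)

theorem memLp_indicator_const_sub {Q : Set E} (hQ : MeasurableSet Q) (h1 : volume Q ≠ ⊤) (c : ℝ)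
    (x : E) : MemLp (fun z => Q.indicator (fun _ => c) (z - x)) 2 volume :=
  (memLp_indicator_const 2 hQ c (Or.inr h1)).comp_measurePreserving
    (measurePreserving_sub_right volume x)

theorem integrable_comp_add_uniformMeasure {Q : Set E} (h0 : volume Q ≠ 0) (h1 : volume Q ≠ ⊤)
    {w : E → ℝ} (hw : MemLp w 2 volume) (x : E) :
    Integrable (fun y => w (x + y)) (uniformMeasure Q) := by
  have : IsFiniteMeasure (volume.restrict Q) := ⟨by simpa using h1.lt_top⟩
  have h2 : MemLp (fun y => w (x + y)) 2 volume :=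
    hw.comp_measurePreserving (measurePreserving_add_left volume x)
  have h3 : Integrable (fun y => w (x + y)) (volume.restrict Q) :=
    (h2.restrict Q).integrable (by norm_num)
  exact h3.smul_measure (ENNReal.inv_ne_top.2 h0)

/-- Averages of a weakly convergent sequence converge strongly on sets of finite measure. -/
theorem tendsto_eLpNorm_average_sub {Q Ω : Set E} (hQ : MeasurableSet Q)
    (h1 : volume Q ≠ ⊤) (hΩ : volume Ω ≠ ⊤) {w : ℕ → E → ℝ} {g G : E → ℝ}
    (hw : ∀ k, Measurable (w k)) (hw2 : ∀ k, MemLp (w k) 2 volume)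
    (hG : ∀ k, eLpNorm (w k) 2 volume ≤ eLpNorm G 2 volume) (hG2 : MemLp G 2 volume)
    [IsProbabilityMeasure (uniformMeasure Q)]
    (hlim : ∀ ψ, MemLp ψ 2 volume →
      Tendsto (fun k => ∫ x, w k x * ψ x) atTop (𝓝 (∫ x, g x * ψ x))) :
    AEStronglyMeasurable (fun x => ∫ y, g (x + y) ∂(uniformMeasure Q)) (volume.restrict Ω) ∧
    Tendsto (fun k => eLpNorm (fun x => (∫ y, w k (x + y) ∂(uniformMeasure Q))
      - ∫ y, g (x + y) ∂(uniformMeasure Q)) 2 (volume.restrict Ω)) atTop (𝓝 0) := by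
  have : IsFiniteMeasure (volume.restrict Ω) := ⟨by simpa using hΩ.lt_top⟩
  set c := (volume Q)⁻¹.toReal
  have hχ := memLp_indicator_const_sub hQ h1 c
  have hAm : ∀ k, Measurable fun x => ∫ y, w k (x + y) ∂(uniformMeasure Q) := fun k =>
    (StronglyMeasurable.integral_prod_right (ν := uniformMeasure Q)
      (f := fun x y => w k (x + y))
      ((hw k).comp (measurable_fst.add measurable_snd)).stronglyMeasurable).measurable
  have hpt : ∀ x, Tendsto (fun k => ∫ y, w k (x + y) ∂(uniformMeasure Q)) atTop
      (𝓝 (∫ y, g (x + y) ∂(uniformMeasure Q))) := fun x => by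
    simp only [integral_uniformMeasure_eq hQ]
    exact hlim _ (hχ x)
  have hgm : Measurable fun x => ∫ y, g (x + y) ∂(uniformMeasure Q) :=
    measurable_of_tendsto_metrizable hAm (tendsto_pi_nhds.2 hpt)
  set M := (eLpNorm G 2 volume).toReal
    * (eLpNorm (Q.indicator fun _ => c) 2 (volume : Measure E)).toReal
  -- By Cauchy–Schwarz the averages have a bound independent of `k` and `x`; on a set of finite
  -- measure this constant allows dominated convergence.
  have hb : ∀ k x, |∫ y, w k (x + y) ∂(uniformMeasure Q)| ≤ M := fun k x => by
    rw [integral_uniformMeasure_eq hQ]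
    refine (abs_integral_mul_le (hw2 k) (hχ x)).trans ?_
    rw [eLpNorm_comp_sub_right (measurable_const.indicator hQ).aestronglyMeasurable x]
    exact mul_le_mul_of_nonneg_right (ENNReal.toReal_mono hG2.eLpNorm_ne_top (hG k))
      ENNReal.toReal_nonneg
  have hbg : ∀ x, |∫ y, g (x + y) ∂(uniformMeasure Q)| ≤ M := fun x =>
    le_of_tendsto (hpt x).abs (Eventually.of_forall fun k => hb k x)
  refine ⟨hgm.aestronglyMeasurable, tendsto_eLpNorm_two_zero_of_dominated (G := fun _ => M + M)
    (fun k => ((hAm k).sub hgm).aestronglyMeasurable) (memLp_const _) (fun k => ?_) ?_⟩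
  · refine Eventually.of_forall fun x => ?_
    exact ((abs_sub _ _).trans (add_le_add (hb k x) (hbg x))).trans (le_abs_self _)
  · refine Eventually.of_forall fun x => ?_
    simpa using (hpt x).sub_const (∫ y, g (x + y) ∂(uniformMeasure Q))

end Average

/-! ### A Kolmogorov–Riesz compactness theorem -/

section Kolmogorov

variable {E : Type*} [NormedAddCommGroup E] [InnerProductSpace ℝ E] [FiniteDimensional ℝ E]
  [MeasurableSpace E] [BorelSpace E]

/-- A dominated sequence of functions which is equicontinuous in `L²` with respect to
translations has a subsequence which converges almost everywhere. -/
theorem exists_subseq_ae_tendsto_of_translate {Ω : Set E} (hΩ : volume Ω ≠ ⊤)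
    {w : ℕ → E → ℝ} {G : E → ℝ} (hw : ∀ k, Measurable (w k)) (hG : MemLp G 2 volume)
    (hwG : ∀ k, ∀ᵐ x, |w k x| ≤ |G x|)
    (hT : ∀ η : ℝ, 0 < η → ∃ Q : Set E, MeasurableSet Q ∧ volume Q ≠ 0 ∧ volume Q ≠ ⊤ ∧
      ∀ᶠ k in atTop, ∀ y ∈ Q, eLpNorm (fun x => w k (x + y) - w k x) 2 volume
        ≤ ENNReal.ofReal η) :
    ∃ φ : ℕ → ℕ, StrictMono φ ∧ ∃ u : E → ℝ, MemLp u 2 (volume.restrict Ω) ∧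
      ∀ᵐ x ∂volume.restrict Ω, Tendsto (fun k => w (φ k) x) atTop (𝓝 (u x)) := by
  have hw2 : ∀ k, MemLp (w k) 2 volume := fun k => hG.mono (hw k).aestronglyMeasurable (hwG k)
  have hle : ∀ k, eLpNorm (w k) 2 volume ≤ eLpNorm G 2 volume := fun k =>
    eLpNorm_mono_ae (hwG k)
  obtain ⟨φ, hφ, g, -, -, hg⟩ := exists_subseq_integral_mul_tendsto hw2
    (a := fun _ => (eLpNorm G 2 volume).toReal)
    (fun k => ENNReal.toReal_mono hG.eLpNorm_ne_top (hle k)) tendsto_const_nhds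
  have hφ' := hφ.tendsto_atTop
  have hw2Ω : ∀ k, MemLp (w (φ k)) 2 (volume.restrict Ω) := fun k => (hw2 _).restrict Ω
  -- Each late `w (φ k)` is close to its own average over `Q`, and these averages converge strongly.
  -- So late terms are near one fixed function, which makes the sequence Cauchy in `L²`. Nothing is
  -- needed of `Q` beyond measurability, positive finite measure and the translation bound.
  have hclose : ∀ η : ℝ, 0 < η → ∃ z : E → ℝ, AEStronglyMeasurable z (volume.restrict Ω) ∧
      ∀ᶠ k in atTop, eLpNorm (w (φ k) - z) 2 (volume.restrict Ω) ≤ ENNReal.ofReal η := by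
    intro η hη
    obtain ⟨Q, hQ, hQ0, hQ1, hQT⟩ := hT (η / 2) (half_pos hη)
    have := isProbabilityMeasure_uniformMeasure hQ0 hQ1
    obtain ⟨hz, hlim⟩ := tendsto_eLpNorm_average_sub hQ hQ1 hΩ (fun k => hw (φ k))
      (fun k => hw2 (φ k)) (fun k => hle (φ k)) hG hg
    refine ⟨_, hz, ?_⟩
    filter_upwards [hφ'.eventually hQT, ENNReal.tendsto_nhds_zero.1 hlim (ENNReal.ofReal (η / 2))
      (by simpa using hη)] with k hk1 hk2
    have h1 := eLpNorm_average_sub_le (ν := uniformMeasure Q) (hw (φ k))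
      (integrable_comp_add_uniformMeasure hQ0 hQ1 (hw2 (φ k))) (η := ENNReal.ofReal (η / 2))
      ((Measure.ae_smul_measure (ae_restrict_of_forall_mem hQ hk1) _))
    have hAm : Measurable fun x => ∫ y, w (φ k) (x + y) ∂(uniformMeasure Q) :=
      (StronglyMeasurable.integral_prod_right (ν := uniformMeasure Q)
        (f := fun x y => w (φ k) (x + y))
        ((hw (φ k)).comp (measurable_fst.add measurable_snd)).stronglyMeasurable).measurable
    calc eLpNorm (w (φ k) - fun x => ∫ y, g (x + y) ∂(uniformMeasure Q)) 2 (volume.restrict Ω)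
        = eLpNorm ((w (φ k) - fun x => ∫ y, w (φ k) (x + y) ∂(uniformMeasure Q))
          + ((fun x => ∫ y, w (φ k) (x + y) ∂(uniformMeasure Q))
            - fun x => ∫ y, g (x + y) ∂(uniformMeasure Q))) 2 (volume.restrict Ω) := by
          congr 1; abel
      _ ≤ _ := eLpNorm_add_le ((hw (φ k)).sub hAm).aestronglyMeasurable
          (hAm.aestronglyMeasurable.sub hz) (by norm_num)
      _ ≤ ENNReal.ofReal (η / 2) + ENNReal.ofReal (η / 2) := by
          refine add_le_add ?_ hk2
          rw [eLpNorm_sub_comm]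
          exact (eLpNorm_restrict_le _ _ _ _).trans h1
      _ = ENNReal.ofReal η := by
          rw [← ENNReal.ofReal_add (half_pos hη).le (half_pos hη).le, add_halves]
  let F : ℕ → Lp ℝ 2 (volume.restrict Ω) := fun k => (hw2Ω k).toLp (w (φ k))
  have hF : CauchySeq F := by
    rw [Metric.cauchySeq_iff']
    intro ε hε
    obtain ⟨z, hz, hev⟩ := hclose (ε / 3) (by positivity)
    obtain ⟨N, hN⟩ := eventually_atTop.1 hev
    refine ⟨N, fun k hk => ?_⟩
    rw [dist_eq_norm, ← MemLp.toLp_sub, Lp.norm_toLp]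
    have h1 : eLpNorm (w (φ k) - w (φ N)) 2 (volume.restrict Ω) ≤ ENNReal.ofReal (ε / 3 + ε / 3) :=
      calc eLpNorm (w (φ k) - w (φ N)) 2 (volume.restrict Ω)
          = eLpNorm ((w (φ k) - z) + (z - w (φ N))) 2 (volume.restrict Ω) := by congr 1; abel
        _ ≤ _ := eLpNorm_add_le ((hw2Ω k).aestronglyMeasurable.sub hz)
            (hz.sub (hw2Ω N).aestronglyMeasurable) (by norm_num)
        _ ≤ ENNReal.ofReal (ε / 3) + ENNReal.ofReal (ε / 3) := by
            refine add_le_add (hN k hk) ?_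
            rw [eLpNorm_sub_comm]
            exact hN N le_rfl
        _ = _ := by rw [ENNReal.ofReal_add (by positivity) (by positivity)]
    exact (ENNReal.toReal_le_of_le_ofReal (by positivity) h1).trans_lt (by linarith)
  obtain ⟨u, hu⟩ := cauchySeq_tendsto_of_complete hF
  have hmeas := tendstoInMeasure_of_tendsto_Lp hu
  obtain ⟨θ, hθ, hae⟩ := hmeas.exists_seq_tendsto_ae
  refine ⟨φ ∘ θ, hφ.comp hθ, u, Lp.memLp u, ?_⟩
  have hall : ∀ᵐ x ∂volume.restrict Ω, ∀ k, F (θ k) x = w (φ (θ k)) x :=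
    ae_all_iff.2 fun k => (hw2Ω (θ k)).coeFn_toLp
  filter_upwards [hae, hall] with x hx1 hx2
  simpa only [hx2, Function.comp_apply] using hx1

/-- The part of `Ω` that leaves `Ω` under a small translation carries little `L²`-mass. -/
theorem tendsto_eLpNorm_indicator_diff_shiftDomain {Ω : Set E} (hΩ : IsOpen Ω) {G : E → ℝ}
    (hG : MemLp G 2 volume) :
    Tendsto (fun y => eLpNorm ((Ω \ shiftDomain Ω y).indicator G) 2 volume) (𝓝 0) (𝓝 0) := by
  refine tendsto_eLpNorm_two_zero_of_dominated (G := G) (fun y => ?_) hG (fun y => ?_) ?_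
  · exact hG.aestronglyMeasurable.indicator
      (hΩ.measurableSet.diff (hΩ.shiftDomain y).measurableSet)
  · exact Eventually.of_forall fun x => norm_indicator_le_norm_self G x
  · refine Eventually.of_forall fun x => ?_
    refine tendsto_const_nhds.congr' ?_
    by_cases hx : x ∈ Ω
    · have h1 : Tendsto (fun y => x + y) (𝓝 0) (𝓝 x) := by
        simpa using (continuous_const_add x).tendsto (0 : E)
      filter_upwards [h1.eventually (hΩ.mem_nhds hx)] with y hy
      rw [Set.indicator_of_notMem]
      exact fun h => h.2 ⟨hx, hy⟩
    · exact Eventually.of_forall fun y => (Set.indicator_of_notMem (fun h => hx h.1) _).symm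

/-- The effect of a translation on a function which vanishes outside `Ω`. -/
theorem eLpNorm_translate_sub_le_shiftDomain {Ω : Set E} (hΩ : IsOpen Ω) {w G : E → ℝ}
    (hw : Measurable w) (hw0 : ∀ x ∉ Ω, w x = 0) (hwG : ∀ᵐ x, |w x| ≤ |G x|) (y : E) :
    eLpNorm (fun x => w (x + y) - w x) 2 volume
      ≤ eLpNorm (fun x => w (x + y) - w x) 2 (volume.restrict (shiftDomain Ω y))
        + eLpNorm ((Ω \ shiftDomain Ω (-y)).indicator G) 2 volume
        + eLpNorm ((Ω \ shiftDomain Ω y).indicator G) 2 volume := by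
  have hmD : ∀ y : E, MeasurableSet (Ω \ shiftDomain Ω y) := fun y =>
    hΩ.measurableSet.diff (hΩ.shiftDomain y).measurableSet
  -- The difference splits into the points that stay in `Ω` (`f1`), those that enter it (`f2`) and
  -- those that leave it (`f3`).
  set f1 : E → ℝ := (shiftDomain Ω y).indicator fun x => w (x + y) - w x
  set f2 : E → ℝ := fun x => (Ω \ shiftDomain Ω (-y)).indicator w (x + y)
  set f3 : E → ℝ := (Ω \ shiftDomain Ω y).indicator w
  have hm1 : Measurable f1 :=
    ((hw.comp (measurable_add_const y)).sub hw).indicator (hΩ.shiftDomain y).measurableSet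
  have hm2' : Measurable ((Ω \ shiftDomain Ω (-y)).indicator w) := hw.indicator (hmD _)
  have hm2 : Measurable f2 := hm2'.comp (measurable_add_const y)
  have hm3 : Measurable f3 := hw.indicator (hmD _)
  have hdecomp : (fun x => w (x + y) - w x) = f1 + f2 - f3 := by
    ext x
    have hsd : x ∈ shiftDomain Ω y ↔ x ∈ Ω ∧ x + y ∈ Ω := Iff.rfl
    have hsd' : x + y ∈ shiftDomain Ω (-y) ↔ x + y ∈ Ω ∧ x ∈ Ω := by
      simp [shiftDomain]
    by_cases h1 : x ∈ Ω <;> by_cases h2 : x + y ∈ Ω <;>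
      simp [f1, f2, f3, Set.indicator, hsd, hsd', h1, h2, hw0]
  have hn2 : eLpNorm f2 2 volume ≤ eLpNorm ((Ω \ shiftDomain Ω (-y)).indicator G) 2 volume := by
    rw [eLpNorm_comp_add_right hm2'.aestronglyMeasurable y]
    refine eLpNorm_mono_ae ?_
    filter_upwards [hwG] with x hx
    by_cases h : x ∈ Ω \ shiftDomain Ω (-y)
    · simp only [Set.indicator_of_mem h]; exact hx
    · simp [Set.indicator_of_notMem h]
  have hn3 : eLpNorm f3 2 volume ≤ eLpNorm ((Ω \ shiftDomain Ω y).indicator G) 2 volume := by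
    refine eLpNorm_mono_ae ?_
    filter_upwards [hwG] with x hx
    by_cases h : x ∈ Ω \ shiftDomain Ω y
    · simp only [f3, Set.indicator_of_mem h]; exact hx
    · simp [f3, Set.indicator_of_notMem h]
  have hn1 : eLpNorm f1 2 volume
      = eLpNorm (fun x => w (x + y) - w x) 2 (volume.restrict (shiftDomain Ω y)) :=
    eLpNorm_indicator_eq_eLpNorm_restrict (hΩ.shiftDomain y).measurableSet
  have t1 : eLpNorm (f1 + f2 - f3) 2 volume
      ≤ eLpNorm (f1 + f2) 2 volume + eLpNorm f3 2 volume :=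
    eLpNorm_sub_le (hm1.add hm2).aestronglyMeasurable hm3.aestronglyMeasurable (by norm_num)
  have t2 : eLpNorm (f1 + f2) 2 volume ≤ eLpNorm f1 2 volume + eLpNorm f2 2 volume :=
    eLpNorm_add_le hm1.aestronglyMeasurable hm2.aestronglyMeasurable (by norm_num)
  rw [← hn1, hdecomp]
  exact t1.trans (add_le_add (t2.trans (add_le_add le_rfl hn2)) hn3)

end Kolmogorov

theorem EuclideanSpace.eq_sum_smul_single {n : ℕ} (y : EuclideanSpace ℝ (Fin n)) :
    y = ∑ i, y i • EuclideanSpace.single i (1 : ℝ) := by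
  have := (EuclideanSpace.basisFun (Fin n) ℝ).sum_repr y
  simpa using this.symm

theorem ae_shiftDomain_eq {E : Type*} [NormedAddCommGroup E] [MeasurableSpace E] [BorelSpace E]
    {μ : Measure E} [μ.IsAddRightInvariant] {Ω : Set E} (hΩ : IsOpen Ω) {w w' : E → ℝ}
    (h : ∀ᵐ x ∂μ.restrict Ω, w x = w' x) (y : E) :
    ∀ᵐ x ∂μ.restrict (shiftDomain Ω y), w (x + y) - w x = w' (x + y) - w' x := by
  rw [ae_restrict_iff' hΩ.measurableSet] at h
  rw [ae_restrict_iff' (hΩ.shiftDomain y).measurableSet]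
  filter_upwards [h, (measurePreserving_add_right μ y).quasiMeasurePreserving.ae h]
    with x h1 h2 hx
  rw [h1 hx.1, h2 hx.2]

/-- A dominated sequence of functions on `Ω` which is equicontinuous in `L²` with respect to
translations along the coordinate axes has a subsequence which converges almost everywhere. -/
theorem exists_subseq_ae_tendsto {n : ℕ} {Ω : Set (EuclideanSpace ℝ (Fin n))} (hΩ : IsOpen Ω)
    (hfin : volume Ω ≠ ⊤) {w : ℕ → EuclideanSpace ℝ (Fin n) → ℝ}
    {G : EuclideanSpace ℝ (Fin n) → ℝ}
    (hw : ∀ k, AEStronglyMeasurable (w k) (volume.restrict Ω))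
    (hG : MemLp G 2 (volume.restrict Ω)) (hwG : ∀ k, ∀ᵐ x ∂volume.restrict Ω, |w k x| ≤ |G x|)
    (hT : ∀ i : Fin n, ∀ η : ℝ, 0 < η → ∃ ρ > 0, ∀ᶠ k in atTop, ∀ τ : ℝ, 0 ≤ τ → τ ≤ ρ →
      eLpNorm (fun x => w k (x + τ • EuclideanSpace.single i 1) - w k x) 2
        (volume.restrict (shiftDomain Ω (τ • EuclideanSpace.single i 1))) ≤ ENNReal.ofReal η) :
    ∃ φ : ℕ → ℕ, StrictMono φ ∧ ∃ u, MemLp u 2 (volume.restrict Ω) ∧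
      ∀ᵐ x ∂volume.restrict Ω, Tendsto (fun k => w (φ k) x) atTop (𝓝 (u x)) := by
  let W : ℕ → EuclideanSpace ℝ (Fin n) → ℝ := fun k => Ω.indicator ((hw k).mk (w k))
  have hW : ∀ k, Measurable (W k) := fun k =>
    (hw k).stronglyMeasurable_mk.measurable.indicator hΩ.measurableSet
  have hWw : ∀ k, ∀ᵐ x ∂volume.restrict Ω, w k x = W k x := fun k => by
    filter_upwards [(hw k).ae_eq_mk, ae_restrict_mem hΩ.measurableSet] with x hx hxΩ
    rw [hx]; simp [W, hxΩ]
  have hG' : MemLp (Ω.indicator G) 2 volume := (memLp_indicator_iff_restrict hΩ.measurableSet).2 hG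
  have hWG : ∀ k, ∀ᵐ x, |W k x| ≤ |Ω.indicator G x| := fun k => by
    have h1 := hWw k
    have h2 := hwG k
    rw [ae_restrict_iff' hΩ.measurableSet] at h1 h2
    filter_upwards [h1, h2] with x hx1 hx2
    by_cases hx : x ∈ Ω
    · rw [← hx1 hx]; simpa [hx] using hx2 hx
    · simp [W, hx]
  have hout : ∀ η : ℝ, 0 < η → ∃ r > 0, ∀ y : EuclideanSpace ℝ (Fin n), ‖y‖ < r →
      eLpNorm ((Ω \ shiftDomain Ω y).indicator (Ω.indicator G)) 2 volume ≤ ENNReal.ofReal η := by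
    intro η hη
    have h1 := ENNReal.tendsto_nhds_zero.1 (tendsto_eLpNorm_indicator_diff_shiftDomain hΩ hG')
      (ENNReal.ofReal η) (by simpa using hη)
    obtain ⟨r, hr, hball⟩ := Metric.eventually_nhds_iff.1 h1
    exact ⟨r, hr, fun y hy => hball (by simpa using hy)⟩
  obtain ⟨φ, hφ, u, hu, hae⟩ := exists_subseq_ae_tendsto_of_translate hfin hW hG' hWG (by
    intro η hη
    -- There are `n` coordinate shifts, each costing `3 * η'`: one interior term and two boundary
    -- layers. Using `n + 1` keeps the quotient meaningful for `n = 0`.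
    set η' : ℝ := η / (3 * (n + 1)) with hη'
    have hη'0 : 0 < η' := by positivity
    obtain ⟨r, hr, hrout⟩ := hout η' hη'0
    choose ρ hρ0 hρ using fun i => hT i η' hη'0
    obtain ⟨ρ', hρ'0, hρ'⟩ : ∃ ρ' > 0, ρ' < r ∧ ∀ i, ρ' ≤ ρ i := by
      obtain ⟨m, hm0, hm⟩ : ∃ m > 0, ∀ i, m ≤ ρ i := by
        have h1 := (Filter.eventually_all (l := 𝓝[>] (0 : ℝ))).2 fun i =>
          (eventually_le_nhds (hρ0 i)).filter_mono nhdsWithin_le_nhds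
        obtain ⟨m, hm, hm0⟩ := (h1.and eventually_mem_nhdsWithin).exists
        exact ⟨m, hm0, hm⟩
      exact ⟨min m (r / 2), by positivity, (min_le_right _ _).trans_lt (by linarith),
        fun i => (min_le_left _ _).trans (hm i)⟩
    -- The ball is pushed into the positive orthant so that all coordinates of its points lie in
    -- `[0, ρ']`, since only nonnegative shifts are controlled.
    let c : EuclideanSpace ℝ (Fin n) := WithLp.toLp 2 fun _ => ρ' / 2
    have hQ : ∀ y ∈ Metric.ball c (ρ' / 2), ∀ i, 0 ≤ y i ∧ y i ≤ ρ' := by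
      intro y hy i
      rw [Metric.mem_ball, dist_eq_norm] at hy
      have h1 := (PiLp.norm_apply_le (y - c) i).trans hy.le
      simp only [PiLp.sub_apply, c, Real.norm_eq_abs] at h1
      have := abs_le.1 h1
      constructor <;> linarith
    refine ⟨Metric.ball c (ρ' / 2), measurableSet_ball, ?_, measure_ball_lt_top.ne, ?_⟩
    · exact (Metric.measure_ball_pos volume c (by positivity)).ne'
    filter_upwards [eventually_all.2 hρ] with k hk y hy
    have hbound : ∀ i, eLpNorm (fun x => W k (x + y i • EuclideanSpace.single i (1 : ℝ)) - W k x) 2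
        volume ≤ ENNReal.ofReal (3 * η') := by
      intro i
      have hyi := hQ y hy i
      set a := y i • EuclideanSpace.single i (1 : ℝ) with ha
      have hna : ‖a‖ < r := by
        rw [ha, norm_smul, PiLp.norm_single, norm_one, mul_one, Real.norm_eq_abs,
          abs_of_nonneg hyi.1]
        exact hyi.2.trans_lt hρ'.1
      refine (eLpNorm_translate_sub_le_shiftDomain hΩ (hW k)
        (fun x hx => Set.indicator_of_notMem hx _) (hWG k) a).trans ?_
      have e1 : eLpNorm (fun x => W k (x + a) - W k x) 2 (volume.restrict (shiftDomain Ω a))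
          ≤ ENNReal.ofReal η' := by
        rw [← eLpNorm_congr_ae (ae_shiftDomain_eq hΩ (hWw k) a)]
        exact hk i (y i) hyi.1 (hyi.2.trans (hρ'.2 i))
      have e2 := hrout a hna
      have e3 := hrout (-a) (by rwa [norm_neg])
      refine (add_le_add (add_le_add e1 e3) e2).trans (le_of_eq ?_)
      rw [← ENNReal.ofReal_add hη'0.le hη'0.le, ← ENNReal.ofReal_add (by positivity) hη'0.le]
      congr 1; ring
    have hsum := eLpNorm_translate_sum_le (hW k) Finset.univ
      fun i => y i • EuclideanSpace.single i (1 : ℝ)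
    rw [← EuclideanSpace.eq_sum_smul_single y] at hsum
    refine hsum.trans ((Finset.sum_le_sum fun i _ => hbound i).trans ?_)
    rw [Finset.sum_const, Finset.card_univ, Fintype.card_fin, ← ENNReal.ofReal_nsmul]
    refine ENNReal.ofReal_le_ofReal ?_
    rw [hη', nsmul_eq_mul]
    have h3 : (n : ℝ) * (3 * (η / (3 * (n + 1)))) = η * (n / (n + 1)) := by field_simp
    rw [h3]
    refine mul_le_of_le_one_right hη.le ?_
    rw [div_le_one (by positivity)]
    linarith)
  refine ⟨φ, hφ, u, hu, ?_⟩
  filter_upwards [hae, ae_all_iff.2 hWw] with x hx1 hx2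
  simpa only [hx2] using hx1

/-! ### Weak derivatives of limits -/

section WeakLimit

theorem eventually_subset_shiftDomain {E : Type*} [NormedAddCommGroup E] {Ω K : Set E}
    (hΩ : IsOpen Ω) (hK : IsCompact K)
    (hKΩ : K ⊆ Ω) : ∀ᶠ y in 𝓝 (0 : E), K ⊆ shiftDomain Ω y := by
  obtain ⟨δ, hδ, hsub⟩ := hK.exists_thickening_subset_open hΩ hKΩ
  filter_upwards [Metric.ball_mem_nhds (0 : E) hδ] with y hy x hx
  refine ⟨hKΩ hx, hsub (Metric.mem_thickening_iff.2 ⟨x, hx, ?_⟩)⟩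
  simpa using hy

variable {E : Type*} [NormedAddCommGroup E] [InnerProductSpace ℝ E] [FiniteDimensional ℝ E]
  [MeasurableSpace E] [BorelSpace E]

/-- With the difference quotient on the smooth factor, dominated convergence is enough, and the `w
k` need not be weakly differentiable. -/
theorem tendsto_integral_mul_difference_quotient {Ω : Set E} {w : ℕ → E → ℝ} {u G : E → ℝ}
    (hw : ∀ k, AEStronglyMeasurable (w k) (volume.restrict Ω)) (hG : IntegrableOn G Ω)
    (hwG : ∀ k, ∀ᵐ x ∂volume.restrict Ω, |w k x| ≤ |G x|)
    (hlim : ∀ᵐ x ∂volume.restrict Ω, Tendsto (fun k => w k x) atTop (𝓝 (u x)))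
    {τ : ℕ → ℝ} (hτ0 : ∀ k, 0 < τ k) (hτ : Tendsto τ atTop (𝓝 0)) (e : E) {ψ : E → ℝ}
    (hψ : ContDiff ℝ ∞ ψ) (hψc : HasCompactSupport ψ) :
    Tendsto (fun k => ∫ x in Ω, w k x * ((τ k)⁻¹ * (ψ (x - τ k • e) - ψ x))) atTop
      (𝓝 (-∫ x in Ω, u x * fderiv ℝ ψ x e)) := by
  have hdc : Continuous (fderiv ℝ ψ) := hψ.continuous_fderiv (by simp)
  obtain ⟨C, hC⟩ := (hψc.fderiv ℝ).exists_bound_of_continuous hdc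
  have hquot : ∀ k x, |(τ k)⁻¹ * (ψ (x - τ k • e) - ψ x)| ≤ C * ‖e‖ := fun k x => by
    have h1 := Convex.norm_image_sub_le_of_norm_fderiv_le (𝕜 := ℝ) (f := ψ) (s := Set.univ) (C := C)
      (fun z _ => hψ.differentiable (by simp) z) (fun z _ => hC z) convex_univ
      (Set.mem_univ x) (Set.mem_univ (x - τ k • e))
    have h2 : ‖x - τ k • e - x‖ = τ k * ‖e‖ := by
      rw [sub_sub_cancel_left, norm_neg, norm_smul, Real.norm_eq_abs, abs_of_pos (hτ0 k)]
    rw [h2, Real.norm_eq_abs] at h1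
    rw [abs_mul, abs_inv, abs_of_pos (hτ0 k), inv_mul_le_iff₀ (hτ0 k)]
    linarith
  rw [← integral_neg]
  refine tendsto_integral_of_dominated_convergence (fun x => |G x| * (C * ‖e‖)) (fun k => ?_)
    (hG.abs.mul_const _) (fun k => ?_) ?_
  · refine (hw k).mul (Continuous.aestronglyMeasurable ?_)
    have := hψ.continuous
    fun_prop
  · filter_upwards [hwG k] with x hx
    rw [norm_mul, Real.norm_eq_abs, Real.norm_eq_abs]
    exact mul_le_mul hx (hquot k x) (abs_nonneg _) (abs_nonneg _)
  · filter_upwards [hlim] with x hx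
    have h1 : HasDerivAt (fun t : ℝ => x - t • e) (-e) 0 := by
      simpa using ((hasDerivAt_id (0 : ℝ)).smul_const e).const_sub x
    have h2 : HasFDerivAt ψ (fderiv ℝ ψ x) (x - (0 : ℝ) • e) := by
      simpa using (hψ.differentiable (by simp) x).hasFDerivAt
    have h3 := (h2.comp_hasDerivAt (0 : ℝ) h1).tendsto_slope_zero
    have hτ' : Tendsto τ atTop (𝓝[≠] 0) :=
      tendsto_nhdsWithin_iff.2 ⟨hτ, Eventually.of_forall fun k => (hτ0 k).ne'⟩
    have h4 := hx.mul (h3.comp hτ')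
    simpa [Function.comp_def] using h4

/-- If the difference quotients of a dominated sequence are bounded in `L²`, the limit has a
square integrable weak derivative satisfying the same bound. -/
theorem exists_isWeakDerivAlong_of_tendsto {Ω : Set E} (hΩ : IsOpen Ω) (hfin : volume Ω ≠ ⊤)
    {w : ℕ → E → ℝ} {u G : E → ℝ}
    (hw : ∀ k, AEStronglyMeasurable (w k) (volume.restrict Ω))
    (hG : MemLp G 2 (volume.restrict Ω)) (hwG : ∀ k, ∀ᵐ x ∂volume.restrict Ω, |w k x| ≤ |G x|)
    (hlim : ∀ᵐ x ∂volume.restrict Ω, Tendsto (fun k => w k x) atTop (𝓝 (u x)))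
    {τ : ℕ → ℝ} (hτ0 : ∀ k, 0 < τ k) (hτ : Tendsto τ atTop (𝓝 0)) (e : E) {a : ℕ → ℝ} {A : ℝ}
    (ha0 : ∀ k, 0 ≤ a k) (ha : Tendsto a atTop (𝓝 A))
    (hwa : ∀ k, eLpNorm (fun x => w k (x + τ k • e) - w k x) 2
      (volume.restrict (shiftDomain Ω (τ k • e))) ≤ ENNReal.ofReal (τ k * a k)) :
    ∃ g, MemLp g 2 (volume.restrict Ω) ∧ (eLpNorm g 2 (volume.restrict Ω)).toReal ≤ A ∧
      IsWeakDerivAlong Ω u e g := by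
  have : IsFiniteMeasure (volume.restrict Ω) := ⟨by simpa using hfin.lt_top⟩
  have hGi : IntegrableOn G Ω := hG.integrable (by norm_num)
  have hw2 : ∀ k, MemLp (w k) 2 (volume.restrict Ω) := fun k => hG.mono (hw k) (hwG k)
  have hwi : ∀ k, IntegrableOn (w k) Ω := fun k => (hw2 k).integrable (by norm_num)
  have hsm : ∀ y : E, MeasurableSet (shiftDomain Ω y) := fun y => (hΩ.shiftDomain y).measurableSet
  have hrr : ∀ y : E, (volume.restrict Ω).restrict (shiftDomain Ω y)
      = volume.restrict (shiftDomain Ω y) := fun y => by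
    rw [Measure.restrict_restrict (hsm y), Set.inter_eq_left.2
      (show shiftDomain Ω y ⊆ Ω from Set.inter_subset_left)]
  -- The difference quotients, extended by zero to `Ω` so that they form one bounded sequence in
  -- `L²(Ω)`; a weak limit of them is the derivative sought.
  let f : ℕ → E → ℝ := fun k => (shiftDomain Ω (τ k • e)).indicator
    ((τ k)⁻¹ • fun x => w k (x + τ k • e) - w k x)
  have hf2 : ∀ k, MemLp (f k) 2 (volume.restrict Ω) := fun k => by
    rw [memLp_indicator_iff_restrict (hsm _), hrr]
    exact ((hw2 k).shiftDomain_sub hΩ _).const_smul _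
  have hfa : ∀ k, (eLpNorm (f k) 2 (volume.restrict Ω)).toReal ≤ a k := fun k => by
    refine ENNReal.toReal_le_of_le_ofReal (ha0 k) ?_
    rw [eLpNorm_indicator_eq_eLpNorm_restrict (hsm _), hrr, eLpNorm_const_smul]
    calc ‖(τ k)⁻¹‖ₑ * _ ≤ ‖(τ k)⁻¹‖ₑ * ENNReal.ofReal (τ k * a k) := by gcongr; exact hwa k
      _ = ENNReal.ofReal (a k) := by
        rw [Real.enorm_eq_ofReal (inv_nonneg.2 (hτ0 k).le),
          ← ENNReal.ofReal_mul (inv_nonneg.2 (hτ0 k).le), inv_mul_cancel_left₀ (hτ0 k).ne']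
  obtain ⟨φ, hφ, g, hg, hgA, hgl⟩ := exists_subseq_integral_mul_tendsto hf2 hfa ha
  refine ⟨g, hg, hgA, fun ψ hψ hψc hψΩ => ?_⟩
  have hψ2 : MemLp ψ 2 (volume.restrict Ω) := hψ.continuous.memLp_of_hasCompactSupport hψc
  have h1 := hgl ψ hψ2
  have h2 := (tendsto_integral_mul_difference_quotient hw hGi hwG hlim hτ0 hτ e hψ hψc).comp
    hφ.tendsto_atTop
  have hτe : Tendsto (fun k => τ k • e) atTop (𝓝 0) := by simpa using hτ.smul_const e
  -- Once the step is small, the support of `ψ` lies in the shifted domain and the discrete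
  -- integration by parts is exact.
  have hev : ∀ᶠ k in atTop, ∫ x in Ω, w k x * ((τ k)⁻¹ * (ψ (x - τ k • e) - ψ x))
      = ∫ x in Ω, f k x * ψ x := by
    filter_upwards [hτe.eventually (eventually_subset_shiftDomain hΩ hψc hψΩ)] with k hk
    have e1 : ∫ x in Ω, f k x * ψ x
        = (τ k)⁻¹ * ∫ x in shiftDomain Ω (τ k • e), (w k (x + τ k • e) - w k x) * ψ x := by
      rw [← integral_const_mul, ← hrr, ← integral_indicator (hsm _)]
      congr 1 with x
      by_cases hx : x ∈ shiftDomain Ω (τ k • e)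
      · simp [f, hx, mul_assoc]
      · simp [f, hx]
    obtain ⟨C, hC⟩ := hψc.exists_bound_of_continuous hψ.continuous
    have hi : ∀ b : E, Integrable (fun x => w k x * ψ (x - b)) (volume.restrict Ω) := fun b =>
      Integrable.mul_bdd (c := C) (hwi k)
        (hψ.continuous.comp (continuous_sub_right b)).aestronglyMeasurable
        (Eventually.of_forall fun x => hC _)
    have hi0 : Integrable (fun x => w k x * ψ x) (volume.restrict Ω) := by simpa using hi 0
    rw [e1, integral_shiftDomain_sub_mul hΩ (hwi k) hψ.continuous hψc _ hk,
      ← integral_sub (hi _) hi0, ← integral_const_mul]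
    congr 1 with x
    ring
  have h3 : Tendsto (fun k => ∫ x in Ω, f (φ k) x * ψ x) atTop
      (𝓝 (-∫ x in Ω, u x * fderiv ℝ ψ x e)) :=
    h2.congr' ((hφ.tendsto_atTop.eventually hev).mono fun k hk => hk)
  have h4 := tendsto_nhds_unique h1 h3
  linarith

end WeakLimit

/-! ### The energy by components and its lower semicontinuity -/

section Energy

variable {n : ℕ}

/-- The measure of the part of `Ω` where `|v| < 1`. -/
noncomputable def phaseVolume (Ω : Set (EuclideanSpace ℝ (Fin n)))
    (v : EuclideanSpace ℝ (Fin n) → ℝ) : ℝ≥0∞ :=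
  ∫⁻ x in Ω, Set.indicator {y | |v y| < 1} 1 x

theorem enorm_sq_eq_sum (y : EuclideanSpace ℝ (Fin n)) : ‖y‖ₑ ^ 2 = ∑ i, ‖y i‖ₑ ^ 2 := by
  have h := EuclideanSpace.norm_sq_eq y
  have h1 : ∀ a : ℝ, ‖a‖ₑ ^ 2 = ENNReal.ofReal (‖a‖ ^ 2) := fun a => by
    rw [← ofReal_norm, ENNReal.ofReal_pow (norm_nonneg _)]
  simp only [h1]
  rw [← ofReal_norm, ← ENNReal.ofReal_pow (norm_nonneg _), h,
    ENNReal.ofReal_sum_of_nonneg fun i _ => sq_nonneg _]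

theorem eLpNorm_two_sq_eq {α : Type*} [MeasurableSpace α] {μ : Measure α} (f : α → ℝ) :
    eLpNorm f 2 μ ^ 2 = ∫⁻ x, ‖f x‖ₑ ^ 2 ∂μ := by
  rw [eLpNorm_eq_lintegral_rpow_enorm_toReal (by simp) (by simp)]
  have h2 : ((2 : ℝ≥0∞).toReal) = 2 := by simp
  rw [h2, ← ENNReal.rpow_natCast, ← ENNReal.rpow_mul]
  norm_num

theorem IsWeakGradient.isWeakDerivAlong {Ω : Set (EuclideanSpace ℝ (Fin n))}
    {v : EuclideanSpace ℝ (Fin n) → ℝ} {g : EuclideanSpace ℝ (Fin n) → EuclideanSpace ℝ (Fin n)}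
    (hg : IsWeakGradient Ω v g) (i : Fin n) :
    IsWeakDerivAlong Ω v (EuclideanSpace.single i 1) fun x => g x i :=
  fun φ hφ hc hs => hg.integral_eq φ hφ hc hs i

theorem MeasureTheory.MemLp.apply_euclidean {α : Type*} [MeasurableSpace α] {μ : Measure α}
    {g : α → EuclideanSpace ℝ (Fin n)} (hg : MemLp g 2 μ) (i : Fin n) :
    MemLp (fun x => g x i) 2 μ :=
  (EuclideanSpace.proj (𝕜 := ℝ) i).comp_memLp' hg

/-- The energy is split by coordinate because each directional derivative of a limit is bounded
separately. -/
theorem energy_eq {Ω : Set (EuclideanSpace ℝ (Fin n))} (hΩ : IsOpen Ω)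
    {v : EuclideanSpace ℝ (Fin n) → ℝ} {g : EuclideanSpace ℝ (Fin n) → EuclideanSpace ℝ (Fin n)}
    (hg : IsWeakGradient Ω v g) (hg2 : MemLp g 2 (volume.restrict Ω)) :
    energy Ω v = ∑ i, eLpNorm (fun x => g x i) 2 (volume.restrict Ω) ^ 2 + phaseVolume Ω v := by
  have h1 : energy Ω v = ∫⁻ x in Ω, (‖g x‖ₑ ^ 2 + Set.indicator {y | |v y| < 1} 1 x) := by
    refine lintegral_congr_ae ?_
    filter_upwards [hg.ae_eq_weakGradient hΩ] with x hx
    rw [hx]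
  rw [h1, lintegral_add_left' (hg2.aestronglyMeasurable.enorm.pow_const _)]
  congr 1
  simp only [enorm_sq_eq_sum, eLpNorm_two_sq_eq]
  exact lintegral_finsetSum' _ fun i _ =>
    ((hg2.apply_euclidean i).aestronglyMeasurable.enorm.pow_const _)

theorem exists_isWeakGradient_of_forall {Ω : Set (EuclideanSpace ℝ (Fin n))}
    (hfin : volume Ω ≠ ⊤) {v : EuclideanSpace ℝ (Fin n) → ℝ} (hv : MemLp v 2 (volume.restrict Ω))
    {g : Fin n → EuclideanSpace ℝ (Fin n) → ℝ} (hg2 : ∀ i, MemLp (g i) 2 (volume.restrict Ω))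
    (hg : ∀ i, IsWeakDerivAlong Ω v (EuclideanSpace.single i 1) (g i)) :
    ∃ G, IsWeakGradient Ω v G ∧ MemLp G 2 (volume.restrict Ω) ∧ ∀ x i, G x i = g i x := by
  have : IsFiniteMeasure (volume.restrict Ω) := ⟨by simpa using hfin.lt_top⟩
  let G : EuclideanSpace ℝ (Fin n) → EuclideanSpace ℝ (Fin n) := fun x =>
    ∑ i, g i x • EuclideanSpace.single i (1 : ℝ)
  have hG : ∀ x i, G x i = g i x := fun x i => by
    simp [G, Finset.sum_apply, Pi.single_apply]
  have hG2 : MemLp G 2 (volume.restrict Ω) := memLp_finsetSum _ fun i _ =>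
    (ContinuousLinearMap.toSpanSingleton ℝ
      (EuclideanSpace.single i (1 : ℝ) : EuclideanSpace ℝ (Fin n))).comp_memLp' (hg2 i)
  have hvi : IntegrableOn v Ω := hv.integrable (by norm_num)
  have hGi : IntegrableOn G Ω := hG2.integrable (by norm_num)
  refine ⟨G, ⟨hvi.locallyIntegrableOn, hGi.locallyIntegrableOn, fun φ hφ hc hs i => ?_⟩, hG2, hG⟩
  simp only [hG]
  exact hg i φ hφ hc hs

theorem aemeasurable_indicator_abs_lt_one {α : Type*} [MeasurableSpace α] {μ : Measure α}
    {v : α → ℝ} (hv : AEMeasurable v μ) :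
    AEMeasurable (Set.indicator {y | |v y| < 1} (1 : α → ℝ≥0∞)) μ := by
  have h : Measurable (Set.indicator {t : ℝ | |t| < 1} (1 : ℝ → ℝ≥0∞)) :=
    measurable_one.indicator (measurableSet_lt measurable_norm measurable_const)
  exact h.comp_aemeasurable hv

/-- The volume of `{|v| < 1}` is lower semicontinuous under almost everywhere convergence. -/
theorem phaseVolume_le_of_tendsto {Ω : Set (EuclideanSpace ℝ (Fin n))}
    {w : ℕ → EuclideanSpace ℝ (Fin n) → ℝ} {u : EuclideanSpace ℝ (Fin n) → ℝ}
    (hw : ∀ k, AEStronglyMeasurable (w k) (volume.restrict Ω))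
    (hlim : ∀ᵐ x ∂volume.restrict Ω, Tendsto (fun k => w k x) atTop (𝓝 (u x))) {m : ℝ≥0∞}
    (hm : Tendsto (fun k => phaseVolume Ω (w k)) atTop (𝓝 m)) : phaseVolume Ω u ≤ m := by
  rw [← hm.liminf_eq]
  refine le_trans ?_ (lintegral_liminf_le' fun k =>
    aemeasurable_indicator_abs_lt_one (hw k).aemeasurable)
  refine lintegral_mono_ae ?_
  filter_upwards [hlim] with x hx
  by_cases h : |u x| < 1
  -- The set `{|t| < 1}` is open, so the indicators are eventually `1` wherever the limit has
  -- indicator `1`; Fatou needs only this inequality.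
  · have hev : ∀ᶠ k in atTop,
        Set.indicator {y | |w k y| < 1} (1 : EuclideanSpace ℝ (Fin n) → ℝ≥0∞) x = 1 := by
      filter_upwards [hx.abs.eventually_lt_const h] with k hk
      exact Set.indicator_of_mem (s := {y | |w k y| < 1}) hk _
    rw [Tendsto.liminf_eq (tendsto_const_nhds.congr' (hev.mono fun k hk => hk.symm))]
    exact (Set.indicator_of_mem (s := {y | |u y| < 1}) h 1).le
  · rw [Set.indicator_of_notMem (s := {y | |u y| < 1}) h]
    exact zero_le

/-- The compactness and lower semicontinuity principle behind the existence of minimizers. -/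
theorem exists_subseq_tendsto_memH1_energy_le {Ω : Set (EuclideanSpace ℝ (Fin n))}
    (hΩ : IsOpen Ω) (hfin : volume Ω ≠ ⊤) {w : ℕ → EuclideanSpace ℝ (Fin n) → ℝ}
    {G : EuclideanSpace ℝ (Fin n) → ℝ}
    (hw : ∀ k, AEStronglyMeasurable (w k) (volume.restrict Ω))
    (hG : MemLp G 2 (volume.restrict Ω)) (hwG : ∀ k, ∀ᵐ x ∂volume.restrict Ω, |w k x| ≤ |G x|)
    (hT : ∀ i : Fin n, ∀ η : ℝ, 0 < η → ∃ ρ > 0, ∀ᶠ k in atTop, ∀ τ : ℝ, 0 ≤ τ → τ ≤ ρ →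
      eLpNorm (fun x => w k (x + τ • EuclideanSpace.single i 1) - w k x) 2
        (volume.restrict (shiftDomain Ω (τ • EuclideanSpace.single i 1))) ≤ ENNReal.ofReal η)
    {A : Fin n → ℝ} (hA : ∀ i : Fin n, ∃ τ a : ℕ → ℝ, (∀ k, 0 < τ k) ∧ Tendsto τ atTop (𝓝 0) ∧
      (∀ k, 0 ≤ a k) ∧ Tendsto a atTop (𝓝 (A i)) ∧
      ∀ k, eLpNorm (fun x => w k (x + τ k • EuclideanSpace.single i 1) - w k x) 2
        (volume.restrict (shiftDomain Ω (τ k • EuclideanSpace.single i 1)))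
          ≤ ENNReal.ofReal (τ k * a k))
    {m : ℝ≥0∞} (hm : Tendsto (fun k => phaseVolume Ω (w k)) atTop (𝓝 m)) :
    ∃ φ : ℕ → ℕ, StrictMono φ ∧ ∃ u, MemH1 Ω u ∧
      (∀ᵐ x ∂volume.restrict Ω, Tendsto (fun k => w (φ k) x) atTop (𝓝 (u x))) ∧
      energy Ω u ≤ ∑ i, ENNReal.ofReal (A i) ^ 2 + m := by
  -- The hypotheses play different roles: `hT` covers all small shifts without a sharp rate and
  -- gives compactness, while `hA` covers a single sequence of steps with the right constant and
  -- gives the gradient bound.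
  obtain ⟨φ, hφ, u, hu2, hlim⟩ := exists_subseq_ae_tendsto hΩ hfin hw hG hwG hT
  have hφ' := hφ.tendsto_atTop
  choose τ a hτ0 hτ ha0 ha hτa using hA
  choose g hg2 hgA hg using fun i => exists_isWeakDerivAlong_of_tendsto hΩ hfin
    (fun k => hw (φ k)) hG (fun k => hwG (φ k)) hlim (fun k => hτ0 i (φ k)) ((hτ i).comp hφ')
    (EuclideanSpace.single i 1) (fun k => ha0 i (φ k)) ((ha i).comp hφ') fun k => hτa i (φ k)
  obtain ⟨g', hg', hg2', hgg⟩ := exists_isWeakGradient_of_forall hfin hu2 hg2 hg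
  refine ⟨φ, hφ, u, ⟨hu2, g', hg', hg2'⟩, hlim, ?_⟩
  rw [energy_eq hΩ hg' hg2']
  simp only [hgg]
  refine add_le_add (Finset.sum_le_sum fun i _ => ?_)
    (phaseVolume_le_of_tendsto (fun k => hw (φ k)) hlim (hm.comp hφ'))
  gcongr
  exact enorm_le_of_toReal_le (hg2 i) (hgA i)

end Energy

/-! ### Existence of minimizers -/

section Existence

variable {n : ℕ} {Ω : Set (EuclideanSpace ℝ (Fin n))} {V W : EuclideanSpace ℝ (Fin n) → ℝ}

theorem phaseVolume_le_volume (v : EuclideanSpace ℝ (Fin n) → ℝ) :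
    phaseVolume Ω v ≤ volume Ω := by
  refine (lintegral_mono fun x => ?_).trans (setLIntegral_one Ω).le
  exact Set.indicator_le_self' (f := 1) (fun _ _ => zero_le_one) x

theorem energy_lt_top (hΩ : IsOpen Ω) (hfin : volume Ω ≠ ⊤) {v : EuclideanSpace ℝ (Fin n) → ℝ}
    (hv : MemH1 Ω v) : energy Ω v < ⊤ := by
  obtain ⟨-, g, hg, hg2⟩ := hv
  rw [energy_eq hΩ hg hg2]
  refine ENNReal.add_lt_top.2 ⟨ENNReal.sum_lt_top.2 fun i _ => ?_,
    (phaseVolume_le_volume v).trans_lt hfin.lt_top⟩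
  exact ENNReal.pow_lt_top (hg2.apply_euclidean i).eLpNorm_lt_top

theorem abs_le_abs_add_abs_of_mem_constraintSet {v : EuclideanSpace ℝ (Fin n) → ℝ}
    (h : ∀ᵐ x ∂volume.restrict Ω, V x ≤ v x ∧ v x ≤ W x) :
    ∀ᵐ x ∂volume.restrict Ω, |v x| ≤ |(|V x| + |W x|)| := by
  filter_upwards [h] with x hx
  rw [abs_of_nonneg (by positivity : 0 ≤ |V x| + |W x|)]
  exact (abs_le_max_abs_abs hx.1 hx.2).trans (max_le_add_of_nonneg (abs_nonneg _) (abs_nonneg _))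

theorem mem_constraintSet_of_tendsto {w : ℕ → EuclideanSpace ℝ (Fin n) → ℝ}
    {u : EuclideanSpace ℝ (Fin n) → ℝ} (hu : MemH1 Ω u)
    (hw : ∀ k, ∀ᵐ x ∂volume.restrict Ω, V x ≤ w k x ∧ w k x ≤ W x)
    (hlim : ∀ᵐ x ∂volume.restrict Ω, Tendsto (fun k => w k x) atTop (𝓝 (u x))) :
    u ∈ constraintSet Ω V W := by
  refine ⟨hu, ?_⟩
  filter_upwards [hlim, ae_all_iff.2 hw] with x hx hxw
  exact ⟨ge_of_tendsto' hx fun k => (hxw k).1, le_of_tendsto' hx fun k => (hxw k).2⟩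

/-- The direct method. Convexity makes the weak derivatives of a minimizing sequence control its
translations, and the two-sided constraint supplies the domination. -/
theorem exists_energy_eq_iInf (hΩ : IsOpen Ω) (hc : Convex ℝ Ω) (hfin : volume Ω ≠ ⊤)
    (hV : MemLp V 2 (volume.restrict Ω)) (hW : MemLp W 2 (volume.restrict Ω))
    (hS : (constraintSet Ω V W).Nonempty) :
    ∃ u ∈ constraintSet Ω V W, energy Ω u = ⨅ v ∈ constraintSet Ω V W, energy Ω v := by
  rw [← sInf_image]
  obtain ⟨s, hs, hslim, hsmem⟩ := exists_seq_tendsto_sInf (hS.image (energy Ω))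
    (OrderBot.bddBelow _)
  choose w hwS hws using hsmem
  choose g hg hg2 using fun k => (hwS k).1.2
  have hgi := fun k i => (hg2 k).apply_euclidean i
  let a : ℕ → Fin n → ℝ := fun k i => (eLpNorm (fun x => g k x i) 2 (volume.restrict Ω)).toReal
  let p : ℕ → ℝ := fun k => (phaseVolume Ω (w k)).toReal
  have hofa : ∀ k i, ENNReal.ofReal (a k i) = eLpNorm (fun x => g k x i) 2 (volume.restrict Ω) :=
    fun k i => ENNReal.ofReal_toReal (hgi k i).eLpNorm_ne_top
  have hofp : ∀ k, ENNReal.ofReal (p k) = phaseVolume Ω (w k) := fun k =>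
    ENNReal.ofReal_toReal ((phaseVolume_le_volume _).trans_lt hfin.lt_top).ne
  have hen : ∀ k, s k = ∑ i, ENNReal.ofReal (a k i) ^ 2 + ENNReal.ofReal (p k) := fun k => by
    rw [← hws k, energy_eq hΩ (hg k) (hg2 k), hofp]
    simp only [hofa]
  have hs0 : s 0 ≠ ⊤ := by
    rw [← hws 0]; exact (energy_lt_top hΩ hfin (hwS 0).1).ne
  -- The minimizing sequence has decreasing energies, so `s 0` bounds them all; the `+ 1` absorbs
  -- the passage from `a ^ 2` to `a`.
  obtain ⟨B, hB0, haB, hpB⟩ : ∃ B : ℝ, 0 ≤ B ∧ (∀ k i, a k i ≤ B) ∧ ∀ k, p k ≤ B := by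
    refine ⟨(s 0).toReal + 1, by positivity, fun k i => ?_, fun k => ?_⟩
    · have h1 : ENNReal.ofReal (a k i) ^ 2 ≤ s 0 := by
        refine le_trans ?_ (hs (zero_le (a := k)))
        rw [hen k]
        exact (Finset.single_le_sum (f := fun i => ENNReal.ofReal (a k i) ^ 2)
          (fun _ _ => zero_le) (Finset.mem_univ i)).trans le_self_add
      rw [← ENNReal.ofReal_pow ENNReal.toReal_nonneg] at h1
      have h2 := (ENNReal.ofReal_le_iff_le_toReal hs0).1 h1
      nlinarith [sq_nonneg (a k i - 1)]
    · have h1 : ENNReal.ofReal (p k) ≤ s 0 := by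
        refine le_trans ?_ (hs (zero_le (a := k)))
        rw [hen k]
        exact le_add_self
      have h2 := (ENNReal.ofReal_le_iff_le_toReal hs0).1 h1
      linarith
  -- Lower semicontinuity is used term by term, so every derivative norm and the phase volume must
  -- converge on its own; compactness of a box provides this.
  obtain ⟨⟨A, m⟩, -, φ, hφ, hlim⟩ := (isCompact_Icc (a := ((0 : Fin n → ℝ), (0 : ℝ)))
    (b := ((fun _ => B : Fin n → ℝ), B))).tendsto_subseq (x := fun k => (a k, p k)) fun k =>
      ⟨⟨fun i => ENNReal.toReal_nonneg, ENNReal.toReal_nonneg⟩, ⟨haB k, hpB k⟩⟩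
  have hlima : ∀ i, Tendsto (fun k => a (φ k) i) atTop (𝓝 (A i)) := fun i =>
    (tendsto_pi_nhds.1 ((Prod.tendsto_iff _ _).1 hlim).1) i
  have hlimp : Tendsto (fun k => p (φ k)) atTop (𝓝 m) := ((Prod.tendsto_iff _ _).1 hlim).2
  have hI : ∑ i, ENNReal.ofReal (A i) ^ 2 + ENNReal.ofReal m
      = sInf (energy Ω '' constraintSet Ω V W) := by
    refine tendsto_nhds_unique ?_ (hslim.comp hφ.tendsto_atTop)
    simp only [Function.comp_def, hen]
    refine Tendsto.add (tendsto_finsetSum _ fun i _ => ?_) (ENNReal.tendsto_ofReal hlimp)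
    exact ENNReal.Tendsto.pow (ENNReal.tendsto_ofReal (hlima i))
  have hshift : ∀ k i τ, eLpNorm
      (fun x => w k (x + τ • EuclideanSpace.single i 1) - w k x) 2
      (volume.restrict (shiftDomain Ω (τ • EuclideanSpace.single i 1)))
        ≤ ENNReal.ofReal (|τ| * a k i) := fun k i τ =>
    eLpNorm_shift_sub_le hΩ hc hfin (hwS k).1.1 (hgi k i) ((hg k).isWeakDerivAlong i) τ
  have hG : MemLp (fun x => |V x| + |W x|) 2 (volume.restrict Ω) := hV.abs.add hW.abs
  obtain ⟨θ, hθ, u, hu, hulim, hule⟩ := exists_subseq_tendsto_memH1_energy_le hΩ hfin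
    (w := fun k => w (φ k)) (fun k => (hwS (φ k)).1.1.aestronglyMeasurable) hG
    (fun k => abs_le_abs_add_abs_of_mem_constraintSet (hwS (φ k)).2)
    (fun i η hη => by
      refine ⟨η / (B + 1), by positivity, Eventually.of_forall fun k τ h0 h1 => ?_⟩
      refine (hshift (φ k) i τ).trans (ENNReal.ofReal_le_ofReal ?_)
      rw [abs_of_nonneg h0]
      calc τ * a (φ k) i ≤ η / (B + 1) * (B + 1) :=
            mul_le_mul h1 ((haB _ _).trans (by linarith)) ENNReal.toReal_nonneg (by positivity)
        _ = η := by field_simp)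
    (A := A) (fun i => ⟨fun k => 1 / ((k : ℝ) + 1), fun k => a (φ k) i, fun k => by positivity,
      tendsto_one_div_add_atTop_nhds_zero_nat, fun k => ENNReal.toReal_nonneg, hlima i, fun k => by
        have := hshift (φ k) i (1 / ((k : ℝ) + 1))
        rwa [abs_of_pos (by positivity)] at this⟩)
    (m := ENNReal.ofReal m) (by
      have := ENNReal.tendsto_ofReal hlimp
      simpa only [hofp] using this)
  have huS : u ∈ constraintSet Ω V W :=
    mem_constraintSet_of_tendsto hu (fun k => (hwS (φ (θ k))).2) hulim
  refine ⟨u, huS, le_antisymm (hule.trans hI.le) (sInf_le ⟨u, huS, rfl⟩)⟩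

end Existence

/-! ### Sorting a function along a finite lattice -/

section Lattice

variable {E : Type*} [AddCommGroup E]

/-- The translates of `B` by multiples of `t` are pairwise disjoint. -/
def IsLatticeCell (B : Set E) (t : E) : Prop :=
  ∀ b ∈ B, ∀ j k : ℕ, b + j • t - k • t ∈ B → j = k

/-- The union of the first `M` translates of `D` by multiples of `t`. -/
def stack (D : Set E) (t : E) (M : ℕ) : Set E := ⋃ j : Fin M, {x | x - (j : ℕ) • t ∈ D}

theorem mem_stack {D : Set E} {t : E} {M : ℕ} {x : E} :
    x ∈ stack D t M ↔ ∃ b ∈ D, ∃ j : Fin M, x = b + (j : ℕ) • t := by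
  rw [stack, Set.mem_iUnion]
  constructor
  · rintro ⟨j, hj⟩
    exact ⟨_, hj, j, by abel⟩
  · rintro ⟨b, hb, j, rfl⟩
    exact ⟨j, by simpa using hb⟩

theorem add_nsmul_mem_stack {D : Set E} {t : E} {M : ℕ} {b : E} (hb : b ∈ D) (j : Fin M) :
    b + (j : ℕ) • t ∈ stack D t M := mem_stack.2 ⟨b, hb, j, rfl⟩

open Classical in
/-- The function obtained from `u` by sorting, for every `b ∈ B`, the values of `u` at the points
`b + j t`, `j < N`. -/
noncomputable def latticeSort (B : Set E) (t : E) (N : ℕ) (u : E → ℝ) : E → ℝ := fun x =>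
  ∑ j : Fin N, {x | x - (j : ℕ) • t ∈ B}.indicator
    (fun x => sortedTuple (fun i : Fin N => u (x - (j : ℕ) • t + (i : ℕ) • t)) j) x

/-- The translates of the cell are disjoint, so a single summand survives. -/
theorem latticeSort_apply {B : Set E} {t : E} (hB : IsLatticeCell B t) {N : ℕ} (u : E → ℝ) {b : E}
    (hb : b ∈ B) (j : Fin N) :
    latticeSort B t N u (b + (j : ℕ) • t)
      = sortedTuple (fun i : Fin N => u (b + (i : ℕ) • t)) j := by
  rw [latticeSort, Finset.sum_eq_single j]
  · rw [Set.indicator_of_mem (by simpa using hb)]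
    simp
  · intro k _ hk
    refine Set.indicator_of_notMem (fun h => hk ?_) _
    exact Fin.ext (hB b hb _ _ h).symm
  · simp

theorem latticeSort_le_latticeSort_add {B : Set E} {t : E} (hB : IsLatticeCell B t) {N : ℕ}
    (u : E → ℝ) {x : E} {k : ℕ} (hx : x ∈ stack B t N) (hxk : x + k • t ∈ stack B t N) :
    latticeSort B t N u x ≤ latticeSort B t N u (x + k • t) := by
  obtain ⟨b, hb, j, rfl⟩ := mem_stack.1 hx
  obtain ⟨b', hb', j', h⟩ := mem_stack.1 hxk
  have h1 : (j : ℕ) + k = j' := by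
    refine hB b hb _ _ ?_
    rw [add_nsmul, ← add_assoc, h]
    simpa using hb'
  rw [add_assoc, ← add_nsmul, h1, latticeSort_apply hB u hb, latticeSort_apply hB u hb]
  exact monotone_sortedTuple _ (Fin.le_def.2 (by omega))

end Lattice

/-! ### Integral estimates for lattice sorting -/

section LatticeMeasure

variable {E : Type*} [AddCommGroup E] [MeasurableSpace E] [MeasurableAdd₂ E] [MeasurableNeg E]
  {μ : Measure E} [μ.IsAddLeftInvariant]

theorem measurableSet_sub_mem {D : Set E} (hD : MeasurableSet D) (a : E) :
    MeasurableSet {x | x - a ∈ D} := (measurable_id.sub_const a) hD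

theorem measurable_latticeSort {B : Set E} (hB : MeasurableSet B) (t : E) (N : ℕ) {u : E → ℝ}
    (hu : Measurable u) : Measurable (latticeSort B t N u) := by
  refine Finset.measurable_fun_sum _ fun j _ => Measurable.indicator ?_ ?_
  · have h1 : Measurable fun v : Fin N → ℝ => sortedTuple v j :=
      ((continuous_apply j).comp continuous_sortedTuple).measurable
    have h2 : Measurable fun x : E => fun i : Fin N => u (x - (j : ℕ) • t + (i : ℕ) • t) :=
      measurable_pi_lambda _ fun i => hu.comp ((measurable_id.sub_const _).add_const _)
    exact h1.comp h2
  · exact measurableSet_sub_mem hB _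

theorem measurableSet_stack {D : Set E} (hD : MeasurableSet D) (t : E) (M : ℕ) :
    MeasurableSet (stack D t M) :=
  MeasurableSet.iUnion fun _ => measurableSet_sub_mem hD _

/-- Fubini for the lattice: after it, integral inequalities on the stack follow from inequalities
for the finite tuple above each base point. -/
theorem setLIntegral_stack {B D : Set E} {t : E} (hB : IsLatticeCell B t) (hDB : D ⊆ B)
    (hD : MeasurableSet D) (M : ℕ) (F : E → ℝ≥0∞) :
    ∫⁻ x in stack D t M, F x ∂μ = ∑ j : Fin M, ∫⁻ b in D, F (b + (j : ℕ) • t) ∂μ := by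
  rw [stack, lintegral_iUnion (fun _ => measurableSet_sub_mem hD _),
    tsum_fintype]
  · refine Finset.sum_congr rfl fun j _ => ?_
    have hmp : MeasurePreserving (fun x : E => x + (j : ℕ) • t) μ μ :=
      measurePreserving_add_right μ _
    rw [← hmp.setLIntegral_comp_preimage_emb (measurableEmbedding_addRight _)]
    congr 2
    ext x
    simp
  · intro j k hjk
    refine Set.disjoint_left.2 fun x hxj hxk => hjk ?_
    refine Fin.ext (hB _ (hDB hxj) j k (hDB ?_))
    simpa using hxk

theorem ae_restrict_stack_iff {D : Set E} {t : E} (hD : MeasurableSet D) {M : ℕ} {P : E → Prop} :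
    (∀ᵐ x ∂μ.restrict (stack D t M), P x)
      ↔ ∀ᵐ b ∂μ.restrict D, ∀ j : Fin M, P (b + (j : ℕ) • t) := by
  rw [ae_restrict_iff' (measurableSet_stack hD t M), ae_restrict_iff' hD]
  constructor
  · intro h
    have h1 : ∀ j : Fin M, ∀ᵐ b ∂μ, b + (j : ℕ) • t ∈ stack D t M → P (b + (j : ℕ) • t) := fun j =>
      (measurePreserving_add_right μ ((j : ℕ) • t)).quasiMeasurePreserving.ae h
    filter_upwards [ae_all_iff.2 h1] with b hb hbD j
    exact hb j (add_nsmul_mem_stack hbD j)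
  · intro h
    have h1 : ∀ j : Fin M, ∀ᵐ x ∂μ, x - (j : ℕ) • t ∈ D →
        ∀ i : Fin M, P (x - (j : ℕ) • t + (i : ℕ) • t) := fun j =>
      (measurePreserving_sub_right μ ((j : ℕ) • t)).quasiMeasurePreserving.ae h
    filter_upwards [ae_all_iff.2 h1] with x hx hxs
    obtain ⟨b, hb, j, rfl⟩ := mem_stack.1 hxs
    simpa using hx j (by simpa using hb) j

theorem sum_enorm_sq_eq {M : ℕ} (a : Fin M → ℝ) :
    ∑ j, ‖a j‖ₑ ^ 2 = ENNReal.ofReal (∑ j, a j ^ 2) := by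
  rw [ENNReal.ofReal_sum_of_nonneg fun i _ => sq_nonneg _]
  refine Finset.sum_congr rfl fun j _ => ?_
  rw [← ofReal_norm, ← ENNReal.ofReal_pow (norm_nonneg _), Real.norm_eq_abs, sq_abs]

theorem eLpNorm_two_le_iff {α : Type*} [MeasurableSpace α] {ν : Measure α} {f g : α → ℝ} :
    eLpNorm f 2 ν ≤ eLpNorm g 2 ν ↔ ∫⁻ x, ‖f x‖ₑ ^ 2 ∂ν ≤ ∫⁻ x, ‖g x‖ₑ ^ 2 ∂ν := by
  rw [← eLpNorm_two_sq_eq, ← eLpNorm_two_sq_eq, ENNReal.pow_le_pow_left_iff two_ne_zero]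

/-- Sorting along a lattice is a contraction with respect to translations within the cell. -/
theorem eLpNorm_latticeSort_translate_le {B D : Set E} {t : E} (hB : IsLatticeCell B t)
    (hDB : D ⊆ B) (hD : MeasurableSet D) (hBm : MeasurableSet B) (N : ℕ) {u : E → ℝ}
    (hu : Measurable u) {y : E} (hy : ∀ b ∈ D, b + y ∈ B) :
    eLpNorm (fun x => latticeSort B t N u (x + y) - latticeSort B t N u x) 2
        (μ.restrict (stack D t N))
      ≤ eLpNorm (fun x => u (x + y) - u x) 2 (μ.restrict (stack D t N)) := by
  have hw := measurable_latticeSort hBm t N hu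
  have hm : ∀ {f : E → ℝ}, Measurable f → ∀ j : Fin N,
      Measurable fun b => ‖f (b + (j : ℕ) • t + y) - f (b + (j : ℕ) • t)‖ₑ ^ 2 := fun hf j =>
    (((hf.comp ((measurable_add_const _).add_const y)).sub
      (hf.comp (measurable_add_const _))).enorm.pow_const 2)
  rw [eLpNorm_two_le_iff, setLIntegral_stack hB hDB hD, setLIntegral_stack hB hDB hD,
    ← lintegral_finsetSum _ fun j _ => hm hw j, ← lintegral_finsetSum _ fun j _ => hm hu j]
  -- Both `b` and `b + y` lie in the cell, so the tuples above them are sorted at matching levels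
  -- and the contraction inequality applies.
  refine setLIntegral_mono' hD fun b hb => ?_
  have h1 : ∀ j : Fin N, b + (j : ℕ) • t + y = b + y + (j : ℕ) • t := fun j => by abel
  simp only [h1]
  rw [sum_enorm_sq_eq fun j : Fin N => latticeSort B t N u (b + y + (j : ℕ) • t)
      - latticeSort B t N u (b + (j : ℕ) • t),
    sum_enorm_sq_eq fun j : Fin N => u (b + y + (j : ℕ) • t) - u (b + (j : ℕ) • t)]
  refine ENNReal.ofReal_le_ofReal ?_
  simp only [latticeSort_apply hB u (hDB hb), latticeSort_apply hB u (hy b hb)]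
  exact sum_sq_sub_sortedTuple_le _ _

/-- Sorting along a lattice does not increase the differences along the lattice. -/
theorem eLpNorm_latticeSort_step_le {B : Set E} {t : E} (hB : IsLatticeCell B t)
    (hBm : MeasurableSet B) (m : ℕ) {u : E → ℝ} (hu : Measurable u) :
    eLpNorm (fun x => latticeSort B t (m + 1) u (x + t) - latticeSort B t (m + 1) u x) 2
        (μ.restrict (stack B t m))
      ≤ eLpNorm (fun x => u (x + t) - u x) 2 (μ.restrict (stack B t m)) := by
  have hw := measurable_latticeSort hBm t (m + 1) hu
  have hm : ∀ {f : E → ℝ}, Measurable f → ∀ j : Fin m,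
      Measurable fun b => ‖f (b + (j : ℕ) • t + t) - f (b + (j : ℕ) • t)‖ₑ ^ 2 := fun hf j =>
    (((hf.comp ((measurable_add_const _).add_const t)).sub
      (hf.comp (measurable_add_const _))).enorm.pow_const 2)
  rw [eLpNorm_two_le_iff, setLIntegral_stack hB subset_rfl hBm,
    setLIntegral_stack hB subset_rfl hBm,
    ← lintegral_finsetSum _ fun j _ => hm hw j, ← lintegral_finsetSum _ fun j _ => hm hu j]
  -- There are `m + 1` levels but `m` differences: the integral runs over the lowest `m` cells only.
  refine setLIntegral_mono' hBm fun b hb => ?_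
  have h1 : ∀ j : Fin m, b + (j : ℕ) • t + t = b + (j.succ : ℕ) • t := fun j => by
    rw [Fin.val_succ, add_assoc, succ_nsmul]
  have h2 : ∀ j : Fin m, b + (j : ℕ) • t = b + (j.castSucc : ℕ) • t := fun j => rfl
  simp only [h1]
  rw [sum_enorm_sq_eq fun j : Fin m => latticeSort B t (m + 1) u (b + (j.succ : ℕ) • t)
      - latticeSort B t (m + 1) u (b + (j : ℕ) • t),
    sum_enorm_sq_eq fun j : Fin m => u (b + (j.succ : ℕ) • t) - u (b + (j : ℕ) • t)]
  refine ENNReal.ofReal_le_ofReal ?_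
  simp only [h2, latticeSort_apply hB u hb]
  exact sum_sq_sortedTuple_succ_sub_le fun i : Fin (m + 1) => u (b + (i : ℕ) • t)

theorem setLIntegral_comp_latticeSort {B : Set E} {t : E} (hB : IsLatticeCell B t)
    (hBm : MeasurableSet B) (N : ℕ) {u : E → ℝ} (hu : Measurable u) {f : ℝ → ℝ≥0∞}
    (hf : Measurable f) :
    ∫⁻ x in stack B t N, f (latticeSort B t N u x) ∂μ = ∫⁻ x in stack B t N, f (u x) ∂μ := by
  have hw := measurable_latticeSort hBm t N hu
  have hm : ∀ {g : E → ℝ}, Measurable g → ∀ j : Fin N,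
      Measurable fun b => f (g (b + (j : ℕ) • t)) := fun hg j =>
    hf.comp (hg.comp (measurable_add_const _))
  rw [setLIntegral_stack hB subset_rfl hBm, setLIntegral_stack hB subset_rfl hBm,
    ← lintegral_finsetSum _ fun j _ => hm hw j, ← lintegral_finsetSum _ fun j _ => hm hu j]
  refine setLIntegral_congr_fun hBm fun b hb => ?_
  simp only [latticeSort_apply hB u hb]
  exact sum_sortedTuple (fun i : Fin N => u (b + (i : ℕ) • t)) f

theorem ae_latticeSort_mem_Icc {B : Set E} {t : E} (hB : IsLatticeCell B t)
    (hBm : MeasurableSet B) {N : ℕ} {u V W : E → ℝ}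
    (hV : ∀ᵐ b ∂μ.restrict B, Monotone fun j : Fin N => V (b + (j : ℕ) • t))
    (hW : ∀ᵐ b ∂μ.restrict B, Monotone fun j : Fin N => W (b + (j : ℕ) • t))
    (h : ∀ᵐ x ∂μ.restrict (stack B t N), V x ≤ u x ∧ u x ≤ W x) :
    ∀ᵐ x ∂μ.restrict (stack B t N), V x ≤ latticeSort B t N u x ∧ latticeSort B t N u x ≤ W x := by
  rw [ae_restrict_stack_iff hBm] at h ⊢
  filter_upwards [h, hV, hW, ae_restrict_mem hBm] with b hb hbV hbW hbB j
  rw [latticeSort_apply hB u hbB]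
  exact ⟨le_sortedTuple hbV (fun i => (hb i).1) j, sortedTuple_le hbW (fun i => (hb i).2) j⟩

end LatticeMeasure

/-! ### Sorting along the axis of the cylinder -/

section Subadditive

variable {E : Type*} [NormedAddCommGroup E] [InnerProductSpace ℝ E] [FiniteDimensional ℝ E]
  [MeasurableSpace E] [BorelSpace E]

theorem eLpNorm_two_restrict_union_le {α : Type*} [MeasurableSpace α] {μ : Measure α} (f : α → ℝ)
    (s s' : Set α) :
    eLpNorm f 2 (μ.restrict (s ∪ s'))
      ≤ eLpNorm f 2 (μ.restrict s) + eLpNorm f 2 (μ.restrict s') := by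
  rw [← ENNReal.pow_le_pow_left_iff two_ne_zero, eLpNorm_two_sq_eq]
  refine (lintegral_union_le _ _ _).trans ?_
  rw [← eLpNorm_two_sq_eq, ← eLpNorm_two_sq_eq, add_sq]
  gcongr
  exact le_self_add

theorem eLpNorm_comp_add_right_restrict_le {F : E → ℝ} (hF : Measurable F) {s S : Set E}
    (hS : MeasurableSet S) {a : E} (h : ∀ x ∈ s, x + a ∈ S) :
    eLpNorm (fun x => F (x + a)) 2 (volume.restrict s) ≤ eLpNorm F 2 (volume.restrict S) := by
  have hmp := (measurePreserving_add_right (volume : Measure E) a).restrict_preimage hS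
  rw [← eLpNorm_comp_measurePreserving hF.aestronglyMeasurable hmp]
  exact eLpNorm_mono_measure _ (Measure.restrict_mono h le_rfl)

/-- The intermediate point `x + α • e` stays in `Ω` by convexity, so a long shift can be made in two
stages. -/
theorem eLpNorm_shift_add_le {Ω : Set E} (hΩ : IsOpen Ω) (hc : Convex ℝ Ω) {w : E → ℝ}
    (hw : Measurable w) (e : E) {α β : ℝ} (hα : 0 ≤ α) (hβ : 0 ≤ β) :
    eLpNorm (fun x => w (x + (α + β) • e) - w x) 2
        (volume.restrict (shiftDomain Ω ((α + β) • e)))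
      ≤ eLpNorm (fun x => w (x + α • e) - w x) 2 (volume.restrict (shiftDomain Ω (α • e)))
        + eLpNorm (fun x => w (x + β • e) - w x) 2 (volume.restrict (shiftDomain Ω (β • e))) := by
  have hm : ∀ a : E, Measurable fun x => w (x + a) - w x := fun a =>
    (hw.comp (measurable_add_const a)).sub hw
  have h1 : (fun x => w (x + (α + β) • e) - w x)
      = (fun x => w (x + α • e) - w x) + fun x => w (x + α • e + β • e) - w (x + α • e) := by
    ext x
    simp only [Pi.add_apply]
    rw [add_smul, ← add_assoc]
    ring
  have hαmem : ∀ x ∈ shiftDomain Ω ((α + β) • e), x + α • e ∈ Ω := fun x hx =>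
    hc.add_smul_mem_of_mem_shiftDomain hx (Set.mem_uIcc.2 (Or.inl ⟨hα, by linarith⟩))
  rw [h1]
  refine (eLpNorm_add_le (hm _).aestronglyMeasurable
    ((hm _).comp (measurable_add_const _)).aestronglyMeasurable (by norm_num)).trans ?_
  refine add_le_add (eLpNorm_mono_measure _ (Measure.restrict_mono ?_ le_rfl)) ?_
  · exact fun x hx => ⟨hx.1, hαmem x hx⟩
  · refine eLpNorm_comp_add_right_restrict_le (hm (β • e)) (hΩ.shiftDomain _).measurableSet
      fun x hx => ⟨hαmem x hx, ?_⟩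
    have : x + (α + β) • e ∈ Ω := hx.2
    rwa [add_smul, ← add_assoc] at this

end Subadditive

section Cylinder

variable {d : ℕ}

/-- The first `d` coordinates of a point of `ℝᵈ⁺¹`. -/
noncomputable def horizontalPart (d : ℕ) :
    EuclideanSpace ℝ (Fin (d + 1)) →ₗ[ℝ] EuclideanSpace ℝ (Fin d) where
  toFun x := WithLp.toLp 2 fun i : Fin d => x i.castSucc
  map_add' _ _ := rfl
  map_smul' _ _ := rfl

theorem continuous_horizontalPart (d : ℕ) : Continuous (horizontalPart d) :=
  LinearMap.continuous_of_finiteDimensional _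

theorem continuous_last (d : ℕ) :
    Continuous fun x : EuclideanSpace ℝ (Fin (d + 1)) => x (Fin.last d) := by fun_prop

theorem mem_rightCylinder {R h : ℝ} {x : EuclideanSpace ℝ (Fin (d + 1))} :
    x ∈ rightCylinder d R h
      ↔ ‖horizontalPart d x‖ < R ∧ -h < x (Fin.last d) ∧ x (Fin.last d) < h := by
  rw [← abs_lt]; rfl

theorem isOpen_rightCylinder (d : ℕ) (R h : ℝ) : IsOpen (rightCylinder d R h) :=
  (isOpen_lt (continuous_horizontalPart d).norm continuous_const).inter
    (isOpen_lt (continuous_last d).abs continuous_const)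

theorem convex_rightCylinder (d : ℕ) (R h : ℝ) : Convex ℝ (rightCylinder d R h) := by
  intro x hx y hy a b ha hb hab
  have h1 := (convex_ball (0 : EuclideanSpace ℝ (Fin d)) R)
    (mem_ball_zero_iff.2 hx.1) (mem_ball_zero_iff.2 hy.1) ha hb hab
  have h2 := (convex_ball (0 : ℝ) h)
    (mem_ball_zero_iff.2 hx.2) (mem_ball_zero_iff.2 hy.2) ha hb hab
  exact ⟨mem_ball_zero_iff.1 h1, mem_ball_zero_iff.1 h2⟩

theorem volume_rightCylinder_ne_top (d : ℕ) (R h : ℝ) : volume (rightCylinder d R h) ≠ ⊤ := by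
  refine ((measure_mono ?_).trans_lt
    (measure_closedBall_lt_top (x := (0 : EuclideanSpace ℝ (Fin (d + 1)))) (r := R + h))).ne
  intro x hx
  have h1 : ‖horizontalPart d x‖ < R := hx.1
  have h2 : |x (Fin.last d)| < h := hx.2
  have h3 : ‖x‖ ^ 2 = ‖horizontalPart d x‖ ^ 2 + |x (Fin.last d)| ^ 2 := by
    rw [EuclideanSpace.norm_sq_eq, EuclideanSpace.norm_sq_eq, Fin.sum_univ_castSucc]
    rfl
  rw [mem_closedBall_zero_iff]
  have h4 := norm_nonneg (horizontalPart d x)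
  have h5 := abs_nonneg (x (Fin.last d))
  refine abs_le_of_sq_le_sq' ?_ (by linarith) |>.2
  nlinarith

theorem horizontalPart_smul_single_last (a : ℝ) :
    horizontalPart d (a • EuclideanSpace.single (Fin.last d) 1) = 0 := by
  ext i
  change (a • EuclideanSpace.single (Fin.last d) (1 : ℝ)) i.castSucc = 0
  simp [(Fin.castSucc_lt_last i).ne]

/-- The cylinder of height `δ` over the disc of radius `R` whose bottom is at height `a`; it
contains its bottom but not its top. -/
def cylinderCell (d : ℕ) (R a δ : ℝ) : Set (EuclideanSpace ℝ (Fin (d + 1))) :=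
  {x | ‖horizontalPart d x‖ < R ∧ a ≤ x (Fin.last d) ∧ x (Fin.last d) < a + δ}

theorem measurableSet_cylinderCell (d : ℕ) (R a δ : ℝ) : MeasurableSet (cylinderCell d R a δ) :=
  (measurableSet_lt (continuous_horizontalPart d).norm.measurable measurable_const).inter
    ((measurableSet_le measurable_const (continuous_last d).measurable).inter
      (measurableSet_lt (continuous_last d).measurable measurable_const))

theorem horizontalPart_add_nsmul (x : EuclideanSpace ℝ (Fin (d + 1))) (δ : ℝ) (j : ℕ) :
    horizontalPart d (x + j • δ • EuclideanSpace.single (Fin.last d) 1) = horizontalPart d x := by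
  rw [map_add, map_nsmul, horizontalPart_smul_single_last, nsmul_zero, add_zero]

theorem last_add_nsmul (x : EuclideanSpace ℝ (Fin (d + 1))) (δ : ℝ) (j : ℕ) :
    (x + j • δ • EuclideanSpace.single (Fin.last d) (1 : ℝ)) (Fin.last d)
      = x (Fin.last d) + j * δ := by
  simp

theorem isLatticeCell_cylinderCell (R a : ℝ) {δ : ℝ} (hδ : 0 < δ) :
    IsLatticeCell (cylinderCell d R a δ) (δ • EuclideanSpace.single (Fin.last d) 1) := by
  intro b hb j k hjk
  obtain ⟨-, h1, h2⟩ := hb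
  obtain ⟨-, h3, h4⟩ := hjk
  have e : (b + j • δ • EuclideanSpace.single (Fin.last d) (1 : ℝ)
      - k • δ • EuclideanSpace.single (Fin.last d) (1 : ℝ)) (Fin.last d)
        = b (Fin.last d) + j * δ - k * δ := by simp
  rw [e] at h3 h4
  by_contra hne
  rcases lt_or_gt_of_ne hne with hlt | hlt
  · have h5 : (j : ℝ) + 1 ≤ k := by exact_mod_cast hlt
    nlinarith
  · have h5 : (k : ℝ) + 1 ≤ j := by exact_mod_cast hlt
    nlinarith

theorem mem_stack_cylinderCell {R a δ : ℝ} (hδ : 0 < δ) {M : ℕ}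
    {x : EuclideanSpace ℝ (Fin (d + 1))} :
    x ∈ stack (cylinderCell d R a δ) (δ • EuclideanSpace.single (Fin.last d) 1) M
      ↔ x ∈ cylinderCell d R a (M * δ) := by
  rw [mem_stack]
  constructor
  · rintro ⟨b, ⟨h1, h2, h3⟩, j, rfl⟩
    have hj : (j : ℝ) + 1 ≤ M := by exact_mod_cast j.2
    refine ⟨by rwa [horizontalPart_add_nsmul], ?_, ?_⟩ <;> rw [last_add_nsmul]
    · have : 0 ≤ (j : ℝ) * δ := by positivity
      linarith
    · nlinarith
  · rintro ⟨h1, h2, h3⟩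
    have hq : 0 ≤ (x (Fin.last d) - a) / δ := div_nonneg (by linarith) hδ.le
    have hl := Nat.floor_le hq
    have hu := Nat.lt_floor_add_one ((x (Fin.last d) - a) / δ)
    rw [le_div_iff₀ hδ] at hl
    rw [div_lt_iff₀ hδ] at hu
    set j := ⌊(x (Fin.last d) - a) / δ⌋₊
    have hjM : j < M := by
      have : (j : ℝ) * δ < M * δ := by linarith
      exact_mod_cast lt_of_mul_lt_mul_right this hδ.le
    have hx : x = (x + (-(j : ℝ) * δ) • EuclideanSpace.single (Fin.last d) 1)
        + j • δ • EuclideanSpace.single (Fin.last d) (1 : ℝ) := by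
      rw [← Nat.cast_smul_eq_nsmul ℝ j, smul_smul, add_assoc, ← add_smul]
      simp
    refine ⟨_, ⟨?_, ?_, ?_⟩, ⟨j, hjM⟩, hx⟩
    · rwa [map_add, horizontalPart_smul_single_last, add_zero]
    · simp; linarith
    · simp; linarith

theorem ae_last_ne (c : ℝ) : ∀ᵐ x : EuclideanSpace ℝ (Fin (d + 1)), x (Fin.last d) ≠ c := by
  have h1 : (volume : Measure (Fin (d + 1) → ℝ)) {f | f (Fin.last d) = c} = 0 :=
    Measure.pi_hyperplane _ _ _
  have h2 : ∀ᵐ f : Fin (d + 1) → ℝ, f (Fin.last d) ≠ c := by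
    rw [ae_iff]; simpa using h1
  exact (PiLp.volume_preserving_ofLp (Fin (d + 1))).quasiMeasurePreserving.ae h2

theorem rightCylinder_subset_cylinderCell (R h : ℝ) :
    rightCylinder d R h ⊆ cylinderCell d R (-h) (2 * h) := fun x hx => by
  obtain ⟨h1, h2, h3⟩ := mem_rightCylinder.1 hx
  exact ⟨h1, h2.le, by linarith⟩

theorem mem_rightCylinder_of_mem_cylinderCell {R h : ℝ} {x : EuclideanSpace ℝ (Fin (d + 1))}
    (hx : x ∈ cylinderCell d R (-h) (2 * h)) (hne : x (Fin.last d) ≠ -h) :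
    x ∈ rightCylinder d R h := by
  obtain ⟨h1, h2, h3⟩ := hx
  exact mem_rightCylinder.2 ⟨h1, lt_of_le_of_ne h2 hne.symm, by linarith⟩

/-- The half-open cells tile the cylinder together with its bottom face, which is null; the shift by
`y` produces a second null hyperplane. -/
theorem ae_le_shiftDomain_rightCylinder {R h : ℝ} {s : Set (EuclideanSpace ℝ (Fin (d + 1)))}
    {y : EuclideanSpace ℝ (Fin (d + 1))} (hs : s ⊆ shiftDomain (cylinderCell d R (-h) (2 * h)) y) :
    s ≤ᵐ[volume] shiftDomain (rightCylinder d R h) y := by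
  filter_upwards [ae_last_ne (d := d) (-h), ae_last_ne (d := d) (-h - y (Fin.last d))]
    with x h1 h2 hx
  refine ⟨mem_rightCylinder_of_mem_cylinderCell (hs hx).1 h1,
    mem_rightCylinder_of_mem_cylinderCell (hs hx).2 fun h3 => h2 ?_⟩
  rw [PiLp.add_apply] at h3
  linarith

theorem restrict_rightCylinder_eq (R h : ℝ) :
    (volume : Measure (EuclideanSpace ℝ (Fin (d + 1)))).restrict (rightCylinder d R h)
      = volume.restrict (cylinderCell d R (-h) (2 * h)) := by
  refine Measure.restrict_congr_set ?_
  filter_upwards [ae_last_ne (d := d) (-h)] with x hx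
  exact propext ⟨fun h1 => rightCylinder_subset_cylinderCell R h h1,
    fun h1 => mem_rightCylinder_of_mem_cylinderCell h1 hx⟩

end Cylinder

/-! ### Difference estimates for the sorted function -/

section CylinderSort

variable {d : ℕ}

/-- The mesh of the subdivision of `(-h, h)` into `m + 1` intervals. -/
noncomputable def meshSize (h : ℝ) (m : ℕ) : ℝ := 2 * h / (m + 1)

theorem meshSize_pos {h : ℝ} (hh : 0 < h) (m : ℕ) : 0 < meshSize h m := by
  unfold meshSize; positivity

theorem natCast_succ_mul_meshSize (h : ℝ) (m : ℕ) : ((m + 1 : ℕ) : ℝ) * meshSize h m = 2 * h := by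
  unfold meshSize; push_cast; field_simp

theorem tendsto_meshSize (h : ℝ) : Tendsto (meshSize h) atTop (𝓝 0) := by
  have := (tendsto_one_div_add_atTop_nhds_zero_nat (𝕜 := ℝ)).const_mul (2 * h)
  rw [mul_zero] at this
  refine this.congr fun m => ?_
  unfold meshSize; ring

/-- The lowest cell of the subdivision of the cylinder into `m + 1` slices. -/
def baseCell (d : ℕ) (R h : ℝ) (m : ℕ) : Set (EuclideanSpace ℝ (Fin (d + 1))) :=
  cylinderCell d R (-h) (meshSize h m)

/-- The vertical vector whose length is the height of one slice. -/
noncomputable def meshVector (d : ℕ) (h : ℝ) (m : ℕ) : EuclideanSpace ℝ (Fin (d + 1)) :=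
  meshSize h m • EuclideanSpace.single (Fin.last d) 1

/-- The function obtained from `u` by sorting its values along the lattice of mesh
`2h / (m + 1)` on each vertical line. -/
noncomputable def cylinderSort (d : ℕ) (R h : ℝ) (m : ℕ)
    (u : EuclideanSpace ℝ (Fin (d + 1)) → ℝ) : EuclideanSpace ℝ (Fin (d + 1)) → ℝ :=
  latticeSort (baseCell d R h m) (meshVector d h m) (m + 1) u

theorem isLatticeCell_baseCell {R h : ℝ} (hh : 0 < h) (m : ℕ) :
    IsLatticeCell (baseCell d R h m) (meshVector d h m) :=
  isLatticeCell_cylinderCell R (-h) (meshSize_pos hh m)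

theorem measurableSet_baseCell (R h : ℝ) (m : ℕ) : MeasurableSet (baseCell d R h m) :=
  measurableSet_cylinderCell _ _ _ _

theorem stack_baseCell {R h : ℝ} (hh : 0 < h) (m : ℕ) :
    stack (baseCell d R h m) (meshVector d h m) (m + 1) = cylinderCell d R (-h) (2 * h) := by
  ext x
  rw [baseCell, meshVector, mem_stack_cylinderCell (meshSize_pos hh m), natCast_succ_mul_meshSize]

theorem measurable_cylinderSort (R h : ℝ) (m : ℕ) {u : EuclideanSpace ℝ (Fin (d + 1)) → ℝ}
    (hu : Measurable u) : Measurable (cylinderSort d R h m u) :=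
  measurable_latticeSort (measurableSet_baseCell R h m) _ _ hu

/-- The contraction property holds only where the shift by `y` does not change the slice, which is
what the stack on the left describes. -/
theorem eLpNorm_cylinderSort_translate_le {R h : ℝ} (hh : 0 < h) (m : ℕ)
    {u : EuclideanSpace ℝ (Fin (d + 1)) → ℝ} (hu : Measurable u)
    (y : EuclideanSpace ℝ (Fin (d + 1))) :
    eLpNorm (fun x => cylinderSort d R h m u (x + y) - cylinderSort d R h m u x) 2
        (volume.restrict (stack (shiftDomain (baseCell d R h m) y) (meshVector d h m) (m + 1)))
      ≤ eLpNorm (fun x => u (x + y) - u x) 2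
        (volume.restrict (shiftDomain (rightCylinder d R h) y)) := by
  have hB := measurableSet_baseCell (d := d) R h m
  refine (eLpNorm_latticeSort_translate_le (isLatticeCell_baseCell hh m)
    (D := shiftDomain (baseCell d R h m) y) (fun x hx => hx.1)
    (hB.inter ((measurable_add_const y) hB)) hB (m + 1) hu (fun b hb => hb.2)).trans ?_
  refine eLpNorm_mono_measure _ (Measure.restrict_mono_ae (ae_le_shiftDomain_rightCylinder ?_))
  intro x hx
  obtain ⟨b, hb, j, rfl⟩ := mem_stack.1 hx
  rw [← stack_baseCell hh m]
  refine ⟨add_nsmul_mem_stack hb.1 j, ?_⟩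
  have h1 := add_nsmul_mem_stack (t := meshVector d h m) (show b + y ∈ baseCell d R h m from hb.2) j
  rwa [add_right_comm] at h1

theorem exists_eq_add_nsmul_meshVector {R h : ℝ} (hh : 0 < h) (m : ℕ)
    {x : EuclideanSpace ℝ (Fin (d + 1))} (hx : x ∈ rightCylinder d R h) :
    ∃ b ∈ baseCell d R h m, ∃ j : Fin (m + 1), x = b + (j : ℕ) • meshVector d h m := by
  rw [← mem_stack, stack_baseCell hh m]
  exact rightCylinder_subset_cylinderCell R h hx

/-- Sorting does not increase horizontal difference quotients. -/
theorem eLpNorm_cylinderSort_horizontal_le {R h : ℝ} (hh : 0 < h) (m : ℕ)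
    {u : EuclideanSpace ℝ (Fin (d + 1)) → ℝ} (hu : Measurable u)
    {y : EuclideanSpace ℝ (Fin (d + 1))} (hy : y (Fin.last d) = 0) :
    eLpNorm (fun x => cylinderSort d R h m u (x + y) - cylinderSort d R h m u x) 2
        (volume.restrict (shiftDomain (rightCylinder d R h) y))
      ≤ eLpNorm (fun x => u (x + y) - u x) 2
        (volume.restrict (shiftDomain (rightCylinder d R h) y)) := by
  refine le_trans (eLpNorm_mono_measure _ (Measure.restrict_mono ?_ le_rfl))
    (eLpNorm_cylinderSort_translate_le hh m hu y)
  rintro x ⟨hx, hxy⟩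
  obtain ⟨b, hb, j, rfl⟩ := exists_eq_add_nsmul_meshVector hh m hx
  refine add_nsmul_mem_stack (D := shiftDomain (baseCell d R h m) y) ⟨hb, ?_, ?_⟩ j
  · have h1 := (mem_rightCylinder.1 hxy).1
    rwa [add_right_comm, meshVector, horizontalPart_add_nsmul] at h1
  · rw [PiLp.add_apply, hy, add_zero]
    exact hb.2

/-- Sorting does not increase vertical differences at the distance of one mesh size. -/
theorem eLpNorm_cylinderSort_step_le {R h : ℝ} (hh : 0 < h) (m : ℕ)
    {u : EuclideanSpace ℝ (Fin (d + 1)) → ℝ} (hu : Measurable u) :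
    eLpNorm (fun x => cylinderSort d R h m u (x + meshVector d h m) - cylinderSort d R h m u x) 2
        (volume.restrict (stack (baseCell d R h m) (meshVector d h m) m))
      ≤ eLpNorm (fun x => u (x + meshVector d h m) - u x) 2
        (volume.restrict (shiftDomain (rightCylinder d R h) (meshVector d h m))) := by
  refine (eLpNorm_latticeSort_step_le (isLatticeCell_baseCell hh m)
    (measurableSet_baseCell R h m) m hu).trans ?_
  refine eLpNorm_mono_measure _ (Measure.restrict_mono_ae (ae_le_shiftDomain_rightCylinder ?_))
  intro x hx
  obtain ⟨b, hb, j, rfl⟩ := mem_stack.1 hx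
  rw [← stack_baseCell hh m]
  refine ⟨add_nsmul_mem_stack hb j.castSucc, ?_⟩
  have h1 := add_nsmul_mem_stack (t := meshVector d h m) hb j.succ
  rwa [Fin.val_succ, succ_nsmul, ← add_assoc] at h1

/-- A point that can be raised by a full mesh size is not in the top slice, hence `m` levels instead
of `m + 1`. -/
theorem shiftDomain_meshVector_subset {R h : ℝ} (hh : 0 < h) (m : ℕ) :
    shiftDomain (rightCylinder d R h) (meshVector d h m)
      ⊆ stack (baseCell d R h m) (meshVector d h m) m := by
  rintro x ⟨hx, hxt⟩
  have hδ := meshSize_pos hh m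
  rw [baseCell, meshVector, mem_stack_cylinderCell hδ]
  obtain ⟨h1, h2, -⟩ := mem_rightCylinder.1 hx
  have h3 := (mem_rightCylinder.1 hxt).2.2
  have h4 := natCast_succ_mul_meshSize h m
  simp only [meshVector, PiLp.add_apply, PiLp.smul_apply, smul_eq_mul] at h3
  rw [PiLp.single_apply, if_pos rfl] at h3
  push_cast at h4
  exact ⟨h1, h2.le, by nlinarith⟩

/-- A shift shorter than one mesh size either stays in its slice or reaches the next one. In the
second case the shift by `τ - meshSize h m` stays in the slice, and the slice is not the top one. -/
theorem shiftDomain_subset_union_stack {R h : ℝ} (hh : 0 < h) (m : ℕ) {τ : ℝ} (h0 : 0 ≤ τ)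
    (h1 : τ < meshSize h m) :
    shiftDomain (rightCylinder d R h) (τ • EuclideanSpace.single (Fin.last d) 1)
      ⊆ stack (shiftDomain (baseCell d R h m) (τ • EuclideanSpace.single (Fin.last d) 1))
          (meshVector d h m) (m + 1)
        ∪ stack (shiftDomain (baseCell d R h m)
            ((τ - meshSize h m) • EuclideanSpace.single (Fin.last d) 1)) (meshVector d h m) m := by
  rintro x ⟨hx, hxt⟩
  have hδ := meshSize_pos hh m
  obtain ⟨b, hb, j, rfl⟩ := exists_eq_add_nsmul_meshVector hh m hx
  have hH : ∀ a : ℝ, horizontalPart d (b + a • EuclideanSpace.single (Fin.last d) 1)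
      = horizontalPart d b := fun a => by
    rw [map_add, horizontalPart_smul_single_last, add_zero]
  have hL : ∀ a : ℝ, (b + a • EuclideanSpace.single (Fin.last d) (1 : ℝ)) (Fin.last d)
      = b (Fin.last d) + a := fun a => by simp
  obtain ⟨hb1, hb2, hb3⟩ := id hb
  by_cases hcase : b (Fin.last d) + τ < -h + meshSize h m
  · refine Or.inl (add_nsmul_mem_stack (D := shiftDomain (baseCell d R h m)
      (τ • EuclideanSpace.single (Fin.last d) 1)) ⟨hb, ?_, ?_, ?_⟩ j)
    · rwa [hH]
    · rw [hL]; linarith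
    · rw [hL]; linarith
  · push Not at hcase
    have hjm : (j : ℕ) < m := by
      have h3 := (mem_rightCylinder.1 hxt).2.2
      have h4 := natCast_succ_mul_meshSize h m
      rw [add_right_comm, meshVector, last_add_nsmul, hL] at h3
      have h5 : ((j : ℕ) : ℝ) * meshSize h m < m * meshSize h m := by
        push_cast at h4
        nlinarith
      exact_mod_cast lt_of_mul_lt_mul_right h5 hδ.le
    refine Or.inr (add_nsmul_mem_stack (D := shiftDomain (baseCell d R h m)
      ((τ - meshSize h m) • EuclideanSpace.single (Fin.last d) 1)) (j := ⟨j, hjm⟩)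
      ⟨hb, ?_, ?_, ?_⟩)
    · rwa [hH]
    · rw [hL]; linarith
    · rw [hL]; linarith

/-- With `δ` the mesh size, the shift by `τ` within a slice costs `τ * a`; across slices it is a
shift by `τ - δ` within the slice followed by one full step, costing `(δ - τ) * a + δ * a`. The
total `2 * δ * a` is below the stated bound. -/
theorem eLpNorm_cylinderSort_small_vertical_le {R h : ℝ} (hh : 0 < h) (m : ℕ)
    {u : EuclideanSpace ℝ (Fin (d + 1)) → ℝ} (hu : Measurable u) {a : ℝ} (ha : 0 ≤ a)
    (hua : ∀ τ : ℝ, eLpNorm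
      (fun x => u (x + τ • EuclideanSpace.single (Fin.last d) 1) - u x) 2
      (volume.restrict (shiftDomain (rightCylinder d R h)
        (τ • EuclideanSpace.single (Fin.last d) 1))) ≤ ENNReal.ofReal (|τ| * a))
    {τ : ℝ} (h0 : 0 ≤ τ) (h1 : τ < meshSize h m) :
    eLpNorm (fun x => cylinderSort d R h m u (x + τ • EuclideanSpace.single (Fin.last d) 1)
        - cylinderSort d R h m u x) 2
      (volume.restrict (shiftDomain (rightCylinder d R h)
        (τ • EuclideanSpace.single (Fin.last d) 1))) ≤ ENNReal.ofReal (3 * meshSize h m * a) := by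
  have hδ := meshSize_pos hh m
  set e : EuclideanSpace ℝ (Fin (d + 1)) := EuclideanSpace.single (Fin.last d) 1 with he
  set w := cylinderSort d R h m u
  have hw : Measurable w := measurable_cylinderSort R h m hu
  have hm : ∀ b, Measurable fun x => w (x + b) - w x := fun b =>
    (hw.comp (measurable_add_const b)).sub hw
  set y' := (τ - meshSize h m) • e with hy'
  have hsplit : τ • e = y' + meshVector d h m := by
    rw [hy', meshVector, ← add_smul, sub_add_cancel]
  have p1 := (eLpNorm_cylinderSort_translate_le (R := R) hh m hu (τ • e)).trans (hua τ)
  have p2 := (eLpNorm_cylinderSort_translate_le (R := R) hh m hu y').trans (hua _)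
  have p3 := (eLpNorm_cylinderSort_step_le (R := R) hh m hu).trans (hua _)
  set s₂ := stack (shiftDomain (baseCell d R h m) y') (meshVector d h m) m
  have p2' : eLpNorm (fun x => w (x + y') - w x) 2 (volume.restrict s₂)
      ≤ ENNReal.ofReal (|τ - meshSize h m| * a) := by
    refine le_trans (eLpNorm_mono_measure _ (Measure.restrict_mono ?_ le_rfl)) p2
    intro x hx
    obtain ⟨b, hb, j, rfl⟩ := mem_stack.1 hx
    exact add_nsmul_mem_stack hb j.castSucc
  have p3' : eLpNorm (fun x => w (x + y' + meshVector d h m) - w (x + y')) 2 (volume.restrict s₂)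
      ≤ ENNReal.ofReal (|meshSize h m| * a) := by
    refine le_trans (eLpNorm_comp_add_right_restrict_le (hm (meshVector d h m))
      (measurableSet_stack (measurableSet_baseCell R h m) _ m) (a := y') ?_) p3
    intro x hx
    obtain ⟨b, hb, j, rfl⟩ := mem_stack.1 hx
    rw [add_right_comm]
    exact add_nsmul_mem_stack (show b + y' ∈ baseCell d R h m from hb.2) j
  have p4 : eLpNorm (fun x => w (x + τ • e) - w x) 2 (volume.restrict s₂)
      ≤ ENNReal.ofReal (|meshSize h m| * a) + ENNReal.ofReal (|τ - meshSize h m| * a) := by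
    have hf : (fun x => w (x + τ • e) - w x)
        = (fun x => w (x + y' + meshVector d h m) - w (x + y')) + fun x => w (x + y') - w x := by
      ext x
      simp only [Pi.add_apply]
      rw [hsplit, ← add_assoc]
      ring
    rw [hf]
    have hm1 : Measurable fun x => w (x + y' + meshVector d h m) - w (x + y') :=
      (hm (meshVector d h m)).comp (measurable_add_const y')
    exact (eLpNorm_add_le hm1.aestronglyMeasurable (hm y').aestronglyMeasurable
      (by norm_num)).trans (add_le_add p3' p2')
  refine (eLpNorm_mono_measure _ (Measure.restrict_mono
    (shiftDomain_subset_union_stack hh m h0 h1) le_rfl)).trans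
    ((eLpNorm_two_restrict_union_le _ _ _).trans ((add_le_add p1 p4).trans ?_))
  rw [← ENNReal.ofReal_add (by positivity) (by positivity),
    ← ENNReal.ofReal_add (by positivity) (by positivity)]
  refine ENNReal.ofReal_le_ofReal ?_
  rw [abs_of_nonneg h0, abs_of_pos hδ, abs_of_neg (by linarith)]
  nlinarith

/-- The shift is cut into full mesh steps, which are sharp, and one short remainder. The excess
vanishes as `m → ∞`, which is enough for equicontinuity though not for the sharp gradient bound. -/
theorem eLpNorm_cylinderSort_vertical_le {R h : ℝ} (hh : 0 < h) (m : ℕ)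
    {u : EuclideanSpace ℝ (Fin (d + 1)) → ℝ} (hu : Measurable u) {a : ℝ} (ha : 0 ≤ a)
    (hua : ∀ τ : ℝ, eLpNorm
      (fun x => u (x + τ • EuclideanSpace.single (Fin.last d) 1) - u x) 2
      (volume.restrict (shiftDomain (rightCylinder d R h)
        (τ • EuclideanSpace.single (Fin.last d) 1))) ≤ ENNReal.ofReal (|τ| * a))
    {τ : ℝ} (h0 : 0 ≤ τ) :
    eLpNorm (fun x => cylinderSort d R h m u (x + τ • EuclideanSpace.single (Fin.last d) 1)
        - cylinderSort d R h m u x) 2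
      (volume.restrict (shiftDomain (rightCylinder d R h)
        (τ • EuclideanSpace.single (Fin.last d) 1)))
      ≤ ENNReal.ofReal ((τ + 3 * meshSize h m) * a) := by
  have hδ := meshSize_pos hh m
  have hw : Measurable (cylinderSort d R h m u) := measurable_cylinderSort R h m hu
  have hstep := (eLpNorm_mono_measure _ (Measure.restrict_mono
    (shiftDomain_meshVector_subset (R := R) hh m) le_rfl)).trans
      ((eLpNorm_cylinderSort_step_le (R := R) hh m hu).trans (hua _))
  have key : ∀ (k : ℕ) (σ : ℝ), 0 ≤ σ → σ < meshSize h m → eLpNorm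
      (fun x => cylinderSort d R h m u
        (x + (k * meshSize h m + σ) • EuclideanSpace.single (Fin.last d) 1)
        - cylinderSort d R h m u x) 2 (volume.restrict (shiftDomain (rightCylinder d R h)
        ((k * meshSize h m + σ) • EuclideanSpace.single (Fin.last d) 1)))
      ≤ ENNReal.ofReal ((k * meshSize h m + 3 * meshSize h m) * a) := by
    intro k σ hσ0 hσ1
    induction k with
    | zero =>
      simpa using eLpNorm_cylinderSort_small_vertical_le hh m hu ha hua hσ0 hσ1
    | succ k ih =>
      have e1 : ((k + 1 : ℕ) : ℝ) * meshSize h m + σ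
          = meshSize h m + (k * meshSize h m + σ) := by push_cast; ring
      rw [e1]
      refine (eLpNorm_shift_add_le (isOpen_rightCylinder d R h) (convex_rightCylinder d R h) hw _
        hδ.le (by positivity)).trans ((add_le_add hstep ih).trans ?_)
      rw [← ENNReal.ofReal_add (by positivity) (by positivity)]
      refine ENNReal.ofReal_le_ofReal (le_of_eq ?_)
      rw [abs_of_pos hδ]
      push_cast
      ring
  have hq : 0 ≤ τ / meshSize h m := div_nonneg h0 hδ.le
  have hl := Nat.floor_le hq
  have hu' := Nat.lt_floor_add_one (τ / meshSize h m)
  rw [le_div_iff₀ hδ] at hl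
  rw [div_lt_iff₀ hδ] at hu'
  set k := ⌊τ / meshSize h m⌋₊
  have := key k (τ - k * meshSize h m) (by linarith) (by linarith)
  rw [add_sub_cancel] at this
  refine this.trans (ENNReal.ofReal_le_ofReal ?_)
  gcongr

theorem phaseVolume_cylinderSort {R h : ℝ} (hh : 0 < h) (m : ℕ)
    {u : EuclideanSpace ℝ (Fin (d + 1)) → ℝ} (hu : Measurable u) :
    phaseVolume (rightCylinder d R h) (cylinderSort d R h m u)
      = phaseVolume (rightCylinder d R h) u := by
  have h1 : Measurable (Set.indicator {t : ℝ | |t| < 1} (1 : ℝ → ℝ≥0∞)) :=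
    measurable_one.indicator (measurableSet_lt measurable_norm measurable_const)
  have h2 := setLIntegral_comp_latticeSort (μ := volume) (isLatticeCell_baseCell (d := d) (R := R)
    hh m) (measurableSet_baseCell R h m) (m + 1) hu h1
  rw [stack_baseCell hh m] at h2
  rw [phaseVolume, phaseVolume, restrict_rightCylinder_eq]
  exact h2

theorem ae_cylinderSort_mem_Icc {R h : ℝ} (hh : 0 < h) (m : ℕ)
    {u V W : EuclideanSpace ℝ (Fin (d + 1)) → ℝ} (hV : IsMonotoneLast (rightCylinder d R h) V)
    (hW : IsMonotoneLast (rightCylinder d R h) W)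
    (hu : ∀ᵐ x ∂volume.restrict (rightCylinder d R h), V x ≤ u x ∧ u x ≤ W x) :
    ∀ᵐ x ∂volume.restrict (rightCylinder d R h),
      V x ≤ cylinderSort d R h m u x ∧ cylinderSort d R h m u x ≤ W x := by
  have hδ := meshSize_pos hh m
  rw [restrict_rightCylinder_eq, ← stack_baseCell hh m] at hu ⊢
  have hmono : ∀ F : EuclideanSpace ℝ (Fin (d + 1)) → ℝ, IsMonotoneLast (rightCylinder d R h) F →
      ∀ᵐ b ∂volume.restrict (baseCell d R h m),
        Monotone fun j : Fin (m + 1) => F (b + (j : ℕ) • meshVector d h m) := by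
    intro F hF
    -- Monotonicity of `F` is known only on the open cylinder, so base points on the bottom face are
    -- discarded.
    filter_upwards [ae_restrict_mem (measurableSet_baseCell R h m),
      ae_restrict_of_ae (ae_last_ne (d := d) (-h))] with b hb hne i j hij
    have hmem : ∀ i : Fin (m + 1), b + (i : ℕ) • meshVector d h m ∈ rightCylinder d R h := by
      intro i
      refine mem_rightCylinder_of_mem_cylinderCell ?_ ?_
      · rw [← stack_baseCell hh m]
        exact add_nsmul_mem_stack hb i
      · rw [meshVector, last_add_nsmul]
        have h1 : -h < b (Fin.last d) := lt_of_le_of_ne hb.2.1 hne.symm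
        have h2 : 0 ≤ ((i : ℕ) : ℝ) * meshSize h m := by positivity
        linarith
    refine hF _ (hmem i) _ (hmem j) (fun k => ?_) ?_
    · simp [meshVector, (Fin.castSucc_lt_last k).ne]
    · rw [meshVector, last_add_nsmul, last_add_nsmul]
      have : ((i : ℕ) : ℝ) ≤ (j : ℕ) := by exact_mod_cast hij
      gcongr
  exact ae_latticeSort_mem_Icc (isLatticeCell_baseCell hh m) (measurableSet_baseCell R h m)
    (hmono V hV) (hmono W hW) hu

theorem cylinderSort_le_cylinderSort_add {R h : ℝ} (hh : 0 < h) (m : ℕ)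
    (u : EuclideanSpace ℝ (Fin (d + 1)) → ℝ) {x : EuclideanSpace ℝ (Fin (d + 1))} {k : ℕ}
    (hx : x ∈ rightCylinder d R h) (hxk : x + k • meshVector d h m ∈ rightCylinder d R h) :
    cylinderSort d R h m u x ≤ cylinderSort d R h m u (x + k • meshVector d h m) := by
  refine latticeSort_le_latticeSort_add (isLatticeCell_baseCell hh m) u ?_ ?_ <;>
    rw [stack_baseCell hh m]
  exacts [rightCylinder_subset_cylinderCell R h hx, rightCylinder_subset_cylinderCell R h hxk]

end CylinderSort

/-! ### A monotone representative of the limit -/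

section BallAverages

variable {E : Type*} [NormedAddCommGroup E] [InnerProductSpace ℝ E] [FiniteDimensional ℝ E]
  [MeasurableSpace E] [BorelSpace E]

/-- Indicators of moving balls converge off the limiting sphere, which is null. Averages are used
because a.e. convergence of `w k` says nothing about `w k` at points that move with `k`. -/
theorem tendsto_setIntegral_closedBall {Ω : Set E} {w : ℕ → E → ℝ} {u G : E → ℝ}
    (hw : ∀ k, AEStronglyMeasurable (w k) (volume.restrict Ω)) (hG : IntegrableOn G Ω)
    (hwG : ∀ k, ∀ᵐ x ∂volume.restrict Ω, |w k x| ≤ |G x|)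
    (hlim : ∀ᵐ x ∂volume.restrict Ω, Tendsto (fun k => w k x) atTop (𝓝 (u x)))
    {y : ℕ → E} {z : E} (hy : Tendsto y atTop (𝓝 z)) {r : ℝ} (hr : 0 < r)
    (hyΩ : ∀ k, Metric.closedBall (y k) r ⊆ Ω) (hzΩ : Metric.closedBall z r ⊆ Ω) :
    Tendsto (fun k => ∫ x in Metric.closedBall (y k) r, w k x) atTop
      (𝓝 (∫ x in Metric.closedBall z r, u x)) := by
  have hind : ∀ (f : E → ℝ) (c : E), Metric.closedBall c r ⊆ Ω →
      ∫ x in Metric.closedBall c r, f x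
        = ∫ x in Ω, (Metric.closedBall c r).indicator f x := fun f c hc => by
    rw [setIntegral_indicator measurableSet_closedBall, Set.inter_eq_right.2 hc]
  rw [hind u z hzΩ]
  simp only [fun k => hind (w k) (y k) (hyΩ k)]
  refine tendsto_integral_of_dominated_convergence (fun x => |G x|)
    (fun k => (hw k).indicator measurableSet_closedBall) hG.abs (fun k => ?_) ?_
  · filter_upwards [hwG k] with x hx
    exact (norm_indicator_le_norm_self (w k) x).trans hx
  · have hsph : ∀ᵐ x ∂volume.restrict Ω, x ∉ Metric.sphere z r := by
      refine ae_restrict_of_ae ?_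
      exact measure_eq_zero_iff_ae_notMem.1 (Measure.addHaar_sphere_of_ne_zero volume z hr.ne')
    filter_upwards [hlim, hsph] with x hx hxs
    have hdist : Tendsto (fun k => dist x (y k)) atTop (𝓝 (dist x z)) :=
      tendsto_const_nhds.dist hy
    rcases lt_or_gt_of_ne (show dist x z ≠ r from hxs) with hlt | hgt
    · rw [Set.indicator_of_mem (show x ∈ Metric.closedBall z r from hlt.le)]
      refine hx.congr' ?_
      filter_upwards [hdist.eventually_lt_const hlt] with k hk
      rw [Set.indicator_of_mem (show x ∈ Metric.closedBall (y k) r from hk.le)]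
    · rw [Set.indicator_of_notMem (show x ∉ Metric.closedBall z r from not_le.2 hgt)]
      refine tendsto_const_nhds.congr' ?_
      filter_upwards [hdist.eventually_const_lt hgt] with k hk
      rw [Set.indicator_of_notMem (show x ∉ Metric.closedBall (y k) r from not_le.2 hk)]

/-- If `w k` increases under translation by `q k • e` and `q k → τ`, then the averages over balls
of the limit increase under translation by `τ • e`. -/
theorem setIntegral_closedBall_le_of_tendsto {Ω : Set E} (hc : Convex ℝ Ω)
    {w : ℕ → E → ℝ} {u G : E → ℝ}
    (hw : ∀ k, AEStronglyMeasurable (w k) (volume.restrict Ω)) (hG : IntegrableOn G Ω)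
    (hwG : ∀ k, ∀ᵐ x ∂volume.restrict Ω, |w k x| ≤ |G x|)
    (hlim : ∀ᵐ x ∂volume.restrict Ω, Tendsto (fun k => w k x) atTop (𝓝 (u x)))
    {e : E} {q : ℕ → ℝ} {τ : ℝ} (hq : Tendsto q atTop (𝓝 τ)) (hq0 : ∀ k, 0 ≤ q k)
    (hqτ : ∀ k, q k ≤ τ) (hmono : ∀ k, ∀ x ∈ Ω, x + q k • e ∈ Ω → w k x ≤ w k (x + q k • e))
    {x : E} {r : ℝ} (hr : 0 < r) (hx : Metric.closedBall x r ⊆ Ω)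
    (hxτ : Metric.closedBall (x + τ • e) r ⊆ Ω) :
    ∫ z in Metric.closedBall x r, u z ≤ ∫ z in Metric.closedBall (x + τ • e) r, u z := by
  have hmem : ∀ k, ∀ z ∈ Metric.closedBall x r, z + q k • e ∈ Ω := fun k z hz => by
    refine hc.add_smul_mem_of_mem_shiftDomain (τ := τ) ⟨hx hz, hxτ ?_⟩
      (Set.mem_uIcc.2 (Or.inl ⟨hq0 k, hqτ k⟩))
    simpa using hz
  have hsub : ∀ k, Metric.closedBall (x + q k • e) r ⊆ Ω := fun k z hz => by
    have := hmem k (z - q k • e) (by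
      rw [Metric.mem_closedBall, dist_eq_norm] at hz ⊢
      rwa [show z - q k • e - x = z - (x + q k • e) by abel])
    simpa using this
  have hwi : ∀ k, IntegrableOn (w k) Ω := fun k => Integrable.mono hG (hw k) (hwG k)
  have h1 := tendsto_setIntegral_closedBall hw hG hwG hlim (tendsto_const_nhds (x := x)) hr
    (fun _ => hx) hx
  have h2 := tendsto_setIntegral_closedBall hw hG hwG hlim
    (tendsto_const_nhds.add (hq.smul_const e)) hr hsub hxτ
  refine le_of_tendsto_of_tendsto' h1 h2 fun k => ?_
  have hmp := measurePreserving_add_right (volume : Measure E) (q k • e)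
  have hemb := measurableEmbedding_addRight (q k • e)
  have hpre : (fun z => z + q k • e) ⁻¹' Metric.closedBall (x + q k • e) r
      = Metric.closedBall x r := by
    ext z
    simp
  rw [← hmp.setIntegral_preimage_emb hemb (w k) (Metric.closedBall (x + q k • e) r), hpre]
  refine setIntegral_mono_on ((hwi k).mono_set hx) ?_ measurableSet_closedBall
    fun z hz => hmono k z (hx hz) (hmem k z hz)
  rw [← hpre]
  exact (hmp.integrableOn_comp_preimage hemb).2 ((hwi k).mono_set (hsub k))

end BallAverages

/-! ### From monotone averages to a monotone function -/

section MonotoneRepresentative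

variable {d : ℕ} {R h : ℝ} {u V W : EuclideanSpace ℝ (Fin (d + 1)) → ℝ}

theorem exists_eq_add_smul_single_last {x y : EuclideanSpace ℝ (Fin (d + 1))}
    (hxy : ∀ i : Fin d, x i.castSucc = y i.castSucc) :
    y = x + (y (Fin.last d) - x (Fin.last d)) • EuclideanSpace.single (Fin.last d) 1 := by
  ext i
  refine Fin.lastCases ?_ (fun i => ?_) i
  · simp
  · simp [hxy, (Fin.castSucc_lt_last i).ne]

theorem eventually_closedBall_one_div_subset {E : Type*} [PseudoMetricSpace E] {Ω : Set E}
    (hΩ : IsOpen Ω) {x : E} (hx : x ∈ Ω) :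
    ∀ᶠ k : ℕ in atTop, Metric.closedBall x (1 / ((k : ℝ) + 1)) ⊆ Ω := by
  obtain ⟨ε, hε, hsub⟩ := Metric.nhds_basis_closedBall.mem_iff.1 (hΩ.mem_nhds hx)
  filter_upwards [tendsto_one_div_add_atTop_nhds_zero_nat.eventually_le_const hε] with k hk
  exact (Metric.closedBall_subset_closedBall hk).trans hsub

/-- A function whose averages over balls are monotone in the last variable, and which lies between
two functions that are monotone in the last variable, has a representative that is monotone in the
last variable. -/
theorem exists_ae_eq_isMonotoneLast (hui : IntegrableOn u (rightCylinder d R h))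
    (hV : IsMonotoneLast (rightCylinder d R h) V) (hW : IsMonotoneLast (rightCylinder d R h) W)
    (hVW : ∀ᵐ x ∂volume.restrict (rightCylinder d R h), V x ≤ u x ∧ u x ≤ W x)
    (hball : ∀ (x : EuclideanSpace ℝ (Fin (d + 1))) (τ r : ℝ), 0 ≤ τ → 0 < r →
      Metric.closedBall x r ⊆ rightCylinder d R h →
      Metric.closedBall (x + τ • EuclideanSpace.single (Fin.last d) 1) r ⊆ rightCylinder d R h →
      ∫ z in Metric.closedBall x r, u z
        ≤ ∫ z in Metric.closedBall (x + τ • EuclideanSpace.single (Fin.last d) 1) r, u z) :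
    ∃ v, IsMonotoneLast (rightCylinder d R h) v ∧
      ∀ᵐ x ∂volume.restrict (rightCylinder d R h), v x = u x := by
  set Ω := rightCylinder d R h
  have hΩ : IsOpen Ω := isOpen_rightCylinder d R h
  let ρ : ℕ → ℝ := fun k => 1 / ((k : ℝ) + 1)
  have hρ0 : ∀ k, 0 < ρ k := fun k => by positivity
  have hρ : Tendsto ρ atTop (𝓝 0) := tendsto_one_div_add_atTop_nhds_zero_nat
  let A : ℕ → EuclideanSpace ℝ (Fin (d + 1)) → ℝ := fun k x =>
    ⨍ z in Metric.closedBall x (ρ k), Ω.indicator u z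
  -- Clamping by `V` and `W` bounds the sequence at every point, so that the real `limsup` is well
  -- behaved. It keeps monotonicity because `V` and `W` are monotone, and it has no effect on the
  -- limit wherever `V ≤ u ≤ W`.
  let c : ℕ → EuclideanSpace ℝ (Fin (d + 1)) → ℝ := fun k x => max (V x) (min (A k x) (W x))
  have hcV : ∀ k x, V x ≤ c k x := fun k x => le_max_left _ _
  have hcW : ∀ k x, c k x ≤ max (V x) (W x) := fun k x => max_le_max_left _ (min_le_right _ _)
  -- The `limsup` has a value at every point and inherits monotonicity everywhere; at almost every
  -- point Lebesgue differentiation identifies it with `u`.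
  refine ⟨fun x => limsup (fun k => c k x) atTop, ?_, ?_⟩
  · intro x hx y hy hxy hle
    have hA : ∀ᶠ k in atTop, c k x ≤ c k y := by
      filter_upwards [eventually_closedBall_one_div_subset hΩ hx,
          eventually_closedBall_one_div_subset hΩ hy]
        with k hkx hky
      have hind : ∀ z, Metric.closedBall z (ρ k) ⊆ Ω →
          A k z = (volume.real (Metric.closedBall (0 : EuclideanSpace ℝ (Fin (d + 1))) (ρ k)))⁻¹
            * ∫ s in Metric.closedBall z (ρ k), u s := fun z hz => by
        simp only [A]
        rw [setAverage_eq, smul_eq_mul, Measure.real, Measure.real,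
          Measure.addHaar_closedBall_center volume z]
        congr 1
        exact setIntegral_congr_fun measurableSet_closedBall fun s hs =>
          Set.indicator_of_mem (hz hs) u
      have hAk : A k x ≤ A k y := by
        rw [hind x hkx, hind y hky]
        have e := exists_eq_add_smul_single_last hxy
        have h1 := hball x (y (Fin.last d) - x (Fin.last d)) (ρ k) (sub_nonneg.2 hle) (hρ0 k) hkx
        rw [← e] at h1
        exact mul_le_mul_of_nonneg_left (h1 hky) (inv_nonneg.2 measureReal_nonneg)
      exact max_le_max (hV x hx y hy hxy hle) (min_le_min hAk (hW x hx y hy hxy hle))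
    refine limsup_le_limsup hA ?_ ?_
    · exact IsBoundedUnder.isCoboundedUnder_le ⟨V x, eventually_map.2 (Eventually.of_forall
        fun k => hcV k x)⟩
    · exact ⟨max (V y) (W y), eventually_map.2 (Eventually.of_forall fun k => hcW k y)⟩
  · have hloc : LocallyIntegrable (Ω.indicator u) volume :=
      ((integrable_indicator_iff hΩ.measurableSet).2 hui).locallyIntegrable
    have hleb := IsUnifLocDoublingMeasure.ae_tendsto_average volume hloc 1
    filter_upwards [ae_restrict_of_ae hleb, hVW, ae_restrict_mem hΩ.measurableSet]
      with x hx hxVW hxΩ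
    have h1 : Tendsto (fun k => A k x) atTop (𝓝 (u x)) := by
      have := hx (fun _ : ℕ => x) ρ
        (tendsto_nhdsWithin_iff.2 ⟨hρ, Eventually.of_forall fun k => hρ0 k⟩)
        (Eventually.of_forall fun k => Metric.mem_closedBall_self (by
          rw [one_mul]; exact (hρ0 k).le))
      rwa [Set.indicator_of_mem hxΩ] at this
    have h2 : Tendsto (fun k => c k x) atTop (𝓝 (max (V x) (min (u x) (W x)))) :=
      tendsto_const_nhds.max (h1.min tendsto_const_nhds)
    rw [h2.limsup_eq, min_eq_left hxVW.2, max_eq_right hxVW.1]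

end MonotoneRepresentative

/-! ### Independence of the representative -/

section Congr

variable {n : ℕ} {Ω : Set (EuclideanSpace ℝ (Fin n))} {u v : EuclideanSpace ℝ (Fin n) → ℝ}

theorem IsWeakGradient.congr_ae {g : EuclideanSpace ℝ (Fin n) → EuclideanSpace ℝ (Fin n)}
    (hg : IsWeakGradient Ω u g) (hu : IntegrableOn u Ω)
    (h : ∀ᵐ x ∂volume.restrict Ω, v x = u x) : IsWeakGradient Ω v g := by
  refine ⟨IntegrableOn.locallyIntegrableOn (hu.congr (h.mono fun x hx => hx.symm)),
    hg.locallyIntegrableOn_grad, fun φ hφ hc hs i => ?_⟩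
  rw [← hg.integral_eq φ hφ hc hs i]
  refine integral_congr_ae ?_
  filter_upwards [h] with x hx
  rw [hx]

theorem phaseVolume_congr_ae (h : ∀ᵐ x ∂volume.restrict Ω, v x = u x) :
    phaseVolume Ω v = phaseVolume Ω u := by
  refine lintegral_congr_ae ?_
  filter_upwards [h] with x hx
  simp only [Set.indicator, Set.mem_ofPred_eq, hx]

theorem memH1_and_energy_congr_ae (hΩ : IsOpen Ω) (hfin : volume Ω ≠ ⊤) (hu : MemH1 Ω u)
    (h : ∀ᵐ x ∂volume.restrict Ω, v x = u x) : MemH1 Ω v ∧ energy Ω v = energy Ω u := by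
  have : IsFiniteMeasure (volume.restrict Ω) := ⟨by simpa using hfin.lt_top⟩
  obtain ⟨hu2, g, hg, hg2⟩ := hu
  have hgv := hg.congr_ae (hu2.integrable (by norm_num)) h
  refine ⟨⟨hu2.ae_eq (h.mono fun x hx => hx.symm), g, hgv, hg2⟩, ?_⟩
  rw [energy_eq hΩ hgv hg2, energy_eq hΩ hg hg2, phaseVolume_congr_ae h]

end Congr

/-- A minimizer can be replaced by a minimizer that is monotone in the last variable. -/
theorem exists_isMonotoneLast_energy_le {d : ℕ} {R h : ℝ} (hh : 0 < h)
    {V W : EuclideanSpace ℝ (Fin (d + 1)) → ℝ}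
    (hV2 : MemLp V 2 (volume.restrict (rightCylinder d R h)))
    (hW2 : MemLp W 2 (volume.restrict (rightCylinder d R h)))
    (hV : IsMonotoneLast (rightCylinder d R h) V) (hW : IsMonotoneLast (rightCylinder d R h) W)
    {v : EuclideanSpace ℝ (Fin (d + 1)) → ℝ} (hv : v ∈ constraintSet (rightCylinder d R h) V W) :
    ∃ u ∈ constraintSet (rightCylinder d R h) V W,
      energy (rightCylinder d R h) u ≤ energy (rightCylinder d R h) v ∧
      IsMonotoneLast (rightCylinder d R h) u := by
  set Ω := rightCylinder d R h with hΩdef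
  have hΩ : IsOpen Ω := isOpen_rightCylinder d R h
  have hc : Convex ℝ Ω := convex_rightCylinder d R h
  have hfin : volume Ω ≠ ⊤ := volume_rightCylinder_ne_top d R h
  have hfm : IsFiniteMeasure (volume.restrict Ω) := ⟨by simpa using hfin.lt_top⟩
  obtain ⟨⟨hv2, g, hg, hg2⟩, hvVW⟩ := hv
  -- Sorting evaluates the function at translated points, so a Borel measurable representative is
  -- fixed first.
  set u₀ := hv2.aestronglyMeasurable.mk v with hu₀def
  have hu₀m : Measurable u₀ := hv2.aestronglyMeasurable.stronglyMeasurable_mk.measurable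
  have hu₀v : ∀ᵐ x ∂volume.restrict Ω, u₀ x = v x :=
    hv2.aestronglyMeasurable.ae_eq_mk.mono fun x hx => hx.symm
  have hu₀2 : MemLp u₀ 2 (volume.restrict Ω) := hv2.ae_eq hv2.aestronglyMeasurable.ae_eq_mk
  have hg₀ : IsWeakGradient Ω u₀ g := hg.congr_ae (hv2.integrable (by norm_num)) hu₀v
  have hu₀VW : ∀ᵐ x ∂volume.restrict Ω, V x ≤ u₀ x ∧ u₀ x ≤ W x := by
    filter_upwards [hu₀v, hvVW] with x hx hxVW
    rwa [hx]
  let a : Fin (d + 1) → ℝ := fun i => (eLpNorm (fun x => g x i) 2 (volume.restrict Ω)).toReal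
  have ha0 : ∀ i, 0 ≤ a i := fun i => ENNReal.toReal_nonneg
  have hshift : ∀ i τ, eLpNorm (fun x => u₀ (x + τ • EuclideanSpace.single i 1) - u₀ x) 2
      (volume.restrict (shiftDomain Ω (τ • EuclideanSpace.single i 1)))
        ≤ ENNReal.ofReal (|τ| * a i) := fun i τ =>
    eLpNorm_shift_sub_le hΩ hc hfin hu₀2 (hg2.apply_euclidean i) (hg₀.isWeakDerivAlong i) τ
  let w : ℕ → EuclideanSpace ℝ (Fin (d + 1)) → ℝ := fun m => cylinderSort d R h m u₀
  have hwm : ∀ m, Measurable (w m) := fun m => measurable_cylinderSort R h m hu₀m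
  have hwVW : ∀ m, ∀ᵐ x ∂volume.restrict Ω, V x ≤ w m x ∧ w m x ≤ W x := fun m =>
    ae_cylinderSort_mem_Icc hh m hV hW hu₀VW
  have hhor : ∀ m (i : Fin d) τ, eLpNorm
      (fun x => w m (x + τ • EuclideanSpace.single i.castSucc 1) - w m x) 2
      (volume.restrict (shiftDomain Ω (τ • EuclideanSpace.single i.castSucc 1)))
        ≤ ENNReal.ofReal (|τ| * a i.castSucc) := fun m i τ =>
    (eLpNorm_cylinderSort_horizontal_le hh m hu₀m (by
      simp [(Fin.castSucc_lt_last i).ne'])).trans (hshift _ τ)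
  have hG : MemLp (fun x => |V x| + |W x|) 2 (volume.restrict Ω) := hV2.abs.add hW2.abs
  have hwG := fun m => abs_le_abs_add_abs_of_mem_constraintSet (hwVW m)
  have hphase : ∀ m, phaseVolume Ω (w m) = phaseVolume Ω u₀ := fun m =>
    phaseVolume_cylinderSort hh m hu₀m
  obtain ⟨φ, hφ, u, hu, hulim, hule⟩ := exists_subseq_tendsto_memH1_energy_le hΩ hfin
    (fun m => (hwm m).aestronglyMeasurable) hG hwG
    (fun i η hη => by
      refine Fin.lastCases ?_ (fun i => ?_) i
      -- Half of the budget is for `τ`, half for the excess `3 * meshSize h m`; the `+ 1` avoids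
      -- division by zero.
      · set ρ := η / (2 * (a (Fin.last d) + 1)) with hρ
        have hρ0 : 0 < ρ := by have := ha0 (Fin.last d); positivity
        refine ⟨ρ, hρ0, ?_⟩
        have hmesh := (tendsto_meshSize h).const_mul 3
        rw [mul_zero] at hmesh
        filter_upwards [hmesh.eventually_le_const hρ0] with m hm τ hτ0 hτ1
        refine (eLpNorm_cylinderSort_vertical_le hh m hu₀m (ha0 _) (hshift _) hτ0).trans
          (ENNReal.ofReal_le_ofReal ?_)
        calc (τ + 3 * meshSize h m) * a (Fin.last d) ≤ (ρ + ρ) * (a (Fin.last d) + 1) :=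
              mul_le_mul (add_le_add hτ1 hm) (by linarith) (ha0 _) (by positivity)
          _ = η := by
              have : a (Fin.last d) + 1 ≠ 0 := by have := ha0 (Fin.last d); positivity
              rw [hρ]; field_simp; ring
      · have h1 : 0 < a i.castSucc + 1 := by have := ha0 i.castSucc; positivity
        refine ⟨η / (a i.castSucc + 1), by positivity, Eventually.of_forall fun m τ h0 hτ => ?_⟩
        refine (hhor m i τ).trans (ENNReal.ofReal_le_ofReal ?_)
        rw [abs_of_nonneg h0]
        calc τ * a i.castSucc ≤ η / (a i.castSucc + 1) * (a i.castSucc + 1) :=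
              mul_le_mul hτ (by linarith) (ha0 _) (by positivity)
          _ = η := by field_simp)
    (A := a) (fun i => by
      refine Fin.lastCases ?_ (fun i => ?_) i
      -- Vertically the step must be the mesh size itself, where sorting loses nothing; horizontally
      -- any sequence of steps tending to zero serves.
      · refine ⟨meshSize h, fun _ => a (Fin.last d), meshSize_pos hh, tendsto_meshSize h,
          fun _ => ha0 _, tendsto_const_nhds, fun m => ?_⟩
        have h1 := (eLpNorm_mono_measure _ (Measure.restrict_mono
          (shiftDomain_meshVector_subset (R := R) hh m) le_rfl)).trans
            ((eLpNorm_cylinderSort_step_le (R := R) hh m hu₀m).trans (hshift _ _))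
        rwa [abs_of_pos (meshSize_pos hh m)] at h1
      · refine ⟨fun k => 1 / ((k : ℝ) + 1), fun _ => a i.castSucc, fun k => by positivity,
          tendsto_one_div_add_atTop_nhds_zero_nat, fun _ => ha0 _, tendsto_const_nhds,
          fun m => ?_⟩
        have h1 := hhor m i (1 / ((m : ℝ) + 1))
        rwa [abs_of_pos (by positivity)] at h1)
    (m := phaseVolume Ω u₀) (by simp only [hphase]; exact tendsto_const_nhds)
  have huS := mem_constraintSet_of_tendsto hu (fun k => hwVW (φ k)) hulim
  have henergy : energy Ω u ≤ energy Ω v := by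
    refine hule.trans (le_of_eq ?_)
    rw [energy_eq hΩ hg hg2, phaseVolume_congr_ae hu₀v]
    congr 1
    exact Finset.sum_congr rfl fun i _ => by
      rw [ENNReal.ofReal_toReal (hg2.apply_euclidean i).eLpNorm_ne_top]
  obtain ⟨u', hu'mono, hu'u⟩ := exists_ae_eq_isMonotoneLast (hu.1.integrable (by norm_num)) hV hW
    huS.2 fun x τ r hτ hr hx hxτ => by
      -- The largest multiple of the mesh size not exceeding `τ`: the sorted function increases
      -- along such shifts, and they converge to `τ`.
      let q : ℕ → ℝ := fun k => ⌊τ / meshSize h (φ k)⌋₊ * meshSize h (φ k)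
      have hqle : ∀ k, q k ≤ τ := fun k => by
        have := Nat.floor_le (div_nonneg hτ (meshSize_pos hh (φ k)).le)
        rwa [le_div_iff₀ (meshSize_pos hh (φ k))] at this
      have hqge : ∀ k, τ - meshSize h (φ k) ≤ q k := fun k => by
        have := Nat.lt_floor_add_one (τ / meshSize h (φ k))
        rw [div_lt_iff₀ (meshSize_pos hh (φ k))] at this
        simp only [q]
        linarith
      have hqlim : Tendsto q atTop (𝓝 τ) := by
        refine tendsto_of_tendsto_of_tendsto_of_le_of_le ?_ tendsto_const_nhds hqge hqle
        simpa using ((tendsto_meshSize h).comp hφ.tendsto_atTop).const_sub τ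
      have hvec : ∀ k, q k • EuclideanSpace.single (Fin.last d) (1 : ℝ)
          = ⌊τ / meshSize h (φ k)⌋₊ • meshVector d h (φ k) := fun k => by
        rw [meshVector, ← Nat.cast_smul_eq_nsmul ℝ, smul_smul]
      refine setIntegral_closedBall_le_of_tendsto hc (w := fun k => w (φ k))
        (fun k => (hwm (φ k)).aestronglyMeasurable) (hG.integrable (by norm_num))
        (fun k => hwG (φ k)) hulim hqlim
        (fun k => mul_nonneg (Nat.cast_nonneg _) (meshSize_pos hh (φ k)).le) hqle
        (fun k z hz hzq => ?_) hr hx hxτ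
      rw [hvec] at hzq ⊢
      exact cylinderSort_le_cylinderSort_add hh (φ k) u₀ hz hzq
  obtain ⟨hu'H, hu'E⟩ := memH1_and_energy_congr_ae hΩ hfin hu hu'u
  refine ⟨u', ⟨hu'H, ?_⟩, hu'E.le.trans henergy, hu'mono⟩
  filter_upwards [huS.2, hu'u] with x hx hx'
  rwa [hx']

theorem mainTheorem10 (d : ℕ) (R h : ℝ) (hR : 0 < R) (hh : 0 < h)
    (V W : EuclideanSpace ℝ (Fin (d + 1)) → ℝ)
    (hV : MemLp V 2 (volume.restrict (rightCylinder d R h)))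
    (hW : MemLp W 2 (volume.restrict (rightCylinder d R h)))
    (hS : (constraintSet (rightCylinder d R h) V W).Nonempty) :
    (∃ u ∈ constraintSet (rightCylinder d R h) V W,
      energy (rightCylinder d R h) u =
        ⨅ v ∈ constraintSet (rightCylinder d R h) V W, energy (rightCylinder d R h) v) ∧
    (IsMonotoneLast (rightCylinder d R h) V → IsMonotoneLast (rightCylinder d R h) W →
      ∃ u ∈ constraintSet (rightCylinder d R h) V W,
        (energy (rightCylinder d R h) u =
          ⨅ v ∈ constraintSet (rightCylinder d R h) V W, energy (rightCylinder d R h) v) ∧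
        IsMonotoneLast (rightCylinder d R h) u) := by
  obtain ⟨v, hv, hmin⟩ := exists_energy_eq_iInf (isOpen_rightCylinder d R h)
    (convex_rightCylinder d R h) (volume_rightCylinder_ne_top d R h) hV hW hS
  refine ⟨⟨v, hv, hmin⟩, fun hVm hWm => ?_⟩
  obtain ⟨u, hu, hle, hmono⟩ := exists_isMonotoneLast_energy_le hh hV hW hVm hWm hv
  exact ⟨u, hu, le_antisymm (hle.trans hmin.le) (iInf₂_le u hu), hmono⟩
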